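/- **Theorem (error estimate for the MPFA-L/G methods).** *Model.* Let $d\ge1$, let $\Omega\subset\mathbb R^d$ be a bounded connected open polytopal domain, partitioned (up to boundaries) into finitely many disjoint open polytopes $\Omega_1,\dots,\Omega_{N}\subset\Omega$, and let $K$ be a diffusion tensor equal on each $\Omega_i$ to a constant symmetric positive definite matrix. Let $f\in L^2(\Omega)$ and let $u\in H^1_0(\Omega)$ be the weak solution of $-\nabla\cdot(K\nabla u)=f$, i.e. $\int_\Omega K\nabla u\cdot\nabla v=\int_\Omega fv$ for all $v\in H^1_0(\Omega)$. *Mesh.* Let $\mathcal T_h$ be a finite family of disjoint open cells with $\overline\Omega=\bigcup_T\overline T$, each cell being contained in one $\Omega_i$, and let $\mathcal F_h$ be a finite family of disjoint faces (non-empty relatively open subsets of hyperplanes, with relative boundary of zero $(d-1)$-dimensional measure) such that $\partial T$ is the union of the closures of the faces $F\in\mathcal F_T$ of $T$, and each face either is an internal face, contained in $\Omega$ and belonging to exactly two cells, or is a boundary face, contained in $\partial\Omega$ and belonging to exactly one. Let $\mathcal T_F$ be the set of cells having $F$ as a face. Each $T$ is star-shaped with respect to a given point $x_T\in T$. For $F\in\mathcal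 F_T$, $n_{TF}$ is the unit normal to $F$ pointing out of $T$ and $d_{TF}=(x-x_T)\cdot n_{TF}$ ($x\in F$), which is assumed positive, is the orthogonal distance from $x_T$ to $F$. Let $|F|$ be the $(d-1)$-dimensional measure of $F$, $x_F$ its centre of mass, $h_T$ the diameter of $T$, $h=\max_T h_T$, and let $K_T$ be the value of $K$ in $T$ and $\underline\lambda_T$ its smallest eigenvalue. If $\mathcal T_F=\{T,T'\}$, let $d_F=d_{TF}+d_{T'F}$ and $\underline\lambda_F=\min(\underline\lambda_T,\underline\lambda_{T'})$; if $\mathcal T_F=\{T\}$, let $d_F=d_{TF}$, $\underline\lambda_F=\underline\lambda_T$ and $v_{T'}=0$. For $v=(v_T)_{T\in\mathcal T_h}$, set $$\|v\|_{1,\mathcal T_h,c}^2=\sum_{F\in\mathcal F_h}\underline\lambda_F|F|d_F\Big(\frac{v_T-v_{T'}}{d_F}\Big)^2,\qquad I_h^cu=(u(x_T))_{T\in\mathcal T_h}.$$ *Scheme.* A group $G$ is a set of $d$ faces of a same cell sharing a same vertex; for each group fix a cell $T_G$ having all faces of $G$. Let $\mathcal A_G$ be the $d\times d$ matrix and $\mathcal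 B_G(v)\in\mathbb R^d$ the vector with rows indexed by $F\in G$, where for an internal face ($\mathcal T_F=\{T_G,T\}$) $$(\mathcal A_G)_F=\Big(\tfrac{K_Tn_{TF}\cdot n_{TF}}{d_{TF}}(x_T-x_{T_G})+K_{T_G}n_{T_GF}+K_Tn_{TF}\Big)^t,\quad \mathcal B_G(v)_F=\tfrac{K_Tn_{TF}\cdot n_{TF}}{d_{TF}}(v_T-v_{T_G}),$$ and for a boundary face $$(\mathcal A_G)_F=\Big(\tfrac{K_{T_G}n_{T_GF}\cdot n_{T_GF}}{d_{T_GF}}(x_F-x_{T_G})\Big)^t,\quad \mathcal B_G(v)_F=-\tfrac{K_{T_G}n_{T_GF}\cdot n_{T_GF}}{d_{T_GF}}v_{T_G}.$$ When $\mathcal A_G$ is invertible, the group gradients of $v$ are $g=(\nabla v)^{G,F}_{T_G}=\mathcal A_G^{-1}\mathcal B_G(v)$ and, in the other cell $T$ of an internal face $F\in G$, $(\nabla v)^{G,F}_{T}=g+\beta n_{TF}$ with $\beta=\big(v_{T_G}-v_T+g\cdot(x_T-x_{T_G})\big)/d_{TF}$; these are the gradients of the piecewise affine functions with values $v_T$ at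 $x_T$ whose values and fluxes are continuous across the internal faces $F\in G$ (with value $0$ at $x_F$ on the boundary faces of $G$). Let $\mathcal G_F$ be the set of groups $G\ni F$ with $\mathcal A_G$ invertible, assumed non-empty, and let $(\theta_F^G)_{G\in\mathcal G_F}$ be non-negative weights of sum $1$. The fluxes are $$\mathcal F_{TF}(v)=\sum_{G\in\mathcal G_F}\theta_F^G\big(-|F|K_T(\nabla v)_T^{G,F}\cdot n_{TF}\big).$$ Let $u_h=(u_T)_T$ satisfy $\sum_{F\in\mathcal F_T}\mathcal F_{TF}(u_h)=\int_Tf$ for all $T\in\mathcal T_h$. *Assumptions and conclusion.* Let $\eta$ be such that $h_T/d_{TF}\le\eta$ for all $T$ and $F\in\mathcal F_T$, $d_{TF}/d_{T'F}\le\eta$ for all internal faces $F$ and both orderings of $\mathcal T_F=\{T,T'\}$, and $\sum_{G\in\mathcal G_F}\theta_F^G|\mathcal A_G^{-1}|\le\eta$ for all $F$ (induced Euclidean norm). Assume that $u\in C(\overline\Omega)$ and $u_{|\Omega_i}\in C^2(\overline{\Omega_i})$ for all $i$, and that, for some $\gamma>0$ and all $v$, $$\sum_{F\text{ internal},\,\mathcal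 T_F=\{T,T'\}}\mathcal F_{TF}(v)(v_T-v_{T'})+\sum_{F\text{ boundary},\,\mathcal T_F=\{T\}}\mathcal F_{TF}(v)v_T\ \ge\ \gamma\|v\|_{1,\mathcal T_h,c}^2 .$$ Then $$\|u_h-I_h^cu\|_{1,\mathcal T_h,c}\le C\,\gamma^{-1}\,\|u\|_{C^2}\,h,\qquad \|u\|_{C^2}=\max_i\|u\|_{C^2(\overline{\Omega_i})},$$ where $C>0$ depends only on $\Omega$, $\eta$ and $K$ (including its partition $(\Omega_i)_i$). -/

import Mathlib

open MeasureTheory Set Filter Topology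
open scoped ContDiff RealInnerProductSpace

noncomputable section

namespace MPFA

/-- The space `ℝ^d` with its Euclidean norm. -/
abbrev E (d : ℕ) : Type := EuclideanSpace ℝ (Fin d)

variable {d : ℕ}

/-- Action of a `d × d` matrix on a vector of `ℝ^d`. -/
def act (A : Matrix (Fin d) (Fin d) ℝ) (x : E d) : E d := Matrix.toEuclideanLin A x

/-- A polytopal open set: the interior of a finite union of convex polytopes. -/
def IsPolytopal (U : Set (E d)) : Prop :=
  ∃ S : Finset (Finset (E d)), U = interior (⋃ V ∈ S, convexHull ℝ (V : Set (E d)))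

/-! ### The model problem -/

/-- A connected polytopal domain `Ω`, a finite partition of it into polytopes, and a symmetric
positive definite matrix on each element of the partition. -/
structure Diffusion (d : ℕ) where
  /-- the domain -/
  Ω : Set (E d)
  Ω_polytopal : IsPolytopal Ω
  Ω_connected : IsConnected Ω
  /-- number of subdomains -/
  N : ℕ
  /-- the subdomains -/
  part : Fin N → Set (E d)
  part_polytopal : ∀ i, IsPolytopal (part i)
  part_subset : ∀ i, part i ⊆ Ω
  part_disjoint : ∀ i j, i ≠ j → Disjoint (part i) (part j)
  part_cover : closure Ω = ⋃ i, closure (part i)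
  /-- the value of the diffusion tensor on each subdomain -/
  tensor : Fin N → Matrix (Fin d) (Fin d) ℝ
  tensor_posDef : ∀ i, (tensor i).PosDef

namespace Diffusion

variable (D : Diffusion d)

/-- The piecewise constant diffusion field `K`. -/
def field (x : E d) : Matrix (Fin d) (Fin d) ℝ :=
  ∑ i, (D.part i).indicator (fun _ => D.tensor i) x

/-- The smallest eigenvalue of the diffusion tensor on a subdomain. -/
def minEig (i : Fin D.N) : ℝ := ⨅ j, (D.tensor_posDef i).isHermitian.eigenvalues j

end Diffusion

/-- A function of `C_c^∞(U)`. -/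
def IsTest (U : Set (E d)) (φ : E d → ℝ) : Prop :=
  ContDiff ℝ ∞ φ ∧ HasCompactSupport φ ∧ tsupport φ ⊆ U

/-- `g ∈ L²(U)^d` is the weak gradient of `v ∈ L²(U)` on `U`. -/
structure HasWeakGrad (U : Set (E d)) (v : E d → ℝ) (g : E d → E d) : Prop where
  memLp : MemLp v 2 (volume.restrict U)
  memLp_grad : MemLp g 2 (volume.restrict U)
  by_parts : ∀ φ, IsTest U φ → ∀ e : E d,
    ∫ x in U, v x * fderiv ℝ φ x e = -∫ x in U, ⟪g x, e⟫ * φ x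

/-- `v ∈ H¹₀(U)`, with weak gradient `g`: `v` is the limit in `H¹(U)` of functions
of `C_c^∞(U)`. -/
structure IsH10 (U : Set (E d)) (v : E d → ℝ) (g : E d → E d) : Prop where
  weakGrad : HasWeakGrad U v g
  approx : ∃ φ : ℕ → E d → ℝ, (∀ n, IsTest U (φ n)) ∧
    Tendsto (fun n => eLpNorm (fun x => φ n x - v x) 2 (volume.restrict U)) atTop (𝓝 0) ∧
    Tendsto (fun n => eLpNorm (fun x => gradient (φ n) x - g x) 2 (volume.restrict U)) atTop (𝓝 0)

/-- `u` is a weak solution of `-div (K ∇u) = f` in `Ω`, `u = 0` on `∂Ω`. -/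
def IsWeakSolution (D : Diffusion d) (f u : E d → ℝ) : Prop :=
  ∃ g, IsH10 D.Ω u g ∧ ∀ v w, IsH10 D.Ω v w →
    ∫ x in D.Ω, ⟪act (D.field x) (g x), w x⟫ = ∫ x in D.Ω, f x * v x

/-- The restriction of `u` to the open set `U` belongs to `C²(closure U)`: it is `C²` in `U` and
its derivatives of order at most two have continuous extensions to the closure. -/
def IsC2Closure (U : Set (E d)) (u : E d → ℝ) : Prop :=
  ContDiffOn ℝ 2 u U ∧ ∀ k : ℕ, k ≤ 2 → ∃ g : E d → E d [×k]→L[ℝ] ℝ,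
    ContinuousOn g (closure U) ∧ EqOn g (iteratedFDeriv ℝ k u) U

/-- The maximum over the subdomains of the `C²` norms of `u`. -/
def c2Norm (D : Diffusion d) (u : E d → ℝ) : ℝ :=
  ⨆ i : Fin D.N, ⨆ k : Fin 3, ⨆ x : D.part i, ‖iteratedFDeriv ℝ (k : ℕ) u (x : E d)‖

/-! ### Meshes -/

/-- A polytopal mesh of the domain, compliant with the partition, with cells labelled by `𝒯` and
faces labelled by `ℱ`. A face `F` belongs to the boundary of the cell `owner F` and, if it is an
internal face, of a second cell `T'` with `neighbor F = some T'`; boundary faces are those with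
`neighbor F = none`. (For internal faces, which of the two cells is called the owner is
arbitrary.) -/
structure Mesh (D : Diffusion d) (𝒯 ℱ : Type) where
  /-- the cells, as open sets -/
  cell : 𝒯 → Set (E d)
  cell_open : ∀ T, IsOpen (cell T)
  cell_disjoint : ∀ T T', T ≠ T' → Disjoint (cell T) (cell T')
  cell_cover : closure D.Ω = ⋃ T, closure (cell T)
  /-- the subdomain that contains a given cell -/
  region : 𝒯 → Fin D.N
  cell_subset : ∀ T, cell T ⊆ D.part (region T)
  /-- the faces, as relatively open subsets of hyperplanes -/
  face : ℱ → Set (E d)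
  face_nonempty : ∀ F, (face F).Nonempty
  face_disjoint : ∀ F F', F ≠ F' → Disjoint (face F) (face F')
  face_boundary_null : ∀ F, (μHE[d - 1] : Measure (E d)) (closure (face F) \ face F) = 0
  /-- the first cell of a face -/
  owner : ℱ → 𝒯
  /-- the second cell of a face, if there is one -/
  neighbor : ℱ → Option 𝒯
  neighbor_ne : ∀ F, neighbor F ≠ some (owner F)
  boundary_face : ∀ F, neighbor F = none → face F ⊆ frontier D.Ω
  internal_face : ∀ F, neighbor F ≠ none → face F ⊆ D.Ω
  cell_frontier : ∀ T, frontier (cell T) =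
    ⋃ F ∈ {F : ℱ | owner F = T ∨ neighbor F = some T}, closure (face F)
  /-- the cell points `x_T` -/
  pt : 𝒯 → E d
  pt_mem : ∀ T, pt T ∈ cell T
  /-- the cells are star-shaped with respect to their points -/
  cell_star : ∀ T, StarConvex ℝ (pt T) (cell T)
  /-- `normal T F` is the unit normal `n_{TF}` to `F` pointing out of `T` -/
  normal : 𝒯 → ℱ → E d
  normal_norm : ∀ T F, owner F = T ∨ neighbor F = some T → ‖normal T F‖ = 1
  normal_out : ∀ T F, owner F = T ∨ neighbor F = some T → ∀ x ∈ face F,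
    ∃ ε > 0, ∀ t ∈ Ioo 0 ε, x - t • normal T F ∈ cell T ∧ x + t • normal T F ∉ cell T
  /-- `dist T F` is the orthogonal distance `d_{TF}` from `x_T` to (the hyperplane of) `F` -/
  dist : 𝒯 → ℱ → ℝ
  dist_pos : ∀ T F, owner F = T ∨ neighbor F = some T → 0 < dist T F
  face_flat : ∀ T F, owner F = T ∨ neighbor F = some T → ∃ V : Set (E d), IsOpen V ∧
    face F = V ∩ {x | ⟪x - pt T, normal T F⟫ = dist T F}

namespace Mesh

variable {D : Diffusion d} {𝒯 ℱ : Type} (M : Mesh D 𝒯 ℱ)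

/-- `M.Bd T F` means that `F` is a face of the cell `T`. -/
def Bd (T : 𝒯) (F : ℱ) : Prop := M.owner F = T ∨ M.neighbor F = some T

open Classical in
/-- The set `ℱ_T` of the faces of the cell `T`. -/
def facesOf [Fintype ℱ] (T : 𝒯) : Finset ℱ := Finset.univ.filter (M.Bd T)

open Classical in
/-- For a face `F` of `T`, the cell on the other side of `F`, if there is one. -/
def across (T : 𝒯) (F : ℱ) : Option 𝒯 :=
  if T = M.owner F then M.neighbor F else some (M.owner F)

/-- The meshsize `h`: the maximal diameter of a cell. -/
def h : ℝ := ⨆ T, Metric.diam (M.cell T)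

/-- The value `K_T` of the diffusion tensor in the cell `T`. -/
def K (T : 𝒯) : Matrix (Fin d) (Fin d) ℝ := D.tensor (M.region T)

/-- The `(d-1)`-dimensional measure `|F|`. -/
def area (F : ℱ) : ℝ := (μHE[d - 1] : Measure (E d)).real (M.face F)

/-- The centre of mass `x_F` of a face. -/
def facePt (F : ℱ) : E d := ⨍ x in M.face F, x ∂(μHE[d - 1] : Measure (E d))

/-- `d_F = d_{TF} + d_{T'F}` for an internal face, `d_F = d_{TF}` for a boundary face. -/
def faceDist (F : ℱ) : ℝ :=
  M.dist (M.owner F) F + (M.neighbor F).elim 0 (fun T' => M.dist T' F)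

/-- The smallest eigenvalue of `K_T`, minimised over the cells around the face `F`. -/
def faceMinEig (F : ℱ) : ℝ :=
  (M.neighbor F).elim (D.minEig (M.region (M.owner F)))
    (fun T' => min (D.minEig (M.region (M.owner F))) (D.minEig (M.region T')))

/-- `v_T - v_{T'}` across the face `F`, with `T` the owner of `F` and `v_{T'} = 0` for a
boundary face. -/
def jump (v : 𝒯 → ℝ) (F : ℱ) : ℝ := v (M.owner F) - (M.neighbor F).elim 0 v

/-- The cell-centred discrete `H¹₀` norm. -/
def norm1 [Fintype ℱ] (v : 𝒯 → ℝ) : ℝ :=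
  √(∑ F, M.faceMinEig F * M.area F * M.faceDist F * (M.jump v F / M.faceDist F) ^ 2)

/-- The interpolant `I_h^c u`. -/
def interp (u : E d → ℝ) : 𝒯 → ℝ := fun T => u (M.pt T)

/-- `x` is a vertex of the mesh: for some face `F`, `x` lies in the closure of `F`, and near `x`
this closure is not invariant under translations along any line. -/
def IsVertex (x : E d) : Prop :=
  ∃ F, x ∈ closure (M.face F) ∧ ¬ ∃ w : E d, w ≠ 0 ∧ ∃ ε > 0, ∀ y ∈ Metric.ball x ε, ∀ t : ℝ,
    y + t • w ∈ Metric.ball x ε → (y ∈ closure (M.face F) ↔ y + t • w ∈ closure (M.face F))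

/-- A group of faces: `d` faces of a same cell which share a same vertex. -/
def IsGroup (G : Finset ℱ) : Prop :=
  G.card = d ∧ (∃ T, ∀ F ∈ G, M.Bd T F) ∧ ∃ x, M.IsVertex x ∧ ∀ F ∈ G, x ∈ closure (M.face F)

/-! ### Group gradients and fluxes -/

/-- `K_T n_{TF} · n_{TF} / d_{TF}`. -/
def trans (T : 𝒯) (F : ℱ) : ℝ :=
  ⟪act (M.K T) (M.normal T F), M.normal T F⟫ / M.dist T F

/-- The row indexed by `F` of the group matrix, `S = T_G` being the cell of the group. -/
def row (S : 𝒯) (F : ℱ) : E d :=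
  (M.across S F).elim (M.trans S F • (M.facePt F - M.pt S))
    (fun T => M.trans T F • (M.pt T - M.pt S)
      + act (M.K S) (M.normal S F) + act (M.K T) (M.normal T F))

/-- The entry indexed by `F` of the right-hand side of the group system. -/
def rhs (S : 𝒯) (v : 𝒯 → ℝ) (F : ℱ) : ℝ :=
  (M.across S F).elim (M.trans S F * (-v S)) (fun T => M.trans T F * (v T - v S))

/-- The group matrix `A_G` (its rows are indexed by the `d` faces of `G`). -/
def groupMatrix (S : 𝒯) (G : Finset ℱ) : Matrix G (Fin d) ℝ :=
  Matrix.of fun F j => M.row S F j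

/-- The group matrix as an operator between Euclidean spaces. -/
def groupOp (S : 𝒯) (G : Finset ℱ) : E d →L[ℝ] EuclideanSpace ℝ G :=
  LinearMap.toContinuousLinearMap (Matrix.toEuclideanLin (M.groupMatrix S G))

/-- The right-hand side `B_G(v)`. -/
def groupRhs (S : 𝒯) (G : Finset ℱ) (v : 𝒯 → ℝ) : EuclideanSpace ℝ G :=
  WithLp.toLp 2 fun F => M.rhs S v F

/-- The solution `A_G⁻¹ B_G(v)` of the group system (meaningful when `A_G` is invertible): the
group gradient in the cell `S = T_G`. -/
def baseGrad (S : 𝒯) (G : Finset ℱ) (v : 𝒯 → ℝ) : E d :=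
  (M.groupOp S G).inverse (M.groupRhs S G v)

open Classical in
/-- The group gradient in a cell `T` next to the face `F ∈ G`. For `T ≠ T_G`, it differs from the
one in `S = T_G` by the multiple of the normal which makes the piecewise affine reconstruction
continuous through `F`. See `groupGrad_value` and the lemmas that follow it. -/
def groupGrad (S : 𝒯) (G : Finset ℱ) (v : 𝒯 → ℝ) (T : 𝒯) (F : ℱ) : E d :=
  if T = S then M.baseGrad S G v
  else M.baseGrad S G v +
    ((v S - v T + ⟪M.baseGrad S G v, M.pt T - M.pt S⟫) / M.dist T F) • M.normal T F

open Classical in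
/-- The set `𝒢_F` of the groups that contain `F` and whose matrix is invertible; `TG G` is the
cell selected for the group `G`. -/
def groups [Fintype ℱ] (TG : Finset ℱ → 𝒯) (F : ℱ) : Finset (Finset ℱ) :=
  Finset.univ.filter fun G => F ∈ G ∧ M.IsGroup G ∧ (M.groupOp (TG G) G).IsInvertible

/-- The numerical flux of `v` through the face `F` of the cell `T`: the combination with weights
`θ F G` of the fluxes `-|F| K_T (∇v)_T^{G,F} · n_{TF}`. -/
def flux [Fintype ℱ] (TG : Finset ℱ → 𝒯) (θ : ℱ → Finset ℱ → ℝ) (T : 𝒯) (F : ℱ)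
    (v : 𝒯 → ℝ) : ℝ :=
  ∑ G ∈ M.groups TG F,
    θ F G * (-(M.area F * ⟪act (M.K T) (M.groupGrad (TG G) G v T F), M.normal T F⟫))

end Mesh

/-- The data of an MPFA-L/G scheme on a mesh: a cell whose boundary contains all faces of `G`, for
each group `G`, and, for each face, the coefficients of a convex combination of the groups. -/
structure Scheme {D : Diffusion d} {𝒯 ℱ : Type} [Fintype ℱ] (M : Mesh D 𝒯 ℱ) where
  /-- the selected cells `T_G` -/
  TG : Finset ℱ → 𝒯
  TG_spec : ∀ G, M.IsGroup G → ∀ F ∈ G, M.Bd (TG G) F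
  /-- the coefficients -/
  θ : ℱ → Finset ℱ → ℝ
  θ_nonneg : ∀ F, ∀ G ∈ M.groups TG F, 0 ≤ θ F G
  θ_sum : ∀ F, ∑ G ∈ M.groups TG F, θ F G = 1

namespace Scheme

variable {D : Diffusion d} {𝒯 ℱ : Type} [Fintype ℱ] {M : Mesh D 𝒯 ℱ} (S : Scheme M)

/-- The numerical fluxes of the scheme. -/
def flux (T : 𝒯) (F : ℱ) (v : 𝒯 → ℝ) : ℝ := M.flux S.TG S.θ T F v

/-- Coercivity of the fluxes with constant `γ`. -/
def Coercive (γ : ℝ) : Prop :=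
  ∀ v : 𝒯 → ℝ, γ * M.norm1 v ^ 2 ≤ ∑ F, S.flux (M.owner F) F v * M.jump v F

/-- `v` solves the finite volume scheme with source term `f`. -/
def IsSolution (f : E d → ℝ) (v : 𝒯 → ℝ) : Prop :=
  ∀ T, ∑ F ∈ M.facesOf T, S.flux T F v = ∫ x in M.cell T, f x

/-- The parameter `η` bounds the regularity parameters of the mesh and the group matrices
(the norms of the inverses being operator norms for the Euclidean norms). -/
structure Regular (η : ℝ) : Prop where
  diam_le : ∀ T F, M.Bd T F → Metric.diam (M.cell T) / M.dist T F ≤ η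
  dist_le : ∀ T T' F, M.Bd T F → M.Bd T' F → T ≠ T' → M.dist T F / M.dist T' F ≤ η
  inverse_le : ∀ F, ∑ G ∈ M.groups S.TG F, S.θ F G * ‖(M.groupOp (S.TG G) G).inverse‖ ≤ η

end Scheme

/-! ### The group gradients have the required properties -/

namespace Mesh

variable {D : Diffusion d} {𝒯 ℱ : Type} (M : Mesh D 𝒯 ℱ)

theorem across_ne {S T : 𝒯} {F : ℱ} (hT : M.across S F = some T) : T ≠ S := by
  unfold across at hT
  have hn := M.neighbor_ne F
  split_ifs at hT with hc
  · rintro rfl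
    rw [hT, hc] at hn
    exact hn rfl
  · rintro rfl
    exact hc (Option.some_injective _ hT).symm

theorem across_bd {S T : 𝒯} {F : ℱ} (hT : M.across S F = some T) : M.Bd T F := by
  unfold across at hT
  split_ifs at hT with hc
  · exact Or.inr hT
  · exact Or.inl (Option.some_injective _ hT)

/-- In the cell of the group, the group gradients do not depend on the face. -/
theorem groupGrad_self (S : 𝒯) (G : Finset ℱ) (v : 𝒯 → ℝ) (F : ℱ) :
    M.groupGrad S G v S F = M.baseGrad S G v := by
  simp [groupGrad]

/-- The piecewise affine reconstruction is continuous through the internal faces of the group. -/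
theorem groupGrad_value {S T : 𝒯} {F : ℱ} (G : Finset ℱ) (v : 𝒯 → ℝ)
    (hT : M.across S F = some T) {x : E d} (hx : x ∈ M.face F) :
    v T + ⟪M.groupGrad S G v T F, x - M.pt T⟫ = v S + ⟪M.groupGrad S G v S F, x - M.pt S⟫ := by
  have hb := M.across_bd hT
  obtain ⟨V, -, hV⟩ := M.face_flat T F hb
  have hd := M.dist_pos T F hb
  rw [hV] at hx
  have hx2 : ⟪x - M.pt T, M.normal T F⟫ = M.dist T F := hx.2
  rw [groupGrad_self, groupGrad, if_neg (M.across_ne hT), inner_add_left, real_inner_smul_left,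
    real_inner_comm, real_inner_comm _ (M.normal T F), hx2, div_mul_cancel₀ _ hd.ne',
    real_inner_comm]
  simp only [inner_sub_right]
  ring

theorem act_symm {A : Matrix (Fin d) (Fin d) ℝ} (hA : A.IsHermitian) (x y : E d) :
    ⟪act A x, y⟫ = ⟪x, act A y⟫ :=
  Matrix.isSymmetric_toEuclideanLin_iff.mpr hA x y

theorem groupOp_baseGrad {S : 𝒯} {G : Finset ℱ} (v : 𝒯 → ℝ)
    (hG : (M.groupOp S G).IsInvertible) {F : ℱ} (hF : F ∈ G) :
    ⟪M.row S F, M.baseGrad S G v⟫ = M.rhs S v F := by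
  have h1 : M.groupOp S G (M.baseGrad S G v) = M.groupRhs S G v := by
    obtain ⟨e, he⟩ := hG
    simp [baseGrad, ← he]
  have h2 := congrArg (fun z : EuclideanSpace ℝ G => z ⟨F, hF⟩) h1
  simp only [groupOp, groupRhs, groupMatrix, LinearMap.coe_toContinuousLinearMap',
    Matrix.toLpLin_apply] at h2
  rw [← h2]
  simp [Matrix.mulVec, dotProduct, PiLp.inner_apply, mul_comm]

/-- The fluxes are continuous through the internal faces of the group. -/
theorem groupGrad_flux {S T : 𝒯} {F : ℱ} {G : Finset ℱ} (v : 𝒯 → ℝ)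
    (hG : (M.groupOp S G).IsInvertible) (hF : F ∈ G) (hT : M.across S F = some T) :
    ⟪act (M.K T) (M.groupGrad S G v T F), M.normal T F⟫
      + ⟪act (M.K S) (M.groupGrad S G v S F), M.normal S F⟫ = 0 := by
  have hd := M.dist_pos T F (M.across_bd hT)
  have h := M.groupOp_baseGrad v hG hF
  have hK : ∀ T, (M.K T).IsHermitian := fun T => (D.tensor_posDef _).isHermitian
  rw [groupGrad_self, groupGrad, if_neg (M.across_ne hT)]
  simp only [row, rhs, hT, Option.elim_some, inner_add_left, real_inner_smul_left] at h
  rw [act_symm (hK T), act_symm (hK S), inner_add_left, real_inner_smul_left,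
    real_inner_comm, real_inner_comm _ (act (M.K T) (M.normal T F)),
    real_inner_comm _ (M.normal T F), real_inner_comm _ (M.baseGrad S G v),
    real_inner_comm (act (M.K S) (M.normal S F))]
  rw [real_inner_comm (M.baseGrad S G v)] at h
  simp only [trans] at h
  simp only [real_inner_comm, inner_sub_right] at h ⊢
  field_simp at h ⊢
  linarith

/-- On the boundary faces of the group, the affine reconstruction vanishes at the centre
of mass. -/
theorem groupGrad_boundary {S : 𝒯} {F : ℱ} {G : Finset ℱ} (v : 𝒯 → ℝ)
    (hG : (M.groupOp S G).IsInvertible) (hF : F ∈ G) (hS : M.Bd S F)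
    (hT : M.across S F = none) :
    v S + ⟪M.groupGrad S G v S F, M.facePt F - M.pt S⟫ = 0 := by
  have hd := M.dist_pos S F hS
  have h := M.groupOp_baseGrad v hG hF
  have hn : M.normal S F ≠ 0 := by
    have := M.normal_norm S F hS
    intro h0
    simp [h0] at this
  have hpos : 0 < ⟪act (M.K S) (M.normal S F), M.normal S F⟫ := by
    rw [real_inner_comm]
    have := (D.tensor_posDef (M.region S)).dotProduct_mulVec_pos
      (x := (M.normal S F).ofLp) (by simpa using hn)
    simpa [act, K, Matrix.toLpLin_apply, EuclideanSpace.inner_eq_star_dotProduct,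
      dotProduct_comm] using this
  have ht : 0 < M.trans S F := div_pos hpos hd
  rw [groupGrad_self]
  simp only [row, rhs, hT, Option.elim_none, real_inner_smul_left] at h
  have h3 := mul_left_cancel₀ ht.ne' h
  rw [real_inner_comm, h3]
  ring

end Mesh

end MPFA

end

/-! Let `e = u_h - I_h^c u`, and let the exact flux through `F` out of `T` be minus the integral
over `F` of `K ∇u · n_TF`, where `∇u` is the trace taken from `T`. The exact fluxes and the
numerical fluxes of `u_h` have the same sum `∫_T f` over the faces of each cell, and both families
are conservative. Discrete integration by parts against `e` therefore gives the same value for both.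
By linearity, the flux form evaluated at `(e, e)` is the sum over the faces of (exact flux minus
flux of `I_h^c u`) times the jump of `e`. Coercivity bounds it below by `γ ‖e‖²`. Consistency of the
fluxes (`abs_flux_sub_le`, error `O(h) |F|`) and Cauchy-Schwarz with `∑ |F| d_F ≤ d |Ω|`
(`sum_area_mul_jump_le`) bound it above by a multiple of `h ‖e‖`.

Consistency rests on `inner_row_sub_rhs`. At a point `p` of `F`, the traces of `∇u` from the two
cells have opposite outward fluxes and differ by a multiple of the normal, so inserting the trace in
the row of `F` leaves only a difference of two second-order Taylor remainders. Its coefficient is of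
order `1 / d_TF` and cells have diameter at most `η d_TF`, so the residual is `O(h)`. The inverse of
the group matrix transfers this to the gradients, and the weighted bound on the inverses suffices
because the fluxes use the same weights.

What remains is to extract pointwise facts on the faces from the weak formulation, for cells that
are merely star-shaped. Balance in a cell (`integral_cell_eq_neg_sum_flux`): the cell is, up to a
null set, the disjoint union of the cones with apex `x_T` over its faces. Its radial function is
Lipschitz and linear on each cone, with gradient `n_TF / d_TF`. A cut-off of this function is an
admissible Lipschitz test function, and it concentrates on the faces as its transition layer
shrinks. Flux continuity (`WeakDiv.normal_eq`): a field with integrable weak divergence and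
one-sided limits at a point of a hyperplane has no jump of its normal component there. Applied to `u
n` extended by zero outside `Ω`, the same lemma gives `u = 0` on the boundary faces. These arguments
are carried out at the points of a face that lie in no other closed face (`IsGood`), which are
almost all its points. -/

namespace MPFA

open scoped Pointwise

variable {d : ℕ}

/-! ### Orthogonal coordinates along a hyperplane -/

/-- The hyperplane orthogonal to `n`. -/
noncomputable abbrev Perp (n : E d) : Submodule ℝ (E d) := (ℝ ∙ n)ᗮ

theorem inner_perp {n : E d} (a : Perp n) : ⟪(a : E d), n⟫ = 0 := by
  rw [real_inner_comm]
  exact Submodule.mem_orthogonal_singleton_iff_inner_right.1 a.2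

theorem finrank_perp {n : E d} (hn : ‖n‖ = 1) : Module.finrank ℝ (Perp n) = d - 1 := by
  have hn0 : n ≠ 0 := by rintro rfl; simp at hn
  have h := (ℝ ∙ n).finrank_add_finrank_orthogonal
  rw [finrank_span_singleton hn0, finrank_euclideanSpace_fin] at h
  unfold Perp
  omega

theorem one_le_of_norm_eq_one {n : E d} (hn : ‖n‖ = 1) : 1 ≤ d := by
  rcases Nat.eq_zero_or_pos d with rfl | h
  · have : n = 0 := Subsingleton.elim _ _
    simp [this] at hn
  · exact h

/-- Coordinates along the hyperplane orthogonal to `n`, and along `n`, with origin `p`. -/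
noncomputable def coord (p n : E d) (z : Perp n × ℝ) : E d := p + ((z.1 : E d) + z.2 • n)

theorem inner_coord {p n : E d} (hn : ‖n‖ = 1) (z : Perp n × ℝ) :
    ⟪coord p n z - p, n⟫ = z.2 := by
  simp [coord, inner_add_left, inner_perp, real_inner_smul_left, hn]

theorem continuous_coord (p n : E d) : Continuous (coord p n) := by
  unfold coord; fun_prop

/-- The coordinates as a homeomorphism. -/
noncomputable def coordHomeo (p : E d) {n : E d} (hn : ‖n‖ = 1) : (Perp n × ℝ) ≃ₜ E d where
  toFun := coord p n
  invFun y := ((Perp n).orthogonalProjectionOnto (y - p), ⟪y - p, n⟫)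
  left_inv z := by
    refine Prod.ext ?_ (inner_coord hn z)
    have h2 : (Perp n).orthogonalProjectionOnto (z.2 • n) = 0 := by
      rw [Submodule.orthogonalProjectionOnto_eq_zero_iff]
      exact Submodule.smul_mem _ _
        (Submodule.le_orthogonal_orthogonal _ (Submodule.mem_span_singleton_self n))
    simp [coord, h2]
  right_inv y := by
    have h := (ℝ ∙ n).starProjection_add_starProjection_orthogonal (y - p)
    have h1 : (ℝ ∙ n).starProjection (y - p) = ⟪y - p, n⟫ • n := by
      rw [Submodule.starProjection_unit_singleton ℝ hn, real_inner_comm]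
    rw [h1] at h
    simp only [coord]
    rw [add_comm _ (⟪y - p, n⟫ • n)]
    rw [Submodule.starProjection_apply] at h
    rw [h]; abel
  continuous_toFun := continuous_coord p n
  continuous_invFun := by fun_prop

theorem measurableEmbedding_coord (p : E d) {n : E d} (hn : ‖n‖ = 1) :
    MeasurableEmbedding (coord p n) :=
  (coordHomeo p hn).measurableEmbedding

/-- The chart is a composition of measure-preserving maps: a swap, the identification of `ℝ` with
the line spanned by `n`, the orthogonal decomposition, and a translation. -/
theorem measurePreserving_coord (p : E d) {n : E d} (hn : ‖n‖ = 1) :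
    MeasurePreserving (coord p n) (volume.prod volume) volume := by
  have h1 : MeasurePreserving (Prod.swap : Perp n × ℝ → ℝ × Perp n)
      (volume.prod volume) (volume.prod volume) := Measure.measurePreserving_swap
  have h2 : MeasurePreserving
      (Prod.map (LinearIsometryEquiv.toSpanUnitSingleton (𝕜 := ℝ) n hn) (id : Perp n → Perp n))
      (volume.prod volume) (volume.prod volume) :=
    (LinearIsometryEquiv.measurePreserving _).prod (MeasurePreserving.id _)
  have h3 := WithLp.volume_preserving_toLp (ℝ ∙ n) (Perp n)
  have h4 := ((ℝ ∙ n).orthogonalDecomposition.symm).measurePreserving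
  have h5 := measurePreserving_add_left (volume : Measure (E d)) p
  convert h5.comp (h4.comp (h3.comp (h2.comp h1))) using 1
  ext1 z
  simp [coord, add_comm]

theorem isometry_coord_slice (p n : E d) (c : ℝ) : Isometry fun a : Perp n => coord p n (a, c) := by
  intro a b
  simp [coord, edist_dist, dist_eq_norm]

/-- An isometry carries the `(d-1)`-dimensional Hausdorff measure to its restriction to the range,
and on the `(d-1)`-dimensional space `Perp n` this measure is Lebesgue. Face integrals thus become
Lebesgue integrals, to which Fubini and scaling apply. -/
theorem map_coord_slice {n : E d} (hn : ‖n‖ = 1) (p : E d) (c : ℝ) :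
    (volume : Measure (Perp n)).map (fun a => coord p n (a, c)) =
      (μHE[d - 1] : Measure (E d)).restrict {x | ⟪x - p, n⟫ = c} := by
  have h := (isometry_coord_slice p n c).map_euclideanHausdorffMeasure (d := d - 1)
  rw [← finrank_perp hn, InnerProductSpace.euclideanHausdorffMeasure_eq_volume,
    finrank_perp hn] at h
  rw [h]
  congr 1
  ext x
  constructor
  · rintro ⟨a, rfl⟩
    exact inner_coord hn _
  · intro hx
    refine ⟨((coordHomeo p hn).symm x).1, ?_⟩
    have hx' : ((coordHomeo p hn).symm x).2 = c := hx
    rw [← hx']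
    exact (coordHomeo p hn).apply_symm_apply x

theorem measurableEmbedding_coord_slice (p n : E d) (c : ℝ) :
    MeasurableEmbedding fun a : Perp n => coord p n (a, c) :=
  (isometry_coord_slice p n c).isClosedEmbedding.measurableEmbedding

/-- The Hausdorff measure on a hyperplane is the Lebesgue measure. -/
theorem measure_slice {n : E d} (hn : ‖n‖ = 1) {p : E d} {c : ℝ} {F : Set (E d)}
    (hF : F ⊆ {x | ⟪x - p, n⟫ = c}) :
    (μHE[d - 1] : Measure (E d)) F = volume {a : Perp n | coord p n (a, c) ∈ F} := by
  have h := congrArg (fun μ => μ F) (map_coord_slice hn p c)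
  simp only [(measurableEmbedding_coord_slice p n c).map_apply] at h
  rw [Measure.restrict_eq_self _ hF] at h
  exact h.symm

theorem integral_slice {n : E d} (hn : ‖n‖ = 1) {p : E d} {c : ℝ} {F : Set (E d)}
    (hF : F ⊆ {x | ⟪x - p, n⟫ = c}) (hFm : MeasurableSet F) (g : E d → ℝ) :
    ∫ z in F, g z ∂(μHE[d - 1] : Measure (E d)) =
      ∫ a in {a : Perp n | coord p n (a, c) ∈ F}, g (coord p n (a, c)) := by
  have h : (μHE[d - 1] : Measure (E d)).restrict F =
      ((volume : Measure (Perp n)).map (fun a => coord p n (a, c))).restrict F := by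
    rw [map_coord_slice hn p c, Measure.restrict_restrict hFm, inter_eq_self_of_subset_left hF]
  rw [h, (measurableEmbedding_coord_slice p n c).setIntegral_map]
  rfl

theorem volume_hyperplane {n : E d} (hn : ‖n‖ = 1) (p : E d) (c : ℝ) :
    volume {x : E d | ⟪x - p, n⟫ = c} = 0 := by
  have hm : MeasurableSet {x : E d | ⟪x - p, n⟫ = c} :=
    (isClosed_eq (by fun_prop) continuous_const).measurableSet
  rw [← (measurePreserving_coord p hn).measure_preimage hm.nullMeasurableSet]
  have : coord p n ⁻¹' {x : E d | ⟪x - p, n⟫ = c} = univ ×ˢ {c} := by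
    ext z
    simp [inner_coord hn]
  rw [this, Measure.prod_prod]
  simp

/-! ### Cones -/

/-- The open cone with apex `p` and base `F`. -/
def cone (p : E d) (F : Set (E d)) : Set (E d) :=
  {y | ∃ r ∈ Ioo (0 : ℝ) 1, ∃ z ∈ F, y = p + r • (z - p)}

/-- The height `s` of a point of the cone determines its ratio `r = s / c`, hence the only possible
point of the base on its ray. -/
theorem coord_mem_cone {n : E d} (hn : ‖n‖ = 1) {p : E d} {c : ℝ} (hc : 0 < c) {F : Set (E d)}
    (hF : F ⊆ {x | ⟪x - p, n⟫ = c}) (a : Perp n) (s : ℝ) :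
    coord p n (a, s) ∈ cone p F ↔ s ∈ Ioo 0 c ∧ coord p n ((s / c)⁻¹ • a, c) ∈ F := by
  constructor
  · rintro ⟨r, hr, z, hz, h⟩
    have h1 : ⟪z - p, n⟫ = c := hF hz
    have h2 : s = r * c := by
      have := inner_coord (p := p) hn (a, s)
      rw [h] at this
      simpa [real_inner_smul_left, h1] using this.symm
    have hr0 := hr.1.ne'
    refine ⟨⟨by rw [h2]; exact mul_pos hr.1 hc, by rw [h2]; nlinarith [hr.2]⟩, ?_⟩
    have h3 : s / c = r := by rw [h2]; field_simp
    rw [h3]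
    convert hz using 1
    simp only [coord, add_right_inj] at h
    have h4 : z - p = r⁻¹ • ((a : E d) + s • n) := by rw [h, smul_smul, inv_mul_cancel₀ hr0, one_smul]
    have h5 : z = p + r⁻¹ • ((a : E d) + s • n) := by rw [← h4]; abel
    rw [h5, h2]
    simp only [coord, smul_add, smul_smul, Submodule.coe_smul]
    rw [← mul_assoc, inv_mul_cancel₀ hr0, one_mul]
  · rintro ⟨hs, hz⟩
    have hsc : 0 < s / c := div_pos hs.1 hc
    refine ⟨s / c, ⟨hsc, (div_lt_one hc).2 hs.2⟩, _, hz, ?_⟩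
    simp only [coord, add_sub_cancel_left, smul_add, smul_smul, Submodule.coe_smul]
    rw [mul_inv_cancel₀ hsc.ne', one_smul, div_mul_cancel₀ _ hc.ne']

theorem measurableSet_coord_cone {n : E d} (hn : ‖n‖ = 1) {p : E d} {c : ℝ} (hc : 0 < c)
    {F : Set (E d)} (hF : F ⊆ {x | ⟪x - p, n⟫ = c}) (hFm : MeasurableSet F) :
    MeasurableSet (coord p n ⁻¹' cone p F) := by
  have : coord p n ⁻¹' cone p F =
      (Prod.snd ⁻¹' Ioo 0 c) ∩ {z | coord p n ((z.2 / c)⁻¹ • z.1, c) ∈ F} := by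
    ext ⟨a, s⟩
    simp [coord_mem_cone hn hc hF]
  rw [this]
  refine (measurable_snd measurableSet_Ioo).inter ?_
  have hm : Measurable fun z : Perp n × ℝ => coord p n ((z.2 / c)⁻¹ • z.1, c) := by
    refine (continuous_coord p n).measurable.comp ?_
    refine Measurable.prodMk ?_ measurable_const
    exact ((measurable_snd.div_const c).inv).smul measurable_fst
  exact hm hFm

theorem measurableSet_cone {n : E d} (hn : ‖n‖ = 1) {p : E d} {c : ℝ} (hc : 0 < c)
    {F : Set (E d)} (hF : F ⊆ {x | ⟪x - p, n⟫ = c}) (hFm : MeasurableSet F) :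
    MeasurableSet (cone p F) :=
  ((coordHomeo p hn).toMeasurableEquiv.measurableSet_preimage).1
    (measurableSet_coord_cone hn hc hF hFm)

theorem cone_slice {n : E d} (hn : ‖n‖ = 1) {p : E d} {c : ℝ} (hc : 0 < c) {F : Set (E d)}
    (hF : F ⊆ {x | ⟪x - p, n⟫ = c}) {s : ℝ} (hs : s ∈ Ioo 0 c) :
    {a : Perp n | coord p n (a, s) ∈ cone p F} = (s / c) • {a : Perp n | coord p n (a, c) ∈ F} := by
  ext a
  have hsc : s / c ≠ 0 := (div_pos hs.1 hc).ne'
  rw [mem_ofPred_eq, coord_mem_cone hn hc hF, mem_smul_set_iff_inv_smul_mem₀ hsc]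
  simp [hs.1, hs.2]

/-- Fubini along `n`: the slice at height `s` is the base scaled by `s / c`, and `(s / c)^(d-1)`
integrates to `c / d`. -/
theorem volume_cone {n : E d} (hn : ‖n‖ = 1) {p : E d} {c : ℝ} (hc : 0 < c) {F : Set (E d)}
    (hF : F ⊆ {x | ⟪x - p, n⟫ = c}) (hFm : MeasurableSet F) :
    volume (cone p F) = ENNReal.ofReal (c / d) * (μHE[d - 1] : Measure (E d)) F := by
  have hd := one_le_of_norm_eq_one hn
  rw [← (measurePreserving_coord p hn).measure_preimage
    (measurableSet_cone hn hc hF hFm).nullMeasurableSet,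
    Measure.prod_apply_symm (measurableSet_coord_cone hn hc hF hFm)]
  have h1 : ∀ s : ℝ, volume ((fun a : Perp n => (a, s)) ⁻¹' (coord p n ⁻¹' cone p F)) =
      (Ioo 0 c).indicator (fun s => ENNReal.ofReal ((s / c) ^ (d - 1)) *
        (μHE[d - 1] : Measure (E d)) F) s := by
    intro s
    change volume {a : Perp n | coord p n (a, s) ∈ cone p F} = _
    by_cases hs : s ∈ Ioo 0 c
    · rw [indicator_of_mem hs, cone_slice hn hc hF hs, Measure.addHaar_smul, finrank_perp hn,
        measure_slice hn hF, abs_of_nonneg (pow_nonneg (div_pos hs.1 hc).le _)]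
    · rw [indicator_of_notMem hs]
      have : {a : Perp n | coord p n (a, s) ∈ cone p F} = ∅ := by
        ext a
        simp [coord_mem_cone hn hc hF, -mem_Ioo, hs]
      rw [this, measure_empty]
  simp only [h1]
  rw [lintegral_indicator measurableSet_Ioo, lintegral_mul_const _ (by fun_prop)]
  congr 1
  rw [← ofReal_integral_eq_lintegral_ofReal]
  · congr 1
    rw [← integral_Ioc_eq_integral_Ioo, ← intervalIntegral.integral_of_le hc.le,
      intervalIntegral.integral_comp_div (fun x => x ^ (d - 1)) hc.ne', integral_pow]
    have : d - 1 + 1 = d := by omega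
    have hd0 : (d : ℝ) ≠ 0 := by positivity
    rw [zero_div, div_self hc.ne', this]
    have h5 : ((d - 1 : ℕ) : ℝ) + 1 = d := by exact_mod_cast this
    rw [h5]
    simp only [one_pow, smul_eq_mul]
    rw [zero_pow (by omega)]
    field_simp
    ring
  · have : Continuous fun s : ℝ => (s / c) ^ (d - 1) := by fun_prop
    exact (this.integrableOn_Icc (a := 0) (b := c)).mono_set Ioo_subset_Icc_self
  · refine (ae_restrict_iff' measurableSet_Ioo).2 (Eventually.of_forall fun s hs => ?_)
    exact pow_nonneg (div_pos hs.1 hc).le _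

/-- The same slicing as for the volume, with the integral over each slice pulled back to the base by
the homothety. -/
theorem integral_cone {n : E d} (hn : ‖n‖ = 1) {p : E d} {c : ℝ} (hc : 0 < c) {F : Set (E d)}
    (hF : F ⊆ {x | ⟪x - p, n⟫ = c}) (hFm : MeasurableSet F) {w : E d → ℝ}
    (hw : IntegrableOn w (cone p F)) :
    ∫ y in cone p F, w y =
      ∫ s in Ioo 0 c, (s / c) ^ (d - 1) *
        ∫ z in F, w (p + (s / c) • (z - p)) ∂(μHE[d - 1] : Measure (E d)) := by
  have hme := measurableEmbedding_coord p hn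
  have hmp := measurePreserving_coord p hn
  have hCm := measurableSet_coord_cone hn hc hF hFm
  rw [← hmp.setIntegral_preimage_emb hme, ← integral_indicator hCm]
  have hw' : Integrable ((coord p n ⁻¹' cone p F).indicator fun x => w (coord p n x))
      (volume.prod volume) := by
    rw [integrable_indicator_iff hCm]
    exact (hmp.integrableOn_comp_preimage hme).2 hw
  rw [integral_prod_symm _ hw', ← integral_indicator measurableSet_Ioo]
  congr 1
  ext s
  by_cases hs : s ∈ Ioo 0 c
  · have hsc := div_pos hs.1 hc
    have hms : MeasurableSet {a : Perp n | coord p n (a, s) ∈ cone p F} :=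
      measurable_prodMk_right hCm
    have h2 : (fun a : Perp n => (coord p n ⁻¹' cone p F).indicator
        (fun x => w (coord p n x)) (a, s)) =
        {a : Perp n | coord p n (a, s) ∈ cone p F}.indicator (fun a => w (coord p n (a, s))) := by
      ext a; simp only [indicator]; rfl
    rw [indicator_of_mem hs, h2, integral_indicator hms, cone_slice hn hc hF hs,
      integral_slice hn hF hFm]
    have h3 := Measure.setIntegral_comp_smul_of_pos (volume : Measure (Perp n))
      (fun a => w (coord p n (a, s))) {a : Perp n | coord p n (a, c) ∈ F} hsc
    rw [finrank_perp hn, smul_eq_mul] at h3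
    have h4 : ∀ a : Perp n, p + (s / c) • (coord p n (a, c) - p) = coord p n ((s / c) • a, s) := by
      intro a
      simp only [coord, add_sub_cancel_left, smul_add, smul_smul, Submodule.coe_smul]
      rw [div_mul_cancel₀ _ hc.ne']
    simp only [h4]
    rw [h3, ← mul_assoc, mul_inv_cancel₀ (pow_pos hsc _).ne', one_mul]
  · rw [indicator_of_notMem hs]
    rw [← integral_zero (Perp n) ℝ]
    congr 1
    ext a
    apply indicator_of_notMem
    simp only [mem_preimage, coord_mem_cone hn hc hF]
    tauto

end MPFA

namespace MPFA

variable {d : ℕ}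

/-! ### Weak formulations -/

theorem inner_gradient_left (φ : E d → ℝ) (x v : E d) : ⟪gradient φ x, v⟫ = fderiv ℝ φ x v := by
  rw [gradient, InnerProductSpace.toDual_symm_apply]

theorem inner_gradient_right (φ : E d → ℝ) (x v : E d) : ⟪v, gradient φ x⟫ = fderiv ℝ φ x v := by
  rw [real_inner_comm, inner_gradient_left]

theorem IsTest.contDiff_one {U : Set (E d)} {φ : E d → ℝ} (hφ : IsTest U φ) : ContDiff ℝ 1 φ :=
  hφ.1.of_le (by exact_mod_cast le_top)

theorem IsTest.continuous_gradient {U : Set (E d)} {φ : E d → ℝ} (hφ : IsTest U φ) :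
    Continuous (gradient φ) :=
  (LinearIsometryEquiv.continuous _).comp (hφ.contDiff_one.continuous_fderiv one_ne_zero)

theorem IsTest.hasCompactSupport_gradient {U : Set (E d)} {φ : E d → ℝ} (hφ : IsTest U φ) :
    HasCompactSupport (gradient φ) :=
  (hφ.2.1.fderiv ℝ).comp_left (g := (InnerProductSpace.toDual ℝ (E d)).symm) (map_zero _)

theorem fderiv_eq_zero_of_notMem_tsupport {φ : E d → ℝ} {x : E d} (hx : x ∉ tsupport φ) :
    fderiv ℝ φ x = 0 :=
  image_eq_zero_of_notMem_tsupport fun h => hx (tsupport_fderiv_subset ℝ h)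

theorem IsTest.mono {U V : Set (E d)} {φ : E d → ℝ} (hφ : IsTest U φ) (h : U ⊆ V) : IsTest V φ :=
  ⟨hφ.1, hφ.2.1, hφ.2.2.trans h⟩

/-- Integration by parts against a smooth compactly supported function. -/
theorem integral_mul_fderiv_test {U : Set (E d)} (hU : IsOpen U) {u : E d → ℝ}
    (hu : ContDiffOn ℝ 1 u U) {φ : E d → ℝ} (hφ : IsTest U φ) (e : E d) :
    ∫ x, u x * fderiv ℝ φ x e = -∫ x, fderiv ℝ u x e * φ x := by
  have hu' : ContinuousOn (fun x => fderiv ℝ u x e) U :=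
    (hu.continuousOn_fderiv_of_isOpen hU le_rfl).clm_apply continuousOn_const
  have hφ' : Continuous fun x => fderiv ℝ φ x e :=
    (hφ.contDiff_one.continuous_fderiv one_ne_zero).clm_apply continuous_const
  -- The factor `a` is controlled only on `U`; the product is continuous on the whole space because
  -- `b` is supported in a compact subset of `U`.
  have key : ∀ {a b : E d → ℝ}, ContinuousOn a U → Continuous b → tsupport b ⊆ tsupport φ →
      Integrable fun x => a x * b x := by
    intro a b ha hb hs
    have hs' : tsupport (fun x => a x * b x) ⊆ tsupport φ :=
      (closure_mono (Function.support_mul_subset_right a b)).trans hs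
    refine Continuous.integrable_of_hasCompactSupport ?_
      (hφ.2.1.of_isClosed_subset (isClosed_tsupport _) hs')
    exact (ha.mul hb.continuousOn).continuous_of_tsupport_subset hU (hs'.trans hφ.2.2)
  have hs : tsupport (fun x => fderiv ℝ φ x e) ⊆ tsupport φ := by
    refine closure_minimal (fun x hx => ?_) (isClosed_tsupport _)
    by_contra h
    exact hx (by simp [fderiv_eq_zero_of_notMem_tsupport h])
  have := integral_bilinear_hasFDerivAt_right_eq_neg_left_of_integrable (μ := volume)
    (f := u) (f' := fderiv ℝ u) (g := φ) (g' := fderiv ℝ φ) (v := e)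
    (B := ContinuousLinearMap.mul ℝ ℝ)
    (key hu' hφ.contDiff_one.continuous subset_rfl) (key hu.continuousOn hφ' hs)
    (key hu.continuousOn hφ.contDiff_one.continuous subset_rfl)
    (fun x hx => ((hu.contDiffAt (hU.mem_nhds (hφ.2.2 hx))).differentiableAt
      one_ne_zero).hasFDerivAt)
    (fun x _ => (hφ.contDiff_one.differentiable one_ne_zero x).hasFDerivAt)
  simpa using this

theorem setIntegral_mul_test {U : Set (E d)} {φ : E d → ℝ} (hφ : IsTest U φ) (a : E d → ℝ) :
    ∫ x in U, a x * φ x = ∫ x, a x * φ x :=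
  setIntegral_eq_integral_of_forall_compl_eq_zero fun x hx => by
    simp [image_eq_zero_of_notMem_tsupport fun h => hx (hφ.2.2 h)]

theorem setIntegral_mul_fderiv_test {U : Set (E d)} {φ : E d → ℝ} (hφ : IsTest U φ)
    (a : E d → ℝ) (e : E d) :
    ∫ x in U, a x * fderiv ℝ φ x e = ∫ x, a x * fderiv ℝ φ x e :=
  setIntegral_eq_integral_of_forall_compl_eq_zero fun x hx => by
    simp [fderiv_eq_zero_of_notMem_tsupport fun h => hx (hφ.2.2 h)]

/-- Functions of `C_c^∞(U)` belong to `H¹₀(U)`. -/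
theorem IsTest.isH10 {U : Set (E d)} {φ : E d → ℝ} (hφ : IsTest U φ) :
    IsH10 U φ (gradient φ) := by
  refine ⟨⟨?_, ?_, fun ψ hψ e => ?_⟩, fun _ => φ, fun _ => hφ, by simp, by simp⟩
  · exact (hφ.1.continuous.memLp_of_hasCompactSupport hφ.2.1).restrict _
  · exact (hφ.continuous_gradient.memLp_of_hasCompactSupport hφ.hasCompactSupport_gradient).restrict _
  · rw [setIntegral_mul_fderiv_test hψ, setIntegral_mul_test hψ,
      integral_mul_fderiv_test isOpen_univ hφ.contDiff_one.contDiffOn (hψ.mono (subset_univ _))]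
    simp only [inner_gradient_left]

/-- A weak gradient coincides with the gradient where the function is smooth. -/
theorem HasWeakGrad.ae_eq {Ω U : Set (E d)} {u : E d → ℝ} {g : E d → E d}
    (h : HasWeakGrad Ω u g) (hU : IsOpen U) (hUΩ : U ⊆ Ω) (hu : ContDiffOn ℝ 1 u U) :
    ∀ᵐ x, x ∈ U → g x = gradient u x := by
  have hloc : LocallyIntegrableOn g U := by
    have h1 : MemLp g 2 (volume.restrict U) :=
      h.memLp_grad.mono_measure (Measure.restrict_mono hUΩ le_rfl)
    have h2 : LocallyIntegrable g (volume.restrict U) := h1.locallyIntegrable (by norm_num)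
    intro x hx
    refine ⟨Metric.closedBall x 1 ∩ U, inter_mem (mem_nhdsWithin_of_mem_nhds
      (Metric.closedBall_mem_nhds x one_pos)) self_mem_nhdsWithin, ?_⟩
    have h3 := h2.integrableOn_isCompact (isCompact_closedBall x 1)
    rwa [IntegrableOn, Measure.restrict_restrict Metric.isClosed_closedBall.measurableSet] at h3
  have key : ∀ e : E d, ∀ᵐ x, x ∈ U → ⟪g x, e⟫ - fderiv ℝ u x e = 0 := by
    intro e
    have hg : LocallyIntegrableOn (fun x => ⟪g x, e⟫) U := by
      intro x hx
      obtain ⟨s, hs, hi⟩ := hloc x hx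
      exact ⟨s, hs, (hi.inner_const e)⟩
    have hu' : LocallyIntegrableOn (fun x => fderiv ℝ u x e) U :=
      ((hu.continuousOn_fderiv_of_isOpen hU le_rfl).clm_apply
        continuousOn_const).locallyIntegrableOn hU.measurableSet
    refine hU.ae_eq_zero_of_integral_contDiff_smul_eq_zero (hg.sub hu') ?_
    intro ψ h1 h2 h3
    have hψ : IsTest U ψ := ⟨h1, h2, h3⟩
    have hb := h.by_parts ψ (hψ.mono hUΩ) e
    rw [setIntegral_mul_fderiv_test (hψ.mono hUΩ), setIntegral_mul_test (hψ.mono hUΩ),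
      integral_mul_fderiv_test hU hu hψ, neg_inj] at hb
    have hi : ∀ a : E d → ℝ, LocallyIntegrableOn a U → Integrable fun x => a x * ψ x := by
      intro a ha
      have hc : IntegrableOn a (tsupport ψ) := ha.integrableOn_compact_subset h3 h2
      have : IntegrableOn (fun x => a x * ψ x) (tsupport ψ) :=
        hc.mul_continuousOn h1.continuous.continuousOn h2
      refine (integrableOn_iff_integrable_of_support_subset ?_).1 this
      exact (Function.support_mul_subset_right _ _).trans subset_closure
    have : ∀ x, ψ x • (⟪g x, e⟫ - fderiv ℝ u x e) = ⟪g x, e⟫ * ψ x - fderiv ℝ u x e * ψ x := by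
      intro x; simp only [smul_eq_mul]; ring
    simp only [this]
    rw [integral_sub (hi _ hg) (hi _ hu'), hb, sub_self]
  -- The exceptional null set in `key` depends on the direction, so only the finitely many basis
  -- directions are used.
  have : ∀ᵐ x, ∀ i, x ∈ U → ⟪g x, EuclideanSpace.basisFun (Fin d) ℝ i⟫ -
      fderiv ℝ u x (EuclideanSpace.basisFun (Fin d) ℝ i) = 0 :=
    ae_all_iff.2 fun i => key _
  filter_upwards [this] with x hx hxU
  refine InnerProductSpace.ext_inner_right_basis (𝕜 := ℝ)
    (EuclideanSpace.basisFun (Fin d) ℝ).toBasis fun i => ?_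
  rw [OrthonormalBasis.coe_toBasis, inner_gradient_left]
  linarith [hx i hxU]

/-- For functions of `H¹₀`, the test functions of the integration by parts need not vanish at
the boundary. -/
theorem IsH10.by_parts {Ω : Set (E d)} {u : E d → ℝ} {g : E d → E d}
    (h : IsH10 Ω u g) {ψ : E d → ℝ} (hψ : IsTest univ ψ) (e : E d) :
    ∫ x in Ω, u x * fderiv ℝ ψ x e = -∫ x in Ω, ⟪g x, e⟫ * ψ x := by
  obtain ⟨φ, hφ, h1, h2⟩ := h.approx
  have hψ' : Continuous fun x => fderiv ℝ ψ x e :=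
    (hψ.contDiff_one.continuous_fderiv one_ne_zero).clm_apply continuous_const
  have hψs : HasCompactSupport fun x => fderiv ℝ ψ x e :=
    (hψ.2.1.fderiv ℝ).comp_left (g := fun L : E d →L[ℝ] ℝ => L e) rfl
  have hm : MemLp (fun x => fderiv ℝ ψ x e) 2 (volume.restrict Ω) :=
    (hψ'.memLp_of_hasCompactSupport hψs).restrict _
  have hm' : MemLp ψ 2 (volume.restrict Ω) :=
    (hψ.1.continuous.memLp_of_hasCompactSupport hψ.2.1).restrict _
  have hlim : ∀ {a : ℕ → E d → ℝ} {b c : E d → ℝ}, (∀ n, MemLp (a n) 2 (volume.restrict Ω)) →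
      MemLp b 2 (volume.restrict Ω) → MemLp c 2 (volume.restrict Ω) →
      Tendsto (fun n => eLpNorm (fun x => a n x - b x) 2 (volume.restrict Ω)) atTop (𝓝 0) →
      Tendsto (fun n => ∫ x in Ω, a n x * c x) atTop (𝓝 (∫ x in Ω, b x * c x)) := by
    intro a b c ha hb hc ht
    have hi : ∀ n, Integrable (fun x => a n x * c x) (volume.restrict Ω) := fun n =>
      (ha n).integrable_mul hc
    have hib : Integrable (fun x => b x * c x) (volume.restrict Ω) := hb.integrable_mul hc
    refine tendsto_integral_of_L1 _ hib.aestronglyMeasurable (Eventually.of_forall hi) ?_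
    have h0 : Tendsto (fun n => eLpNorm (fun x => a n x - b x) 2 (volume.restrict Ω) *
        eLpNorm c 2 (volume.restrict Ω)) atTop (𝓝 0) := by
      have := ENNReal.Tendsto.mul_const (b := eLpNorm c 2 (volume.restrict Ω)) ht
        (Or.inr hc.2.ne)
      simpa using this
    refine tendsto_of_tendsto_of_tendsto_of_le_of_le tendsto_const_nhds h0
      (fun _ => zero_le) fun n => ?_
    have := eLpNorm_le_eLpNorm_mul_eLpNorm_of_nnnorm (p := 2) (q := 2) (r := 1)
      ((ha n).sub hb).1 hc.1 (fun s t => s * t) 1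
      (Eventually.of_forall fun x => by simp)
    rw [ENNReal.coe_one, one_mul, eLpNorm_one_eq_lintegral_enorm] at this
    refine le_trans (le_of_eq ?_) this
    congr 1
    ext x
    congr 1
    simp only [Pi.sub_apply]
    ring
  have hφm : ∀ n, MemLp (φ n) 2 (volume.restrict Ω) := fun n => (hφ n).isH10.weakGrad.memLp
  have hφg : ∀ n, MemLp (fun x => ⟪gradient (φ n) x, e⟫) 2 (volume.restrict Ω) := fun n =>
    (hφ n).isH10.weakGrad.memLp_grad.inner_const e
  have hgm : MemLp (fun x => ⟪g x, e⟫) 2 (volume.restrict Ω) := h.weakGrad.memLp_grad.inner_const e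
  have l1 := hlim hφm h.weakGrad.memLp hm h1
  have l2 := hlim hφg hgm hm' (by
    have h0 : Tendsto (fun n => ENNReal.ofReal ‖e‖ *
        eLpNorm (fun x => gradient (φ n) x - g x) 2 (volume.restrict Ω)) atTop (𝓝 0) := by
      have := ENNReal.Tendsto.const_mul (a := ENNReal.ofReal ‖e‖) h2 (Or.inr ENNReal.ofReal_ne_top)
      simpa using this
    refine tendsto_of_tendsto_of_tendsto_of_le_of_le tendsto_const_nhds h0
      (fun _ => zero_le) fun n => ?_
    refine eLpNorm_le_mul_eLpNorm_of_ae_le_mul (Eventually.of_forall fun x => ?_) 2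
    rw [← inner_sub_left, mul_comm]
    exact norm_inner_le_norm _ _)
  -- For the approximations, the compact support in `Ω` belongs to `φ n`, so nothing is required of
  -- `ψ` at the boundary; the identity then passes to the `L²` limit.
  have l3 : ∀ n, ∫ x in Ω, φ n x * fderiv ℝ ψ x e = -∫ x in Ω, ⟪gradient (φ n) x, e⟫ * ψ x := by
    intro n
    rw [setIntegral_eq_integral_of_forall_compl_eq_zero, integral_mul_fderiv_test isOpen_univ
      (hφ n).contDiff_one.contDiffOn hψ, setIntegral_eq_integral_of_forall_compl_eq_zero]
    · simp only [inner_gradient_left]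
    · intro x hx
      simp [fderiv_eq_zero_of_notMem_tsupport fun h => hx ((hφ n).2.2 h)]
    · intro x hx
      simp [image_eq_zero_of_notMem_tsupport fun h => hx ((hφ n).2.2 h)]
  simp only [l3] at l1
  exact tendsto_nhds_unique l1 l2.neg

/-- The equation `-div q = f` holds weakly in `U`. -/
def WeakDiv (U : Set (E d)) (q : E d → E d) (f : E d → ℝ) : Prop :=
  ∀ φ, IsTest U φ → ∫ x in U, fderiv ℝ φ x (q x) = ∫ x in U, f x * φ x

open scoped Convolution in
-- The difference quotients of the smooth convolution are those of `φ` integrated against a fixed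
-- kernel, and for Lipschitz `φ` these integrals converge to the integral of the line derivative.
theorem fderiv_mollify (ρ : ContDiffBump (0 : E d)) {φ : E d → ℝ} {C : NNReal}
    (hφ : LipschitzWith C φ) (x v : E d) :
    fderiv ℝ (ρ.normed volume ⋆[ContinuousLinearMap.lsmul ℝ ℝ, volume] φ) x v =
      (ρ.normed volume ⋆[ContinuousLinearMap.lsmul ℝ ℝ, volume] fun y => lineDeriv ℝ φ y v) x := by
  have hs : ContDiff ℝ 1 (ρ.normed volume ⋆[ContinuousLinearMap.lsmul ℝ ℝ, volume] φ) :=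
    ρ.hasCompactSupport_normed.contDiff_convolution_left (n := 1) _ ρ.contDiff_normed
      hφ.continuous.locallyIntegrable
  have h1 := ((hs.differentiable one_ne_zero x).hasFDerivAt.hasLineDerivAt
    v).tendsto_slope_zero_right
  have hg : Integrable fun z => ρ.normed volume (x - z) :=
    (ρ.contDiff_normed (n := 0)).continuous.integrable_of_hasCompactSupport
      ρ.hasCompactSupport_normed |>.comp_sub_left x
  have h2 := hφ.integral_inv_smul_sub_mul_tendsto_integral_lineDeriv_mul hg v
  have h3 : (ρ.normed volume ⋆[ContinuousLinearMap.lsmul ℝ ℝ, volume]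
      fun y => lineDeriv ℝ φ y v) x = ∫ z, lineDeriv ℝ φ z v * ρ.normed volume (x - z) := by
    rw [convolution_eq_swap]
    simp [mul_comm]
  rw [h3]
  refine tendsto_nhds_unique h1 (h2.congr fun t => ?_)
  have hi : ∀ w, Integrable fun y => ρ.normed volume y * φ (w - y) := fun w =>
    Continuous.integrable_of_hasCompactSupport
      ((ρ.contDiff_normed (n := 0)).continuous.mul (hφ.continuous.comp (by fun_prop)))
      ρ.hasCompactSupport_normed.mul_right
  simp only [convolution_def, ContinuousLinearMap.lsmul_apply, smul_eq_mul]
  rw [← integral_sub (hi _) (hi _), ← integral_const_mul, ← integral_sub_left_eq_self _ _ x]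
  congr 1
  ext y
  have : x + t • v - y = x - y + t • v := by abel
  rw [sub_sub_cancel, this]
  ring

open scoped Convolution in
/-- In the weak formulation, Lipschitz test functions are allowed. -/
theorem WeakDiv.lipschitz {U : Set (E d)} (hU : IsOpen U) {q : E d → E d} {f : E d → ℝ}
    (h : WeakDiv U q f) (hq : IntegrableOn q U) (hf : IntegrableOn f U) {φ : E d → ℝ} {C : NNReal}
    (hφ : LipschitzWith C φ) (hφc : HasCompactSupport φ) (hφU : tsupport φ ⊆ U) :
    ∫ x in U, fderiv ℝ φ x (q x) = ∫ x in U, f x * φ x := by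
  obtain ⟨δ, hδ, hδU⟩ := hφc.isCompact.exists_cthickening_subset_open hU hφU
  have hpos : ∀ k : ℕ, 0 < δ / (k + 1) := fun k => by positivity
  let ρ : ℕ → ContDiffBump (0 : E d) := fun k =>
    ⟨δ / (k + 1) / 2, δ / (k + 1), half_pos (hpos k), half_lt_self (hpos k)⟩
  let L := ContinuousLinearMap.lsmul ℝ ℝ (E := ℝ)
  let Φ : ℕ → E d → ℝ := fun k => (ρ k).normed volume ⋆[L, volume] φ
  have hΦ : ∀ k, IsTest U (Φ k) := by
    intro k
    have hsub : tsupport (Φ k) ⊆ Metric.cthickening δ (tsupport φ) := by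
      refine closure_minimal ((support_convolution_subset L).trans ?_)
        Metric.isClosed_cthickening
      rintro _ ⟨a, ha, b, hb, rfl⟩
      rw [ContDiffBump.support_normed_eq] at ha
      refine Metric.mem_cthickening_of_dist_le _ b _ _ (subset_closure hb) ?_
      have : ‖a‖ < δ / (k + 1) := by simpa using ha
      rw [dist_eq_norm, add_sub_cancel_right]
      refine this.le.trans (div_le_self hδ.le ?_)
      linarith [(Nat.cast_nonneg k : (0 : ℝ) ≤ k)]
    refine ⟨?_, ?_, hsub.trans hδU⟩
    · exact (ρ k).hasCompactSupport_normed.contDiff_convolution_left (n := ⊤) _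
        (ρ k).contDiff_normed hφ.continuous.locallyIntegrable
    · exact hφc.isCompact.cthickening.of_isClosed_subset (isClosed_tsupport _) hsub
  have hr : Tendsto (fun k => (ρ k).rOut) atTop (𝓝 0) := by
    have := tendsto_one_div_add_atTop_nhds_zero_nat (𝕜 := ℝ)
    have := this.const_mul δ
    simpa [ρ, div_eq_mul_inv] using this
  -- A bounded ratio of the radii is required for the almost everywhere convergence of mollified
  -- locally integrable functions.
  have hr' : ∀ᶠ k in atTop, (ρ k).rOut ≤ 2 * (ρ k).rIn :=
    Eventually.of_forall fun k => by simp only [ρ]; linarith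
  -- Averaging preserves the Lipschitz constant, which makes `C * ‖q‖` a dominating function for all
  -- `k`.
  have hΦlip : ∀ k, LipschitzWith C (Φ k) := by
    intro k
    refine LipschitzWith.of_dist_le_mul fun x y => ?_
    have hi : ∀ w, Integrable fun y => (ρ k).normed volume y * φ (w - y) := fun w =>
      Continuous.integrable_of_hasCompactSupport
        (((ρ k).contDiff_normed (n := 0)).continuous.mul (hφ.continuous.comp (by fun_prop)))
        (ρ k).hasCompactSupport_normed.mul_right
    rw [dist_eq_norm]
    simp only [Φ, convolution_def, L, ContinuousLinearMap.lsmul_apply, smul_eq_mul]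
    rw [← integral_sub (hi _) (hi _)]
    calc ‖∫ a, ((ρ k).normed volume a * φ (x - a) - (ρ k).normed volume a * φ (y - a))‖
        ≤ ∫ a, (ρ k).normed volume a * (C * dist x y) := by
          refine norm_integral_le_of_norm_le ((ρ k).integrable_normed.mul_const _)
            (Eventually.of_forall fun a => ?_)
          rw [← mul_sub, norm_mul, Real.norm_of_nonneg ((ρ k).nonneg_normed a)]
          refine mul_le_mul_of_nonneg_left ?_ ((ρ k).nonneg_normed a)
          have := hφ.dist_le_mul (x - a) (y - a)
          rwa [dist_sub_right, dist_eq_norm] at this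
      _ = C * dist x y := by
          rw [integral_mul_const, (ρ k).integral_normed, one_mul]
  have hlim : ∀ x, Tendsto (fun k => Φ k x) atTop (𝓝 (φ x)) := fun x =>
    ContDiffBump.convolution_tendsto_right_of_continuous hr hφ.continuous x
  -- Convergence holds almost everywhere along each basis vector; where `φ` is differentiable
  -- (almost everywhere, by Rademacher), linearity extends it to every `v`.
  have hlim' : ∀ᵐ x, ∀ v, Tendsto (fun k => fderiv ℝ (Φ k) x v) atTop (𝓝 (fderiv ℝ φ x v)) := by
    have h1 : ∀ᵐ x, ∀ i, Tendsto (fun k => fderiv ℝ (Φ k) x (EuclideanSpace.basisFun (Fin d) ℝ i))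
        atTop (𝓝 (lineDeriv ℝ φ x (EuclideanSpace.basisFun (Fin d) ℝ i))) := by
      refine ae_all_iff.2 fun i => ?_
      filter_upwards [ContDiffBump.ae_convolution_tendsto_right_of_locallyIntegrable (μ := volume) hr hr'
        (hφ.locallyIntegrable_lineDeriv (EuclideanSpace.basisFun (Fin d) ℝ i))] with x hx
      refine hx.congr fun k => ?_
      exact (fderiv_mollify (ρ k) hφ x _).symm
    filter_upwards [h1, hφ.ae_differentiableAt] with x hx hd v
    rw [← (EuclideanSpace.basisFun (Fin d) ℝ).sum_repr v]
    simp only [map_sum, map_smul]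
    refine tendsto_finsetSum _ fun i _ => (Tendsto.const_smul ?_ _)
    rw [← hd.lineDeriv_eq_fderiv]
    exact hx i
  have e1 : Tendsto (fun k => ∫ x in U, fderiv ℝ (Φ k) x (q x)) atTop
      (𝓝 (∫ x in U, fderiv ℝ φ x (q x))) := by
    refine tendsto_integral_of_dominated_convergence (fun x => C * ‖q x‖) (fun k => ?_)
      (hq.norm.const_mul _) (fun k => Eventually.of_forall fun x => ?_) ?_
    · exact isBoundedBilinearMap_apply.continuous.comp_aestronglyMeasurable
        (((hΦ k).contDiff_one.continuous_fderiv one_ne_zero).aestronglyMeasurable.prodMk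
        hq.aestronglyMeasurable)
    · exact (ContinuousLinearMap.le_opNorm _ _).trans (mul_le_mul_of_nonneg_right
        (norm_fderiv_le_of_lipschitz ℝ (hΦlip k)) (norm_nonneg _))
    · exact ae_restrict_of_ae (hlim'.mono fun x hx => hx (q x))
  have e2 : Tendsto (fun k => ∫ x in U, f x * Φ k x) atTop (𝓝 (∫ x in U, f x * φ x)) := by
    obtain ⟨B, hB⟩ := hφc.exists_bound_of_continuous hφ.continuous
    refine tendsto_integral_of_dominated_convergence (fun x => ‖f x‖ * (B + C * δ)) (fun k => ?_)
      (hf.norm.mul_const _) (fun k => Eventually.of_forall fun x => ?_) ?_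
    · exact hf.aestronglyMeasurable.mul (hΦ k).1.continuous.aestronglyMeasurable
    · rw [norm_mul]
      refine mul_le_mul_of_nonneg_left ?_ (norm_nonneg _)
      have h1 : dist (Φ k x) (φ x) ≤ C * δ := by
        refine ContDiffBump.dist_normed_convolution_le hφ.continuous.aestronglyMeasurable
          fun y hy => ?_
        refine (hφ.dist_le_mul y x).trans (mul_le_mul_of_nonneg_left ?_ C.2)
        have : dist y x < δ / (k + 1) := hy
        refine this.le.trans (div_le_self hδ.le ?_)
        linarith [(Nat.cast_nonneg k : (0 : ℝ) ≤ k)]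
      have h2 := norm_le_norm_add_norm_sub' (Φ k x) (φ x)
      rw [dist_eq_norm] at h1
      linarith [hB x]
    · exact Eventually.of_forall fun x => (hlim x).const_mul _
  refine tendsto_nhds_unique e1 (e2.congr fun k => (h _ (hΦ k)).symm)

end MPFA

namespace MPFA

variable {d : ℕ}

/-! ### Continuity of the normal component across a hyperplane -/

theorem proj_coord (p : E d) {n : E d} (hn : ‖n‖ = 1) (z : Perp n × ℝ) :
    (Perp n).orthogonalProjectionOnto (coord p n z - p) = z.1 :=
  congrArg Prod.fst ((coordHomeo p hn).left_inv z)

theorem integral_coord_mul (p : E d) {n : E d} (hn : ‖n‖ = 1) (χ : Perp n → ℝ) (ψ : ℝ → ℝ) :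
    ∫ y, χ ((Perp n).orthogonalProjectionOnto (y - p)) * ψ ⟪y - p, n⟫ =
      (∫ x, χ x) * ∫ s, ψ s := by
  rw [← (measurePreserving_coord p hn).integral_comp (measurableEmbedding_coord p hn)]
  simp only [proj_coord p hn, inner_coord hn]
  exact integral_prod_mul χ ψ

theorem integrable_coord_mul (p : E d) {n : E d} (hn : ‖n‖ = 1) {χ : Perp n → ℝ} {ψ : ℝ → ℝ}
    (hχ : Integrable χ) (hψ : Integrable ψ) :
    Integrable fun y => χ ((Perp n).orthogonalProjectionOnto (y - p)) * ψ ⟪y - p, n⟫ := by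
  rw [← (measurePreserving_coord p hn).integrable_comp_emb (measurableEmbedding_coord p hn)]
  simp only [Function.comp_def, proj_coord p hn, inner_coord hn]
  exact hχ.mul_prod hψ

theorem norm_sub_le_coord (p : E d) {n : E d} (hn : ‖n‖ = 1) (y : E d) :
    ‖y - p‖ ≤ ‖(Perp n).orthogonalProjectionOnto (y - p)‖ + |⟪y - p, n⟫| := by
  have h : coord p n ((Perp n).orthogonalProjectionOnto (y - p), ⟪y - p, n⟫) = y :=
    (coordHomeo p hn).right_inv y
  calc ‖y - p‖ = ‖(((Perp n).orthogonalProjectionOnto (y - p) : Perp n) : E d)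
        + ⟪y - p, n⟫ • n‖ := by
        conv_lhs => rw [← h]
        simp [coord]
    _ ≤ _ := (norm_add_le _ _).trans (by simp [norm_smul, hn])

/-- On each half-line the derivative integrates to plus or minus `ζ 0 = 1`. This is how a test
function concentrated on a hyperplane detects a jump. -/
theorem integral_deriv_bump (ζ : ContDiffBump (0 : ℝ)) (α β : ℝ) :
    ∫ t, deriv ζ t * (if t < 0 then α else β) = α - β := by
  have hs : HasCompactSupport (deriv ζ) := ζ.hasCompactSupport.deriv
  have hc : Continuous (deriv ζ) := (ζ.contDiff (n := 1)).continuous_deriv le_rfl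
  have hi : Integrable (deriv ζ) := hc.integrable_of_hasCompactSupport hs
  have h0 : ζ 0 = 1 := ζ.one_of_mem_closedBall (by simp [ζ.rIn_pos.le])
  have hm : Integrable fun t => deriv ζ t * (if t < 0 then α else β) := by
    refine hi.mul_bdd (c := max |α| |β|) ?_ (Eventually.of_forall fun t => ?_)
    · exact (Measurable.ite measurableSet_Iio measurable_const measurable_const).aestronglyMeasurable
    · split_ifs
      exacts [le_max_left _ _, le_max_right _ _]
  rw [← setIntegral_univ, ← Iio_union_Ici (a := (0 : ℝ)),
    setIntegral_union (by simp) measurableSet_Ici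
      hm.integrableOn hm.integrableOn]
  have e1 : ∫ t in Iio (0 : ℝ), deriv ζ t * (if t < 0 then α else β) = α := by
    rw [setIntegral_congr_fun (g := fun t => deriv ζ t * α) measurableSet_Iio
      fun t ht => by simp [mem_Iio.1 ht], integral_mul_const, ← integral_Iic_eq_integral_Iio,
      ζ.hasCompactSupport.integral_Iic_deriv_eq (ζ.contDiff (n := 1)), h0, one_mul]
  have e2 : ∫ t in Ici (0 : ℝ), deriv ζ t * (if t < 0 then α else β) = -β := by
    rw [setIntegral_congr_fun (g := fun t => deriv ζ t * β) measurableSet_Ici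
      fun t ht => by simp [not_lt.2 (mem_Ici.1 ht)], integral_mul_const, integral_Ici_eq_integral_Ioi,
      ζ.hasCompactSupport.integral_Ioi_deriv_eq (ζ.contDiff (n := 1)), h0, neg_one_mul]
  rw [e1, e2, sub_eq_add_neg]

theorem exists_bound_fderiv_bump {W : Type*} [NormedAddCommGroup W] [InnerProductSpace ℝ W]
    [FiniteDimensional ℝ W] (χ : ContDiffBump (0 : W)) :
    ∃ C, 0 ≤ C ∧ ∀ x v, ‖fderiv ℝ χ x v‖ ≤ C * ‖v‖ := by
  obtain ⟨C, hC⟩ := (χ.hasCompactSupport.fderiv ℝ).exists_bound_of_continuous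
    ((χ.contDiff (n := 1)).continuous_fderiv one_ne_zero)
  exact ⟨C, (norm_nonneg _).trans (hC 0), fun x v => (ContinuousLinearMap.le_opNorm _ _).trans
    (mul_le_mul_of_nonneg_right (hC x) (norm_nonneg _))⟩

/-- If `-div q = f` weakly around a point of a hyperplane, then the normal component of `q` is
continuous across the hyperplane. -/
theorem WeakDiv.normal_eq {U : Set (E d)} (hU : IsOpen U) {q : E d → E d} {f : E d → ℝ}
    (h : WeakDiv U q f) (hq : IntegrableOn q U) (hf : IntegrableOn f U) {p n : E d}
    (hn : ‖n‖ = 1) (hp : p ∈ U) {a b : E d}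
    (ha : Tendsto q (𝓝[{y | ⟪y - p, n⟫ < 0}] p) (𝓝 a))
    (hb : Tendsto q (𝓝[{y | 0 < ⟪y - p, n⟫}] p) (𝓝 b)) : ⟪a, n⟫ = ⟪b, n⟫ := by
  obtain ⟨ζ, hζ⟩ : ∃ ζ : ContDiffBump (0 : ℝ), ζ.rOut = 1 :=
    ⟨⟨1 / 2, 1, by norm_num, by norm_num⟩, rfl⟩
  let Z : ℝ := ∫ t, |deriv ζ t|
  have hζc : Continuous (deriv ζ) := (ζ.contDiff (n := 1)).continuous_deriv le_rfl
  have hζi : Integrable (deriv ζ) := hζc.integrable_of_hasCompactSupport ζ.hasCompactSupport.deriv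
  have hZ : 0 ≤ Z := integral_nonneg fun _ => abs_nonneg _
  suffices hε : ∀ ε > 0, |⟪a, n⟫ - ⟪b, n⟫| ≤ ε * Z by
    have h0 : |⟪a, n⟫ - ⟪b, n⟫| ≤ 0 := by
      refine le_of_forall_pos_le_add fun ε hεp => ?_
      have h1 := hε (ε / (Z + 1)) (by positivity)
      refine h1.trans ?_
      rw [zero_add, div_mul_eq_mul_div, div_le_iff₀ (by positivity)]
      nlinarith
    exact sub_eq_zero.1 (abs_nonpos_iff.1 h0)
  intro ε hε
  obtain ⟨R₀, hR₀, hR₀U, hRa, hRb⟩ : ∃ R₀ > 0, Metric.closedBall p R₀ ⊆ U ∧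
      (∀ y ∈ Metric.ball p R₀, ⟪y - p, n⟫ < 0 → ‖q y - a‖ < ε) ∧
      ∀ y ∈ Metric.ball p R₀, 0 < ⟪y - p, n⟫ → ‖q y - b‖ < ε := by
    obtain ⟨r₁, h₁, h₁'⟩ := Metric.isOpen_iff.1 hU p hp
    obtain ⟨r₂, h₂, h₂'⟩ := Metric.tendsto_nhdsWithin_nhds.1 ha ε hε
    obtain ⟨r₃, h₃, h₃'⟩ := Metric.tendsto_nhdsWithin_nhds.1 hb ε hε
    refine ⟨min (r₁ / 2) (min r₂ r₃), by positivity,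
      (Metric.closedBall_subset_ball ((min_le_left _ _).trans_lt (half_lt_self h₁))).trans h₁',
        fun y hy hs => ?_, fun y hy hs => ?_⟩
    · rw [← dist_eq_norm]
      exact h₂' hs (lt_of_lt_of_le hy ((min_le_right _ _).trans (min_le_left _ _)))
    · rw [← dist_eq_norm]
      exact h₃' hs (lt_of_lt_of_le hy ((min_le_right _ _).trans (min_le_right _ _)))
  -- Tangential radius `R` and normal width at most `R` together keep the supports in the ball of
  -- radius `R₀`.
  let R := R₀ / 2
  have hR : 0 < R := half_pos hR₀
  obtain ⟨χ, hχR⟩ : ∃ χ : ContDiffBump (0 : Perp n), χ.rOut = R :=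
    ⟨⟨R / 2, R, half_pos hR, half_lt_self hR⟩, rfl⟩
  have hχd : Continuous (fderiv ℝ χ) := (χ.contDiff (n := 1)).continuous_fderiv one_ne_zero
  obtain ⟨Cχ, hC0, hCχ⟩ := exists_bound_fderiv_bump χ
  let P : E d →L[ℝ] Perp n := (Perp n).orthogonalProjectionOnto
  let X : ℝ := ∫ x, χ x
  have hX : 0 < X := χ.integral_pos
  let δ : ℕ → ℝ := fun k => R / (k + 1)
  have hδ : ∀ k, 0 < δ k := fun k => by positivity
  have hδR : ∀ k, δ k ≤ R := fun k => div_le_self hR.le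
    (by linarith [(Nat.cast_nonneg k : (0 : ℝ) ≤ k)])
  have hδ0 : Tendsto δ atTop (𝓝 0) := by
    have := (tendsto_one_div_add_atTop_nhds_zero_nat (𝕜 := ℝ)).const_mul R
    simpa [δ, div_eq_mul_inv] using this
  -- The tangential profile is fixed while the normal width `δ k` tends to zero. Only the normal
  -- derivative, of size `1 / δ k`, survives in the limit.
  let φ : ℕ → E d → ℝ := fun k y => χ (P (y - p)) * ζ (⟪y - p, n⟫ / δ k)
  have hsupp : ∀ k y, P (y - p) ∈ Metric.ball 0 R → |⟪y - p, n⟫ / δ k| < 1 →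
      y ∈ Metric.ball p R₀ := by
    intro k y h1 h2
    rw [abs_div, abs_of_pos (hδ k), div_lt_one (hδ k)] at h2
    have h3 := norm_sub_le_coord p hn y
    have h4 : ‖P (y - p)‖ < R := by simpa using h1
    rw [Metric.mem_ball, dist_eq_norm]
    have : R₀ = R + R := by simp [R]
    change ‖y - p‖ ≤ ‖P (y - p)‖ + _ at h3
    linarith [hδR k]
  have hφ0 : ∀ k y, y ∉ Metric.ball p R₀ → χ (P (y - p)) = 0 ∨
      (ζ (⟪y - p, n⟫ / δ k) = 0 ∧ deriv ζ (⟪y - p, n⟫ / δ k) = 0) := by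
    intro k y hy
    by_cases h1 : P (y - p) ∈ Metric.ball 0 R
    · right
      have h2 : ¬ |⟪y - p, n⟫ / δ k| < 1 := fun h2 => hy (hsupp k y h1 h2)
      have h3 : ∀ t : ℝ, ¬ |t| < 1 → ζ t = 0 := fun t ht => by
        apply ζ.zero_of_le_dist
        simpa [hζ] using ht
      refine ⟨h3 _ h2, ?_⟩
      -- At the edge of the support the derivative of `ζ` vanishes as well, since the nonnegative
      -- `ζ` attains its minimum `0` there.
      have hmin : IsLocalMin ζ (⟪y - p, n⟫ / δ k) :=
        Eventually.of_forall fun t => by rw [h3 _ h2]; exact ζ.nonneg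
      exact hmin.deriv_eq_zero
    · left
      apply χ.zero_of_le_dist
      simpa [hχR] using h1
  have hφtest : ∀ k, IsTest U (φ k) := by
    intro k
    have hsub : tsupport (φ k) ⊆ Metric.closedBall p R₀ := by
      refine closure_minimal (fun y hy => ?_) Metric.isClosed_closedBall
      by_contra hy'
      rcases hφ0 k y fun h => hy' (Metric.ball_subset_closedBall h) with h | h
      · exact hy (by simp only [φ, h, zero_mul])
      · exact hy (by simp only [φ, h.1, mul_zero])
    refine ⟨?_, (isCompact_closedBall p R₀).of_isClosed_subset (isClosed_tsupport _) hsub,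
      hsub.trans hR₀U⟩
    refine ContDiff.mul ?_ ?_
    · exact χ.contDiff.comp (P.contDiff.comp (contDiff_id.sub contDiff_const))
    · exact ζ.contDiff.comp (((contDiff_id.sub contDiff_const).inner ℝ contDiff_const).div_const _)
  have hφd : ∀ k y v, fderiv ℝ (φ k) y v =
      ζ (⟪y - p, n⟫ / δ k) * fderiv ℝ χ (P (y - p)) (P v) +
      χ (P (y - p)) * (deriv ζ (⟪y - p, n⟫ / δ k) / δ k) * ⟪v, n⟫ := by
    intro k y v
    have h1 : HasFDerivAt (fun y => χ (P (y - p))) ((fderiv ℝ χ (P (y - p))).comp P) y :=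
      (((χ.contDiff (n := 1)).differentiable one_ne_zero) _).hasFDerivAt.comp y
        (P.hasFDerivAt.comp y ((hasFDerivAt_id y).sub_const p))
    have h2 : HasFDerivAt (fun y => ⟪y - p, n⟫ / δ k) ((δ k)⁻¹ • innerSL ℝ n) y := by
      have : (fun y => ⟪y - p, n⟫ / δ k) = fun y => (δ k)⁻¹ * (innerSL ℝ n (y - p)) := by
        ext y
        rw [innerSL_apply_apply, real_inner_comm, div_eq_inv_mul]
      rw [this]
      exact ((innerSL ℝ n).hasFDerivAt.comp y ((hasFDerivAt_id y).sub_const p)).const_mul _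
    have h3 := (((ζ.contDiff (n := 1)).differentiable one_ne_zero)
      (⟪y - p, n⟫ / δ k)).hasDerivAt.comp_hasFDerivAt y h2
    have h4 := h1.mul h3
    rw [show fderiv ℝ (φ k) y = _ from h4.fderiv]
    simp only [add_apply, smul_apply, ContinuousLinearMap.comp_apply,
      smul_eq_mul, innerSL_apply_apply, Function.comp_apply, real_inner_comm n v]
    ring
  let hh : ℕ → E d → ℝ := fun k y => χ (P (y - p)) * (deriv ζ (⟪y - p, n⟫ / δ k) / δ k)
  have hχi : Integrable χ := χ.integrable
  have hψi : ∀ k, Integrable fun s => deriv ζ (s / δ k) / δ k := fun k =>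
    (hζi.comp_div (hδ k).ne').div_const _
  have hhi : ∀ k, Integrable (hh k) := fun k => integrable_coord_mul p hn hχi (hψi k)
  have hhc : ∀ k, Continuous (hh k) := fun k =>
    (χ.continuous.comp (P.continuous.comp (continuous_id.sub continuous_const))).mul
      ((hζc.comp ((((continuous_id.sub continuous_const).inner continuous_const)).div_const
        _)).div_const _)
  have hhb : ∀ k, ∃ C, ∀ y, ‖hh k y‖ ≤ C := by
    intro k
    obtain ⟨C, hC⟩ := ζ.hasCompactSupport.deriv.exists_bound_of_continuous hζc
    refine ⟨1 * (C / δ k), fun y => ?_⟩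
    rw [norm_mul, norm_div, Real.norm_of_nonneg (hδ k).le]
    refine mul_le_mul ?_ (div_le_div_of_nonneg_right (hC _) (hδ k).le) (by positivity) zero_le_one
    rw [Real.norm_of_nonneg χ.nonneg]
    exact χ.le_one
  have hh0 : ∀ k y, y ∉ Metric.ball p R₀ → hh k y = 0 := by
    intro k y hy
    rcases hφ0 k y hy with h | h
    · simp only [hh, h, zero_mul]
    · simp only [hh, h.2, zero_div, mul_zero]
  -- The normal component of `q` is compared with the step function of its one-sided limits: the
  -- integral of the latter against `hh k` is exactly `X` times the jump, and the error is at most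
  -- `ε` times the `L¹` norm of `hh k`, which does not depend on `k`.
  let A : E d → ℝ := fun y => if ⟪y - p, n⟫ < 0 then ⟪a, n⟫ else ⟪b, n⟫
  have hAint : ∀ k, Integrable fun y => hh k y * A y := by
    intro k
    refine (hhi k).mul_bdd (c := max |⟪a, n⟫| |⟪b, n⟫|) ?_ (Eventually.of_forall fun t => ?_)
    · exact (Measurable.ite (isOpen_lt (by fun_prop) continuous_const).measurableSet
        measurable_const measurable_const).aestronglyMeasurable
    · simp only [A]
      split_ifs
      exacts [le_max_left _ _, le_max_right _ _]
  have hAval : ∀ k, ∫ y in U, hh k y * A y = X * (⟪a, n⟫ - ⟪b, n⟫) := by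
    intro k
    rw [setIntegral_eq_integral_of_forall_compl_eq_zero fun y hy => by
      rw [hh0 k y fun h => hy (hR₀U (Metric.ball_subset_closedBall h)), zero_mul]]
    have h1 : ∀ y, hh k y * A y = χ (P (y - p)) * (fun s => deriv ζ (s / δ k) / δ k *
        (if s < 0 then ⟪a, n⟫ else ⟪b, n⟫)) ⟪y - p, n⟫ := fun y => by simp only [hh, A, mul_assoc]
    rw [integral_congr_ae (Eventually.of_forall h1)]
    refine (integral_coord_mul p hn χ (fun s => deriv ζ (s / δ k) / δ k *
      (if s < 0 then ⟪a, n⟫ else ⟪b, n⟫))).trans ?_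
    congr 1
    have h2 : ∀ s : ℝ, deriv ζ (s / δ k) / δ k * (if s < 0 then ⟪a, n⟫ else ⟪b, n⟫) =
        (δ k)⁻¹ * (fun t => deriv ζ t * (if t < 0 then ⟪a, n⟫ else ⟪b, n⟫)) (s / δ k) := by
      intro s
      have : s / δ k < 0 ↔ s < 0 := by rw [div_lt_iff₀ (hδ k), zero_mul]
      simp only [this]
      ring
    rw [integral_congr_ae (Eventually.of_forall h2), integral_const_mul,
      Measure.integral_comp_div (fun t => deriv ζ t * (if t < 0 then ⟪a, n⟫ else ⟪b, n⟫)), integral_deriv_bump,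
      smul_eq_mul,
      abs_of_pos (hδ k), inv_mul_cancel_left₀ (hδ k).ne']
  have hqi : ∀ k, IntegrableOn (fun y => hh k y * ⟪q y, n⟫) U := by
    intro k
    obtain ⟨C, hC⟩ := hhb k
    exact (hq.inner_const n).bdd_mul (hhc k).aestronglyMeasurable (Eventually.of_forall hC)
  have hs0 : ∀ᵐ y ∂(volume.restrict U), ⟪y - p, n⟫ ≠ 0 :=
    ae_restrict_of_ae (measure_eq_zero_iff_ae_notMem.1 (volume_hyperplane hn p 0))
  have herr : ∀ k, |(∫ y in U, hh k y * ⟪q y, n⟫) - X * (⟪a, n⟫ - ⟪b, n⟫)| ≤ ε * (X * Z) := by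
    intro k
    rw [← hAval k, ← integral_sub (hqi k) (hAint k).integrableOn]
    have h1 : ∫ y, |hh k y| = X * Z := by
      have h2 : ∀ y, |hh k y| = χ (P (y - p)) * (fun s => |deriv ζ (s / δ k)| / δ k)
          ⟪y - p, n⟫ := by
        intro y
        simp only [hh]
        rw [abs_mul, abs_of_nonneg χ.nonneg, abs_div, abs_of_pos (hδ k)]
      rw [integral_congr_ae (Eventually.of_forall h2)]
      refine (integral_coord_mul p hn χ (fun s => |deriv ζ (s / δ k)| / δ k)).trans ?_
      congr 1
      rw [integral_div, Measure.integral_comp_div (fun t => |deriv ζ t|), smul_eq_mul,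
        abs_of_pos (hδ k), mul_div_cancel_left₀ _ (hδ k).ne']
    rw [← Real.norm_eq_abs]
    calc _ ≤ ∫ y in U, ε * |hh k y| := by
          refine norm_integral_le_of_norm_le ((hhi k).abs.const_mul ε).integrableOn ?_
          filter_upwards [hs0] with y hy
          rw [← mul_sub, norm_mul, mul_comm, Real.norm_eq_abs (hh k y)]
          by_cases hyb : y ∈ Metric.ball p R₀
          · refine mul_le_mul_of_nonneg_right ?_ (abs_nonneg _)
            simp only [A]
            split_ifs with hs
            · rw [← inner_sub_left]
              refine (norm_inner_le_norm _ _).trans ?_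
              rw [hn, mul_one]
              exact (hRa y hyb hs).le
            · rw [← inner_sub_left]
              refine (norm_inner_le_norm _ _).trans ?_
              rw [hn, mul_one]
              exact (hRb y hyb (lt_of_le_of_ne (not_lt.1 hs) (Ne.symm hy))).le
          · rw [hh0 k y hyb]; simp
      _ ≤ ε * ∫ y, |hh k y| := by
          rw [integral_const_mul]
          refine mul_le_mul_of_nonneg_left ?_ hε.le
          exact setIntegral_le_integral (hhi k).abs (Eventually.of_forall fun _ => abs_nonneg _)
      _ = ε * (X * Z) := by rw [h1]
  have hζ0 : ∀ y, ⟪y - p, n⟫ ≠ 0 → ∀ᶠ k in atTop, ζ (⟪y - p, n⟫ / δ k) = 0 := by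
    intro y hy
    have h1 : ∀ᶠ k in atTop, δ k < |⟪y - p, n⟫| :=
      hδ0.eventually_lt_const (abs_pos.2 hy)
    filter_upwards [h1] with k hk
    apply ζ.zero_of_le_dist
    rw [hζ, dist_zero_right, Real.norm_eq_abs, abs_div, abs_of_pos (hδ k)]
    exact (one_le_div (hδ k)).2 hk.le
  have hζn : ∀ t, ‖ζ t‖ ≤ 1 := fun t => by
    rw [Real.norm_of_nonneg ζ.nonneg]; exact ζ.le_one
  have hlim1 : Tendsto (fun k => ∫ y in U, f y * φ k y) atTop (𝓝 0) := by
    rw [← integral_zero (E d) ℝ (μ := volume.restrict U)]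
    refine tendsto_integral_of_dominated_convergence (fun y => ‖f y‖) (fun k => ?_)
      hf.norm (fun k => Eventually.of_forall fun y => ?_) ?_
    · exact hf.aestronglyMeasurable.mul (hφtest k).1.continuous.aestronglyMeasurable
    · rw [norm_mul, norm_mul]
      refine mul_le_of_le_one_right (norm_nonneg _) (mul_le_one₀ ?_ (norm_nonneg _) (hζn _))
      rw [Real.norm_of_nonneg χ.nonneg]; exact χ.le_one
    · filter_upwards [hs0] with y hy
      refine tendsto_const_nhds.congr' ?_
      filter_upwards [hζ0 y hy] with k hk
      simp only [φ, hk, mul_zero]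
  have hm2 : ∀ k, AEStronglyMeasurable (fun y => ζ (⟪y - p, n⟫ / δ k) *
      fderiv ℝ χ (P (y - p)) (P (q y))) (volume.restrict U) := by
    intro k
    refine AEStronglyMeasurable.mul ?_ ?_
    · exact (ζ.continuous.comp (((continuous_id.sub continuous_const).inner
        continuous_const).div_const _)).aestronglyMeasurable
    · exact isBoundedBilinearMap_apply.continuous.comp_aestronglyMeasurable
        ((hχd.comp (P.continuous.comp (continuous_id.sub
          continuous_const))).aestronglyMeasurable.prodMk
        (P.continuous.comp_aestronglyMeasurable hq.aestronglyMeasurable))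
  have hb2 : ∀ k y, ‖ζ (⟪y - p, n⟫ / δ k) * fderiv ℝ χ (P (y - p)) (P (q y))‖ ≤
      Cχ * (‖P‖ * ‖q y‖) := by
    intro k y
    rw [norm_mul]
    refine (mul_le_of_le_one_left (norm_nonneg _) (hζn _)).trans ?_
    exact (hCχ _ _).trans (mul_le_mul_of_nonneg_left (P.le_opNorm _) hC0)
  have hi2 : IntegrableOn (fun y => Cχ * (‖P‖ * ‖q y‖)) U := (hq.norm.const_mul _).const_mul _
  have hlim2 : Tendsto (fun k => ∫ y in U, ζ (⟪y - p, n⟫ / δ k) *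
      fderiv ℝ χ (P (y - p)) (P (q y))) atTop (𝓝 0) := by
    have h0 := integral_zero (E d) ℝ (μ := volume.restrict U)
    refine (tendsto_integral_of_dominated_convergence (f := fun _ => 0) _ hm2
      hi2 (fun k => Eventually.of_forall (hb2 k)) ?_).mono_right (congrArg 𝓝 h0).le
    filter_upwards [hs0] with y hy
    refine tendsto_const_nhds.congr' ?_
    filter_upwards [hζ0 y hy] with k hk
    rw [hk, zero_mul]
  -- By the weak equation, the concentrated term equals two terms that tend to zero by dominated
  -- convergence: their factor `ζ` eventually vanishes at every point off the hyperplane.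
  have hsplit : ∀ k, ∫ y in U, hh k y * ⟪q y, n⟫ = (∫ y in U, f y * φ k y) -
      ∫ y in U, ζ (⟪y - p, n⟫ / δ k) * fderiv ℝ χ (P (y - p)) (P (q y)) := by
    intro k
    rw [← h (φ k) (hφtest k)]
    simp only [hφd]
    rw [integral_add (hi2.mono' (hm2 k) (Eventually.of_forall (hb2 k))) (hqi k)]
    ring
  have hlim : Tendsto (fun k => ∫ y in U, hh k y * ⟪q y, n⟫) atTop (𝓝 0) := by
    have := hlim1.sub hlim2
    rw [sub_zero] at this
    exact this.congr fun k => (hsplit k).symm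
  have := le_of_tendsto ((hlim.sub_const (X * (⟪a, n⟫ - ⟪b, n⟫))).abs)
    (Eventually.of_forall herr)
  rw [zero_sub, abs_neg, abs_mul, abs_of_pos hX] at this
  nlinarith

end MPFA

/-! ### Lipschitz selections and the geometry of star-shaped cells -/

namespace MPFA

open scoped Pointwise

variable {d : ℕ}

/-- A continuous selection of finitely many Lipschitz functions is Lipschitz. -/
theorem lipschitzWith_of_selection {ι : Type*} [Finite ι] {f : E d → ℝ} (hf : Continuous f)
    {g : ι → E d → ℝ} {L : NNReal} (hg : ∀ i, LipschitzWith L (g i)) (h : ∀ y, ∃ i, f y = g i y) :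
    LipschitzWith L f := by
  refine LipschitzWith.of_le_add_mul L fun y x => ?_
  let γ : ℝ → E d := fun t => x + t • (y - x)
  have hγ : Continuous γ := by fun_prop
  let S : Set ℝ := {t | f (γ t) ≤ f (γ 0) + L * (t * dist y x)}
  have hS : IsClosed S := isClosed_le (hf.comp hγ) (by fun_prop)
  have hγd : ∀ s t, t ≤ s → dist (γ s) (γ t) = (s - t) * dist y x := by
    intro s t hst
    simp only [γ, dist_eq_norm]
    rw [add_sub_add_left_eq_sub, ← sub_smul, norm_smul, Real.norm_of_nonneg (sub_nonneg.2 hst)]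
  -- Continuous induction along the segment. Among finitely many selections, one agrees with `f` at
  -- points accumulating at `t` from the right, hence also at `t`, and its Lipschitz bound carries
  -- the estimate beyond `t`.
  have hsub : Icc (0 : ℝ) 1 ⊆ S := by
    refine (hS.inter isClosed_Icc).Icc_subset_of_forall_exists_gt (by simp [S])
      fun t ht b hb => ?_
    obtain ⟨i, hi⟩ : ∃ i, ∃ᶠ s in 𝓝[>] t, f (γ s) = g i (γ s) := by
      by_contra hcon
      simp only [not_exists, not_frequently] at hcon
      obtain ⟨s, hs⟩ := (eventually_all.2 hcon).exists
      obtain ⟨i, hi⟩ := h (γ s)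
      exact hs i hi
    have hti : f (γ t) = g i (γ t) := by
      have hc : IsClosed {s | f (γ s) = g i (γ s)} :=
        isClosed_eq (hf.comp hγ) ((hg i).continuous.comp hγ)
      exact hc.closure_subset_iff.2 subset_rfl
        (mem_closure_iff_frequently.2 (hi.filter_mono nhdsWithin_le_nhds))
    obtain ⟨s, hs, hsi⟩ := (hi.and_eventually (Ioc_mem_nhdsGT hb)).exists
    refine ⟨s, ?_, hsi⟩
    have h1 := (hg i).dist_le_mul (γ s) (γ t)
    rw [hγd s t hsi.1.le, ← hs, ← hti, Real.dist_eq] at h1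
    have h2 : f (γ t) ≤ f (γ 0) + L * (t * dist y x) := ht.1
    have h3 := (abs_le.1 h1).2
    change f (γ s) ≤ f (γ 0) + L * (s * dist y x)
    nlinarith
  have := hsub (right_mem_Icc.2 zero_le_one)
  simpa [S, γ] using this

theorem IsPolytopal.isBounded {U : Set (E d)} (hU : IsPolytopal U) : Bornology.IsBounded U := by
  obtain ⟨S, rfl⟩ := hU
  refine Bornology.IsBounded.subset ?_ interior_subset
  refine (Bornology.isBounded_biUnion S.finite_toSet).2 fun V _ => ?_
  exact isBounded_convexHull.2 V.finite_toSet.isBounded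

theorem IsPolytopal.isOpen {U : Set (E d)} (hU : IsPolytopal U) : IsOpen U := by
  obtain ⟨S, rfl⟩ := hU
  exact isOpen_interior

namespace Mesh

variable {D : Diffusion d} {𝒯 ℱ : Type} (M : Mesh D 𝒯 ℱ)

theorem cell_subset_domain (T : 𝒯) : M.cell T ⊆ D.Ω :=
  (M.cell_subset T).trans (D.part_subset _)

theorem isBounded_cell (T : 𝒯) : Bornology.IsBounded (M.cell T) :=
  D.Ω_polytopal.isBounded.subset (M.cell_subset_domain T)

theorem isCompact_closure_cell (T : 𝒯) : IsCompact (closure (M.cell T)) :=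
  (M.isBounded_cell T).isCompact_closure

variable {M} {T : 𝒯} {F : ℱ}

theorem closure_face_subset_frontier (h : M.Bd T F) :
    closure (M.face F) ⊆ frontier (M.cell T) := by
  rw [M.cell_frontier T]
  exact subset_biUnion_of_mem (u := fun F => closure (M.face F)) h

theorem face_subset_hyperplane (h : M.Bd T F) :
    M.face F ⊆ {x | ⟪x - M.pt T, M.normal T F⟫ = M.dist T F} := by
  obtain ⟨V, -, hV⟩ := M.face_flat T F h
  rw [hV]
  exact inter_subset_right

theorem closure_face_subset_hyperplane (h : M.Bd T F) :
    closure (M.face F) ⊆ {x | ⟪x - M.pt T, M.normal T F⟫ = M.dist T F} :=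
  closure_minimal (face_subset_hyperplane h) (isClosed_eq (by fun_prop) continuous_const)

theorem exists_of_mem_frontier {z : E d} (hz : z ∈ frontier (M.cell T)) :
    ∃ F, M.Bd T F ∧ z ∈ closure (M.face F) := by
  rw [M.cell_frontier T] at hz
  obtain ⟨F, hF, h⟩ := mem_iUnion₂.1 hz
  exact ⟨F, hF, h⟩

theorem cell_not_mem_frontier {z : E d} (hz : z ∈ M.cell T) : z ∉ frontier (M.cell T) := by
  rw [(M.cell_open T).frontier_eq]
  exact fun h => h.2 hz

variable (M) in
theorem closure_star {z : E d} (hz : z ∈ closure (M.cell T)) {t : ℝ} (h0 : 0 ≤ t) (h1 : t ≤ 1) :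
    M.pt T + t • (z - M.pt T) ∈ closure (M.cell T) := by
  have hc : Continuous fun z => M.pt T + t • (z - M.pt T) := by fun_prop
  exact map_mem_closure (f := fun z => M.pt T + t • (z - M.pt T)) hc hz
    fun y hy => (M.cell_star T).add_smul_sub_mem hy h0 h1

/-! ### The radial function of a cell -/

variable (M T) in
/-- The cell, translated so that its point is the origin. -/
def centred : Set (E d) := {v | M.pt T + v ∈ M.cell T}

variable (M T) in
/-- The radial function of the cell: `0` at the point `x_T`, `1` on the boundary of the cell. -/
noncomputable def radial (y : E d) : ℝ := gauge (M.centred T) (y - M.pt T)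

variable (M T) in
theorem isOpen_centred : IsOpen (M.centred T) :=
  (M.cell_open T).preimage (continuous_const.add continuous_id)

variable (M T) in
theorem absorbent_centred : Absorbent ℝ (M.centred T) := by
  refine absorbent_nhds_zero ((M.isOpen_centred T).mem_nhds ?_)
  simpa [centred] using M.pt_mem T

theorem radial_nonneg (y : E d) : 0 ≤ M.radial T y := gauge_nonneg _

theorem radial_pos {y : E d} (hy : y ≠ M.pt T) : 0 < M.radial T y := by
  refine (gauge_pos (M.absorbent_centred T) ?_).2 (sub_ne_zero.2 hy)
  rw [NormedSpace.isVonNBounded_iff]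
  obtain ⟨R, hR⟩ := (M.isBounded_cell T).exists_norm_le
  refine (isBounded_iff_forall_norm_le).2 ⟨R + ‖M.pt T‖, fun v hv => ?_⟩
  have h1 := hR _ hv
  have h2 : v = (M.pt T + v) - M.pt T := by abel
  rw [h2]
  exact (norm_sub_le _ _).trans (by linarith)

/-- For an open star-shaped set the strict sublevel sets of the gauge are exactly the dilates;
convexity plays no role. -/
theorem radial_lt_iff {y : E d} {r : ℝ} (hr : 0 < r) :
    M.radial T y < r ↔ M.pt T + r⁻¹ • (y - M.pt T) ∈ M.cell T := by
  constructor
  · intro h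
    obtain ⟨b, hb, hbr, hy⟩ := exists_lt_of_gauge_lt (M.absorbent_centred T) h
    rw [mem_smul_set_iff_inv_smul_mem₀ hb.ne'] at hy
    have h1 : M.pt T + b⁻¹ • (y - M.pt T) ∈ M.cell T := hy
    have h2 := (M.cell_star T).add_smul_sub_mem h1 (t := b / r) (by positivity)
      ((div_le_one hr).2 hbr.le)
    rw [add_sub_cancel_left, smul_smul] at h2
    convert h2 using 3
    field_simp
  · intro h
    refine gauge_lt_of_mem_smul _ r hr (M.isOpen_centred T) ?_
    rw [mem_smul_set_iff_inv_smul_mem₀ hr.ne']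
    exact h

theorem radial_lt_one_iff {y : E d} : M.radial T y < 1 ↔ y ∈ M.cell T := by
  rw [radial_lt_iff one_pos]; simp

variable [Finite ℱ]

variable (M) in
/-- Since the hyperplanes of the faces do not contain `x_T`, rays from `x_T` leave the cell only
once. -/
theorem ray_mem {z : E d} (hz : z ∈ closure (M.cell T)) {t : ℝ} (h0 : 0 ≤ t) (h1 : t < 1) :
    M.pt T + t • (z - M.pt T) ∈ M.cell T := by
  by_contra hcon
  have hfr : ∀ s ∈ Icc t 1, M.pt T + s • (z - M.pt T) ∈ frontier (M.cell T) := by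
    intro s hs
    rw [(M.cell_open T).frontier_eq]
    refine ⟨M.closure_star hz (h0.trans hs.1) hs.2, fun hmem => hcon ?_⟩
    have hspos : 0 ≤ s := h0.trans hs.1
    rcases hspos.eq_or_lt with hs0 | hs0
    · have : t = 0 := le_antisymm (hs.1.trans hs0.symm.le) h0
      simpa [this] using M.pt_mem T
    · have := (M.cell_star T).add_smul_sub_mem hmem (t := t / s) (by positivity)
        ((div_le_one hs0).2 hs.1)
      rwa [add_sub_cancel_left, smul_smul, div_mul_cancel₀ _ hs0.ne'] at this
  -- A stretch of the ray in the frontier would lie in finitely many hyperplanes. None of them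
  -- contains `x_T`, so each meets the ray at most once, whereas the stretch has infinitely many
  -- points.
  have hsub : Icc t 1 ⊆ range fun F : ℱ =>
      M.dist T F / ⟪z - M.pt T, M.normal T F⟫ := by
    intro s hs
    obtain ⟨F, hF, hsF⟩ := exists_of_mem_frontier (hfr s hs)
    have h2 : ⟪_ - M.pt T, M.normal T F⟫ = M.dist T F := closure_face_subset_hyperplane hF hsF
    rw [add_sub_cancel_left, real_inner_smul_left] at h2
    have h3 := M.dist_pos T F hF
    have h4 : ⟪z - M.pt T, M.normal T F⟫ ≠ 0 := by
      intro h4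
      rw [h4, mul_zero] at h2
      exact h3.ne h2
    exact ⟨F, by simp only; rw [← h2, mul_div_cancel_right₀ _ h4]⟩
  exact (Icc_infinite h1) ((finite_range _).subset hsub)

theorem cone_face_subset (h : M.Bd T F) : cone (M.pt T) (closure (M.face F)) ⊆ M.cell T := by
  rintro _ ⟨r, hr, z, hz, rfl⟩
  exact M.ray_mem (frontier_subset_closure (closure_face_subset_frontier h hz)) hr.1.le hr.2

/-- If a common point has different ratios in the two cones, one of the two base points lies
strictly between `x_T` and the other, hence inside the open cell and not on its frontier. With equal
ratios the base points coincide, against the disjointness of the faces. -/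
theorem cone_face_disjoint {F' : ℱ} (h : M.Bd T F) (h' : M.Bd T F') (hne : F ≠ F') :
    Disjoint (cone (M.pt T) (M.face F)) (cone (M.pt T) (M.face F')) := by
  have key : ∀ {F F' : ℱ}, M.Bd T F → M.Bd T F' → ∀ {r r' : ℝ} {z z' : E d}, z ∈ M.face F →
      z' ∈ M.face F' → 0 < r → r < r' →
      M.pt T + r • (z - M.pt T) ≠ M.pt T + r' • (z' - M.pt T) := by
    intro F F' hF hF' r r' z z' hz hz' hr hrr he
    have h1 : z' = M.pt T + (r / r') • (z - M.pt T) := by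
      have hr' : 0 < r' := hr.trans hrr
      have h2 : z' - M.pt T = r'⁻¹ • (r • (z - M.pt T)) := by
        rw [add_left_cancel he, smul_smul, inv_mul_cancel₀ hr'.ne', one_smul]
      rw [div_eq_inv_mul, mul_smul, ← h2]; abel
    refine cell_not_mem_frontier (T := T) (z := z') ?_
      (closure_face_subset_frontier hF' (subset_closure hz'))
    rw [h1]
    exact M.ray_mem (frontier_subset_closure (closure_face_subset_frontier hF (subset_closure hz)))
      (by have := hr.trans hrr; positivity) ((div_lt_one (hr.trans hrr)).2 hrr)
  rw [Set.disjoint_left]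
  rintro y ⟨r, hr, z, hz, h1⟩ ⟨r', hr', z', hz', h2⟩
  rcases lt_trichotomy r r' with hlt | heq | hgt
  · exact key h h' hz hz' hr.1 hlt (h1.symm.trans h2)
  · subst heq
    rw [h1] at h2
    have h3 : z - M.pt T = z' - M.pt T := smul_right_injective _ hr.1.ne' (add_left_cancel h2)
    have h4 : z = z' := sub_left_injective h3
    subst h4
    exact Set.disjoint_left.1 (M.face_disjoint F F' hne) hz hz'
  · exact key h' h hz' hz hr'.1 hgt (h2.symm.trans h1)

/-- The converse implication relies on `ray_mem`: shrinking a point of the closed cell moves it into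
the open cell. -/
theorem radial_le_iff {y : E d} {r : ℝ} (hr : 0 < r) :
    M.radial T y ≤ r ↔ M.pt T + r⁻¹ • (y - M.pt T) ∈ closure (M.cell T) := by
  constructor
  · intro h
    have h1 : Tendsto (fun s : ℝ => M.pt T + s⁻¹ • (y - M.pt T)) (𝓝[>] r)
        (𝓝 (M.pt T + r⁻¹ • (y - M.pt T))) := by
      refine Tendsto.mono_left ?_ nhdsWithin_le_nhds
      exact tendsto_const_nhds.add ((tendsto_inv₀ hr.ne').smul_const _)
    refine mem_closure_of_tendsto h1 ?_
    filter_upwards [self_mem_nhdsWithin] with s hs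
    exact (radial_lt_iff (hr.trans hs)).1 (lt_of_le_of_lt h hs)
  · intro h
    refine le_of_forall_gt fun s hs => ?_
    have hs0 := hr.trans hs
    have h1 := M.ray_mem h (t := r / s) (by positivity) ((div_lt_one hs0).2 hs)
    rw [add_sub_cancel_left, smul_smul] at h1
    rw [radial_lt_iff hs0]
    convert h1 using 3
    field_simp

/-- Sublevel sets at positive levels are dilates of the closed cell, hence closed, and strict ones
are dilates of the open cell, hence open. -/
theorem continuous_radial : Continuous (M.radial T) := by
  rw [continuous_iff_continuousAt]
  refine fun y => tendsto_order.2 ⟨fun a ha => ?_, fun b hb => ?_⟩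
  · rcases lt_or_ge a 0 with h0 | h0
    · exact Eventually.of_forall fun z => h0.trans_le (radial_nonneg z)
    · obtain ⟨c, hac, hc⟩ := exists_between ha
      have hc0 : 0 < c := h0.trans_lt hac
      have h1 : y ∈ {z | M.pt T + c⁻¹ • (z - M.pt T) ∈ closure (M.cell T)}ᶜ := by
        intro h
        exact not_le.2 hc ((radial_le_iff hc0).2 h)
      have ho : IsOpen {z | M.pt T + c⁻¹ • (z - M.pt T) ∈ closure (M.cell T)}ᶜ :=
        (isClosed_closure.preimage (f := fun z => M.pt T + c⁻¹ • (z - M.pt T))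
          (by fun_prop)).isOpen_compl
      filter_upwards [ho.mem_nhds h1] with z hz
      exact hac.trans (not_le.1 fun h => hz ((radial_le_iff hc0).1 h))
  · have hb0 : 0 < b := (radial_nonneg y).trans_lt hb
    have ho : IsOpen {z | M.pt T + b⁻¹ • (z - M.pt T) ∈ M.cell T} :=
      (M.cell_open T).preimage (f := fun z => M.pt T + b⁻¹ • (z - M.pt T)) (by fun_prop)
    filter_upwards [ho.mem_nhds ((radial_lt_iff hb0).1 hb)] with z hz
    exact (radial_lt_iff hb0).2 hz

theorem radial_le_one_iff {y : E d} : M.radial T y ≤ 1 ↔ y ∈ closure (M.cell T) := by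
  rw [radial_le_iff one_pos]; simp

/-- The radial function is linear on the cone over each face. -/
theorem radial_add_smul {z : E d} (hz : z ∈ frontier (M.cell T)) {r : ℝ} (hr : 0 ≤ r) :
    M.radial T (M.pt T + r • (z - M.pt T)) = r := by
  have h1 : M.radial T z = 1 := by
    rw [(M.cell_open T).frontier_eq] at hz
    exact le_antisymm (radial_le_one_iff.2 hz.1) (not_lt.1 fun h => hz.2 (radial_lt_one_iff.1 h))
  unfold radial at h1 ⊢
  rw [add_sub_cancel_left, gauge_smul_of_nonneg hr, h1, smul_eq_mul, mul_one]

theorem exists_frontier_of_ne {y : E d} (hy : y ≠ M.pt T) :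
    ∃ F, M.Bd T F ∧ ∃ z ∈ closure (M.face F), y = M.pt T + M.radial T y • (z - M.pt T) := by
  have hr := radial_pos hy
  let z := M.pt T + (M.radial T y)⁻¹ • (y - M.pt T)
  have hz : z ∈ frontier (M.cell T) := by
    rw [(M.cell_open T).frontier_eq]
    exact ⟨(radial_le_iff hr).1 le_rfl, fun h => lt_irrefl _ ((radial_lt_iff hr).2 h)⟩
  obtain ⟨F, hF, hzF⟩ := exists_of_mem_frontier hz
  refine ⟨F, hF, z, hzF, ?_⟩
  simp only [z]
  rw [add_sub_cancel_left, smul_smul, mul_inv_cancel₀ hr.ne', one_smul]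
  abel

/-- The cones over the faces cover the cell, up to a null set. -/
theorem cell_subset_cones : M.cell T ⊆ {M.pt T} ∪ ⋃ F ∈ {F | M.Bd T F},
    cone (M.pt T) (closure (M.face F)) := by
  intro y hy
  by_cases hyp : y = M.pt T
  · exact Or.inl hyp
  · right
    obtain ⟨F, hF, z, hz, he⟩ := exists_frontier_of_ne hyp
    refine mem_biUnion hF ⟨M.radial T y, ⟨radial_pos hyp, radial_lt_one_iff.2 hy⟩, z, hz, he⟩

theorem radial_eq_level {y : E d} (hy : y ≠ M.pt T) : ∃ F, M.Bd T F ∧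
    M.radial T y = ⟪y - M.pt T, M.normal T F⟫ / M.dist T F := by
  obtain ⟨F, hF, z, hz, he⟩ := exists_frontier_of_ne hy
  refine ⟨F, hF, ?_⟩
  have h1 : ⟪z - M.pt T, M.normal T F⟫ = M.dist T F := closure_face_subset_hyperplane hF hz
  conv_rhs => rw [he]
  rw [add_sub_cancel_left, real_inner_smul_left, h1, mul_div_cancel_right₀ _ (M.dist_pos T F hF).ne']

/-- The radial function is a continuous selection among the affine functions attached to the faces,
each of which is Lipschitz with constant `1 / d_TF`. -/
theorem exists_lipschitzWith_radial (hd : 1 ≤ d) : ∃ L, LipschitzWith L (M.radial T) := by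
  classical
  have : Fintype ℱ := Fintype.ofFinite ℱ
  let L : NNReal := ∑ F, Real.toNNReal (1 / M.dist T F)
  let g : {F // M.Bd T F} → E d → ℝ := fun F y => ⟪y - M.pt T, M.normal T F⟫ / M.dist T F
  have hg : ∀ F, LipschitzWith L (g F) := by
    rintro ⟨F, hF⟩
    have hd0 := M.dist_pos T F hF
    refine LipschitzWith.of_dist_le_mul fun y z => ?_
    have h1 : Real.toNNReal (1 / M.dist T F) ≤ L :=
      Finset.single_le_sum (f := fun F => Real.toNNReal (1 / M.dist T F))
        (fun _ _ => zero_le) (Finset.mem_univ F)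
    have h2 : 1 / M.dist T F ≤ L := by
      have := NNReal.coe_le_coe.2 h1
      rwa [Real.coe_toNNReal _ (by positivity)] at this
    simp only [g, Real.dist_eq]
    rw [← sub_div, ← inner_sub_left, sub_sub_sub_cancel_right, abs_div, abs_of_pos hd0]
    have h3 : |⟪y - z, M.normal T F⟫| ≤ Dist.dist y z := by
      have := abs_real_inner_le_norm (y - z) (M.normal T F)
      rwa [M.normal_norm T F hF, mul_one, ← dist_eq_norm] at this
    calc _ ≤ Dist.dist y z / M.dist T F := by gcongr
      _ = 1 / M.dist T F * Dist.dist y z := by ring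
      _ ≤ _ := by gcongr
  refine ⟨L, lipschitzWith_of_selection continuous_radial hg fun y => ?_⟩
  by_cases hy : y = M.pt T
  -- At `x_T` every affine function vanishes, and any face will do; `1 ≤ d` provides another point
  -- of the space and thereby a face.
  · have : Nonempty (Fin d) := ⟨⟨0, hd⟩⟩
    obtain ⟨y', hy'⟩ := exists_ne (M.pt T)
    obtain ⟨F, hF, -⟩ := radial_eq_level hy'
    refine ⟨⟨F, hF⟩, ?_⟩
    simp [g, hy, radial]
  · obtain ⟨F, hF, h⟩ := radial_eq_level hy
    exact ⟨⟨F, hF⟩, h⟩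

end Mesh

end MPFA

namespace MPFA

variable {d : ℕ}

/-! ### The balance of fluxes in a cell -/

/-- The height is replaced by the ratio `r = s / c`, which is the value of the radial function; the
Jacobian is `c`. -/
theorem integral_cone_radial {n : E d} (hn : ‖n‖ = 1) {p : E d} {c : ℝ} (hc : 0 < c)
    {F : Set (E d)} (hF : F ⊆ {x | ⟪x - p, n⟫ = c}) (hFm : MeasurableSet F) {w : E d → ℝ}
    (hw : IntegrableOn w (cone p F)) :
    ∫ y in cone p F, w y = ∫ r in (0 : ℝ)..1, c * (r ^ (d - 1) *
        ∫ z in F, w (p + r • (z - p)) ∂(μHE[d - 1] : Measure (E d))) := by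
  rw [integral_cone hn hc hF hFm hw, ← integral_Ioc_eq_integral_Ioo,
    ← intervalIntegral.integral_of_le hc.le,
    intervalIntegral.integral_comp_div (fun r => r ^ (d - 1) *
      ∫ z in F, w (p + r • (z - p)) ∂(μHE[d - 1] : Measure (E d))) hc.ne',
    zero_div, div_self hc.ne', intervalIntegral.integral_const_mul, smul_eq_mul]

theorem tendsto_average_left {m : ℝ → ℝ} (hm : ContinuousOn m (Icc 0 1)) {ε : ℕ → ℝ}
    (hε : ∀ k, 0 < ε k) (hε' : ∀ k, 2 * ε k ≤ 1) (hε0 : Tendsto ε atTop (𝓝 0)) :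
    Tendsto (fun k => (ε k)⁻¹ * ∫ r in (1 - 2 * ε k)..(1 - ε k), m r) atTop (𝓝 (m 1)) := by
  rw [Metric.tendsto_atTop']
  intro η hη
  obtain ⟨δ, hδ, hδm⟩ := Metric.continuousOn_iff.1 hm 1 (by simp) (η / 2) (half_pos hη)
  have h1 : ∀ᶠ k in atTop, 2 * ε k < δ := by
    have := hε0.const_mul 2
    rw [mul_zero] at this
    exact this.eventually_lt_const hδ
  obtain ⟨N, hN⟩ := eventually_atTop.1 h1
  refine ⟨N, fun k hk => ?_⟩
  have hk1 := hN k hk.le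
  have hek := hε k
  have hek' := hε' k
  have hle : 1 - 2 * ε k ≤ 1 - ε k := by linarith
  have hi : IntervalIntegrable m volume (1 - 2 * ε k) (1 - ε k) := by
    refine ContinuousOn.intervalIntegrable ?_
    rw [uIcc_of_le hle]
    exact hm.mono (Icc_subset_Icc (by linarith) (by linarith))
  have h2 : (∫ r in (1 - 2 * ε k)..(1 - ε k), m r) - ε k * m 1 =
      ∫ r in (1 - 2 * ε k)..(1 - ε k), (m r - m 1) := by
    rw [intervalIntegral.integral_sub hi intervalIntegrable_const,
      intervalIntegral.integral_const, smul_eq_mul]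
    ring
  have h3 : ‖∫ r in (1 - 2 * ε k)..(1 - ε k), (m r - m 1)‖ ≤
      η / 2 * |(1 - ε k) - (1 - 2 * ε k)| := by
    refine intervalIntegral.norm_integral_le_of_norm_le_const fun r hr => ?_
    rw [uIoc_of_le hle] at hr
    refine (hδm r ⟨by linarith [hr.1], by linarith [hr.2]⟩ ?_).le
    rw [Real.dist_eq, abs_sub_comm, abs_of_nonneg (by linarith [hr.2])]
    linarith [hr.1]
  have h4 : (1 - ε k) - (1 - 2 * ε k) = ε k := by ring
  rw [h4, abs_of_pos hek, ← h2] at h3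
  rw [Real.dist_eq]
  have h5 : (ε k)⁻¹ * (∫ r in (1 - 2 * ε k)..(1 - ε k), m r) - m 1 =
      (ε k)⁻¹ * ((∫ r in (1 - 2 * ε k)..(1 - ε k), m r) - ε k * m 1) := by
    field_simp
  rw [h5, abs_mul, abs_of_pos (inv_pos.2 hek)]
  calc (ε k)⁻¹ * |(∫ r in (1 - 2 * ε k)..(1 - ε k), m r) - ε k * m 1|
      ≤ (ε k)⁻¹ * (η / 2 * ε k) := mul_le_mul_of_nonneg_left h3 (inv_pos.2 hek).le
    _ = η / 2 := by field_simp
    _ < η := half_lt_self hη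

/-- A piecewise affine cut-off: `1` on `(-∞, 1 - 2ε]`, `0` on `[1 - ε, ∞)`. -/
noncomputable def cutoff (ε r : ℝ) : ℝ := max 0 (min 1 ((1 - ε - r) / ε))

theorem cutoff_nonneg (ε r : ℝ) : 0 ≤ cutoff ε r := le_max_left _ _

theorem cutoff_le_one (ε r : ℝ) : cutoff ε r ≤ 1 := max_le zero_le_one (min_le_left _ _)

theorem cutoff_eq_one {ε r : ℝ} (hε : 0 < ε) (h : r ≤ 1 - 2 * ε) : cutoff ε r = 1 := by
  have : 1 ≤ (1 - ε - r) / ε := by rw [le_div_iff₀ hε]; linarith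
  rw [cutoff, min_eq_left this, max_eq_right zero_le_one]

theorem cutoff_eq_zero {ε r : ℝ} (hε : 0 < ε) (h : 1 - ε ≤ r) : cutoff ε r = 0 := by
  have : (1 - ε - r) / ε ≤ 0 := div_nonpos_of_nonpos_of_nonneg (by linarith) hε.le
  rw [cutoff, max_eq_left ((min_le_right _ _).trans this)]

theorem cutoff_eq {ε r : ℝ} (hε : 0 < ε) (h1 : 1 - 2 * ε ≤ r) (h2 : r ≤ 1 - ε) :
    cutoff ε r = (1 - ε - r) / ε := by
  have h3 : (1 - ε - r) / ε ≤ 1 := by rw [div_le_iff₀ hε]; linarith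
  have h4 : 0 ≤ (1 - ε - r) / ε := div_nonneg (by linarith) hε.le
  rw [cutoff, min_eq_right h3, max_eq_right h4]

theorem lipschitzWith_cutoff {ε : ℝ} (hε : 0 < ε) :
    LipschitzWith (Real.toNNReal (1 / ε)) (cutoff ε) := by
  refine (LipschitzWith.const_min ?_ 1).const_max 0
  refine LipschitzWith.of_dist_le_mul fun r s => ?_
  rw [Real.coe_toNNReal _ (by positivity), Real.dist_eq, Real.dist_eq, ← sub_div,
    sub_sub_sub_cancel_left, abs_div, abs_of_pos hε, abs_sub_comm]
  apply le_of_eq; ring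

/-- The two kinks are excluded; they form a null set of levels. The half-open interval matches the
convention of interval integrals. -/
theorem hasDerivAt_cutoff {ε r : ℝ} (hε : 0 < ε) (h1 : r ≠ 1 - 2 * ε) (h2 : r ≠ 1 - ε) :
    HasDerivAt (cutoff ε) ((Ioc (1 - 2 * ε) (1 - ε)).indicator (fun _ => -ε⁻¹) r) r := by
  rcases lt_or_gt_of_ne h1 with h1 | h1
  · rw [indicator_of_notMem fun h => not_lt.2 h.1.le h1]
    refine (hasDerivAt_const r 1).congr_of_eventuallyEq ?_
    filter_upwards [Iio_mem_nhds h1] with s hs using cutoff_eq_one hε (le_of_lt hs)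
  · rcases lt_or_gt_of_ne h2 with h2 | h2
    · rw [indicator_of_mem (show r ∈ Ioc (1 - 2 * ε) (1 - ε) from ⟨h1, h2.le⟩)]
      have h3 : HasDerivAt (fun s => (1 - ε - s) / ε) (-1 / ε) r :=
        ((hasDerivAt_id r).const_sub (1 - ε)).div_const ε
      rw [neg_div, one_div] at h3
      refine h3.congr_of_eventuallyEq ?_
      filter_upwards [Ioo_mem_nhds h1 h2] with s hs using cutoff_eq hε hs.1.le hs.2.le
    · rw [indicator_of_notMem fun h => not_lt.2 h.2 h2]
      refine (hasDerivAt_const r 0).congr_of_eventuallyEq ?_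
      filter_upwards [Ioi_mem_nhds h2] with s hs using cutoff_eq_zero hε (le_of_lt hs)

/-! ### Decomposition of a cell into the cones over its faces -/

namespace Mesh

variable {D : Diffusion d} {𝒯 ℱ : Type} {M : Mesh D 𝒯 ℱ} {T : 𝒯} {F : ℱ}

theorem bd_owner (F : ℱ) : M.Bd (M.owner F) F := Or.inl rfl

theorem mem_facesOf [Fintype ℱ] : F ∈ M.facesOf T ↔ M.Bd T F := by
  simp [facesOf]

theorem measurableSet_face (F : ℱ) : MeasurableSet (M.face F) := by
  obtain ⟨V, hV, h⟩ := M.face_flat _ F (bd_owner F)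
  rw [h]
  exact hV.measurableSet.inter (isClosed_eq (by fun_prop) continuous_const).measurableSet

/-- Openness lets the radial function be differentiated on the cone, where it coincides with an
affine function. -/
theorem isOpen_cone_face (h : M.Bd T F) : IsOpen (cone (M.pt T) (M.face F)) := by
  obtain ⟨V, hV, hF⟩ := M.face_flat T F h
  have hc := M.dist_pos T F h
  let ℓ : E d → ℝ := fun y => ⟪y - M.pt T, M.normal T F⟫ / M.dist T F
  have hℓ : Continuous ℓ := by fun_prop
  have hg : ContinuousOn (fun y => M.pt T + (ℓ y)⁻¹ • (y - M.pt T)) (ℓ ⁻¹' Ioo 0 1) := by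
    refine continuousOn_const.add (ContinuousOn.smul (hℓ.continuousOn.inv₀ fun y hy => hy.1.ne') ?_)
    fun_prop
  convert hg.isOpen_inter_preimage (isOpen_Ioo.preimage hℓ) hV using 1
  ext y
  constructor
  · rintro ⟨r, hr, z, hz, rfl⟩
    have hz' : ⟪z - M.pt T, M.normal T F⟫ = M.dist T F := face_subset_hyperplane h hz
    have hr' : ℓ (M.pt T + r • (z - M.pt T)) = r := by
      simp only [ℓ, add_sub_cancel_left, real_inner_smul_left, hz', mul_div_cancel_right₀ _ hc.ne']
    refine ⟨by rw [mem_preimage, hr']; exact hr, ?_⟩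
    rw [mem_preimage, hr', add_sub_cancel_left, smul_smul, inv_mul_cancel₀ hr.1.ne', one_smul,
      add_sub_cancel]
    rw [hF] at hz
    exact hz.1
  · rintro ⟨hy1, hy2⟩
    have hne : ℓ y ≠ 0 := hy1.1.ne'
    refine ⟨ℓ y, hy1, M.pt T + (ℓ y)⁻¹ • (y - M.pt T), ?_, ?_⟩
    · rw [hF]
      refine ⟨hy2, ?_⟩
      rw [mem_ofPred_eq, add_sub_cancel_left, real_inner_smul_left]
      have : ⟪y - M.pt T, M.normal T F⟫ = ℓ y * M.dist T F := by
        simp only [ℓ]; field_simp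
      rw [this, inv_mul_cancel_left₀ hne]
    · rw [add_sub_cancel_left, smul_smul, mul_inv_cancel₀ hne, one_smul, add_sub_cancel]

theorem volume_cell_lt_top (T : 𝒯) : volume (M.cell T) < ⊤ := (M.isBounded_cell T).measure_lt_top

theorem volume_cone_face (h : M.Bd T F) : volume (cone (M.pt T) (M.face F)) =
    ENNReal.ofReal (M.dist T F / d) * (μHE[d - 1] : Measure (E d)) (M.face F) :=
  volume_cone (M.normal_norm T F h) (M.dist_pos T F h) (face_subset_hyperplane h)
    (measurableSet_face F)

theorem cone_face_subset_cell [Finite ℱ] (h : M.Bd T F) : cone (M.pt T) (M.face F) ⊆ M.cell T := by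
  refine Subset.trans ?_ (cone_face_subset h)
  rintro _ ⟨r, hr, z, hz, rfl⟩
  exact ⟨r, hr, z, subset_closure hz, rfl⟩

/-- The cone over the face lies in the bounded cell, and its volume is a positive multiple of the
measure of the face. -/
theorem measure_face_lt_top [Finite ℱ] (F : ℱ) : (μHE[d - 1] : Measure (E d)) (M.face F) < ⊤ := by
  have h := bd_owner (M := M) F
  have h1 : volume (cone (M.pt (M.owner F)) (M.face F)) < ⊤ :=
    (measure_mono (cone_face_subset_cell h)).trans_lt (volume_cell_lt_top _)
  rw [volume_cone_face h] at h1
  have hd := one_le_of_norm_eq_one (M.normal_norm _ F h)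
  have h2 : 0 < M.dist (M.owner F) F / d :=
    div_pos (M.dist_pos _ F h) (by exact_mod_cast hd)
  exact (ENNReal.mul_lt_top_iff.1 h1).elim (fun h => h.2) fun h => h.elim
    (fun h => absurd h (ENNReal.ofReal_pos.2 h2).ne') fun h => by simp [h]

theorem volume_cone_boundary (h : M.Bd T F) :
    volume (cone (M.pt T) (closure (M.face F) \ M.face F)) = 0 := by
  rw [volume_cone (M.normal_norm T F h) (M.dist_pos T F h)
    (sdiff_subset.trans (closure_face_subset_hyperplane h))
    (isClosed_closure.measurableSet.diff (measurableSet_face F)), M.face_boundary_null F, mul_zero]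

variable [Fintype ℱ]

/-- The cones over the closed faces cover the cell except for `x_T`. What is lost by passing to open
faces is a union of cones over null sets, and the apex is null because `1 ≤ d`. -/
theorem cell_ae_eq_cones (hd : 1 ≤ d) (T : 𝒯) : M.cell T =ᵐ[volume]
    ⋃ F ∈ M.facesOf T, cone (M.pt T) (M.face F) := by
  refine EventuallyLE.antisymm ?_ ?_
  · have : Nonempty (Fin d) := ⟨⟨0, hd⟩⟩
    have hnull : volume ({M.pt T} ∪ ⋃ F ∈ M.facesOf T,
        cone (M.pt T) (closure (M.face F) \ M.face F)) = 0 := by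
      refine measure_union_null (measure_singleton _) ?_
      exact (measure_biUnion_null_iff (M.facesOf T).countable_toSet).2 fun F hF =>
        volume_cone_boundary (mem_facesOf.1 hF)
    rw [ae_le_set]
    refine measure_mono_null ?_ hnull
    rintro y ⟨hy, hy'⟩
    rcases cell_subset_cones hy with h | h
    · exact Or.inl h
    · right
      obtain ⟨F, hF, r, hr, z, hz, he⟩ := mem_iUnion₂.1 h
      refine mem_biUnion (mem_facesOf.2 hF) ⟨r, hr, z, ⟨hz, fun hz' => hy' ?_⟩, he⟩
      exact mem_biUnion (mem_facesOf.2 hF) ⟨r, hr, z, hz', he⟩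
  · exact (iUnion₂_subset fun F hF => cone_face_subset_cell (mem_facesOf.1 hF)).eventuallyLE

theorem pairwiseDisjoint_cones (T : 𝒯) : (M.facesOf T : Set ℱ).PairwiseDisjoint
    fun F => cone (M.pt T) (M.face F) :=
  fun _ hF _ hF' hne => cone_face_disjoint (mem_facesOf.1 hF) (mem_facesOf.1 hF') hne

theorem integral_cell_eq_sum (hd : 1 ≤ d) {w : E d → ℝ} (hw : IntegrableOn w (M.cell T)) :
    ∫ y in M.cell T, w y = ∑ F ∈ M.facesOf T, ∫ y in cone (M.pt T) (M.face F), w y := by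
  rw [setIntegral_congr_set (cell_ae_eq_cones hd T)]
  exact integral_biUnion_finset _ (fun F hF => (isOpen_cone_face (mem_facesOf.1 hF)).measurableSet)
    (pairwiseDisjoint_cones T)
    fun F hF => hw.mono_set (cone_face_subset_cell (mem_facesOf.1 hF))

/-- The disjoint cones in the cell have volumes `|F| d_TF / d`. -/
theorem sum_area_mul_dist_le (hd : 1 ≤ d) (T : 𝒯) :
    ∑ F ∈ M.facesOf T, M.area F * M.dist T F ≤ d * volume.real (M.cell T) := by
  have hd0 : (0 : ℝ) < d := by exact_mod_cast hd
  have h1 : volume.real (⋃ F ∈ M.facesOf T, cone (M.pt T) (M.face F)) =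
      ∑ F ∈ M.facesOf T, volume.real (cone (M.pt T) (M.face F)) :=
    measureReal_biUnion_finset (pairwiseDisjoint_cones T)
      (fun F hF => (isOpen_cone_face (mem_facesOf.1 hF)).measurableSet)
      fun F hF => ((measure_mono (cone_face_subset_cell (mem_facesOf.1 hF))).trans_lt
        (volume_cell_lt_top _)).ne
  have h2 : ∀ F ∈ M.facesOf T, volume.real (cone (M.pt T) (M.face F)) =
      M.area F * M.dist T F / d := by
    intro F hF
    have h := mem_facesOf.1 hF
    rw [measureReal_def, volume_cone_face h, ENNReal.toReal_mul, ENNReal.toReal_ofReal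
      (div_nonneg (M.dist_pos T F h).le hd0.le), area, measureReal_def]
    ring
  rw [Finset.sum_congr rfl h2, ← Finset.sum_div] at h1
  have h3 : volume.real (⋃ F ∈ M.facesOf T, cone (M.pt T) (M.face F)) ≤ volume.real (M.cell T) :=
    measureReal_mono (iUnion₂_subset fun F hF => cone_face_subset_cell (mem_facesOf.1 hF))
      (volume_cell_lt_top _).ne
  rw [h1, div_le_iff₀ hd0] at h3
  linarith

end Mesh

end MPFA

/-! ### Radial cut-offs and the divergence theorem in a cell -/

namespace MPFA

variable {d : ℕ}

namespace Mesh

variable {D : Diffusion d} {𝒯 ℱ : Type} {M : Mesh D 𝒯 ℱ} {T : 𝒯} {F : ℱ}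

variable (M T F) in
/-- The flux of `q` through the dilated face at level `r` of the cone over `F`. -/
noncomputable def levelFlux (q : E d → E d) (r : ℝ) : ℝ :=
  r ^ (d - 1) * ∫ z in M.face F, ⟪q (M.pt T + r • (z - M.pt T)), M.normal T F⟫
    ∂(μHE[d - 1] : Measure (E d))

theorem levelFlux_one (q : E d → E d) : M.levelFlux T F q 1 =
    ∫ z in M.face F, ⟪q z, M.normal T F⟫ ∂(μHE[d - 1] : Measure (E d)) := by
  simp [levelFlux]

/-- Dominated convergence, the bound being the maximum of `‖q‖` on the compact closed cell.
Continuity at `r = 1` recovers the flux through the face itself. -/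
theorem continuousOn_levelFlux [Finite ℱ] (h : M.Bd T F) {q : E d → E d}
    (hq : ContinuousOn q (closure (M.cell T))) : ContinuousOn (M.levelFlux T F q) (Icc 0 1) := by
  obtain ⟨B, hB⟩ := (M.isCompact_closure_cell T).exists_bound_of_continuousOn hq
  have : IsFiniteMeasure ((μHE[d - 1] : Measure (E d)).restrict (M.face F)) :=
    ⟨by rw [Measure.restrict_apply_univ]; exact measure_face_lt_top F⟩
  have hmem : ∀ r ∈ Icc (0 : ℝ) 1, ∀ z ∈ M.face F,
      M.pt T + r • (z - M.pt T) ∈ closure (M.cell T) := fun r hr z hz =>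
    M.closure_star (frontier_subset_closure
      (closure_face_subset_frontier h (subset_closure hz))) hr.1 hr.2
  refine (continuousOn_id.pow _).mul ?_
  refine continuousOn_of_dominated (bound := fun _ => B) (fun r hr => ?_) (fun r hr => ?_)
    (integrable_const B) ?_
  · refine ContinuousOn.aestronglyMeasurable ?_ (measurableSet_face F)
    exact (hq.comp (f := fun z => M.pt T + r • (z - M.pt T)) (by fun_prop)
      (hmem r hr)).inner continuousOn_const
  · refine (ae_restrict_iff' (measurableSet_face F)).2 (Eventually.of_forall fun z hz => ?_)
    refine (norm_inner_le_norm _ _).trans ?_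
    rw [M.normal_norm T F h, mul_one]
    exact hB _ (hmem r hr z hz)
  · refine (ae_restrict_iff' (measurableSet_face F)).2 (Eventually.of_forall fun z hz => ?_)
    exact (hq.comp (f := fun r : ℝ => M.pt T + r • (z - M.pt T)) (by fun_prop)
      (fun r hr => hmem r hr z hz)).inner continuousOn_const

variable (M T) in
/-- Lipschitz approximations of the indicator function of a cell. -/
noncomputable def bump (ε : ℝ) (y : E d) : ℝ := cutoff ε (M.radial T y)

section

variable [Finite ℱ]

theorem radial_eq_of_mem_cone (h : M.Bd T F) {y : E d} (hy : y ∈ cone (M.pt T) (M.face F)) :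
    M.radial T y = ⟪y - M.pt T, M.normal T F⟫ / M.dist T F := by
  obtain ⟨r, hr, z, hz, rfl⟩ := hy
  have hz' : ⟪z - M.pt T, M.normal T F⟫ = M.dist T F := face_subset_hyperplane h hz
  rw [radial_add_smul (closure_face_subset_frontier h (subset_closure hz)) hr.1.le,
    add_sub_cancel_left, real_inner_smul_left, hz', mul_div_cancel_right₀ _ (M.dist_pos T F h).ne']

/-- On the open cone the bump is the cut-off composed with an affine function of gradient `n_TF /
d_TF`, so the chain rule applies away from the kinks. -/
theorem fderiv_bump (h : M.Bd T F) {ε : ℝ} (hε : 0 < ε) {r : ℝ} (hr : r ∈ Ioo (0 : ℝ) 1)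
    (h1 : r ≠ 1 - 2 * ε) (h2 : r ≠ 1 - ε) {z : E d} (hz : z ∈ M.face F) (v : E d) :
    fderiv ℝ (M.bump T ε) (M.pt T + r • (z - M.pt T)) v =
      (Ioc (1 - 2 * ε) (1 - ε)).indicator (fun _ => -ε⁻¹) r *
        (⟪v, M.normal T F⟫ / M.dist T F) := by
  have hmem : M.pt T + r • (z - M.pt T) ∈ cone (M.pt T) (M.face F) := ⟨r, hr, z, hz, rfl⟩
  have hz' : ⟪z - M.pt T, M.normal T F⟫ = M.dist T F := face_subset_hyperplane h hz
  let ℓ : E d → ℝ := fun y => ⟪y - M.pt T, M.normal T F⟫ / M.dist T F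
  have hℓ : HasFDerivAt ℓ ((M.dist T F)⁻¹ • innerSL ℝ (M.normal T F))
      (M.pt T + r • (z - M.pt T)) := by
    have : ℓ = fun y => (M.dist T F)⁻¹ * (innerSL ℝ (M.normal T F) (y - M.pt T)) := by
      ext y
      simp only [ℓ]
      rw [innerSL_apply_apply, real_inner_comm, div_eq_inv_mul]
    rw [this]
    exact ((innerSL ℝ (M.normal T F)).hasFDerivAt.comp _
      ((hasFDerivAt_id _).sub_const (M.pt T))).const_mul _
  have hval : ℓ (M.pt T + r • (z - M.pt T)) = r := by
    simp only [ℓ, add_sub_cancel_left, real_inner_smul_left, hz',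
      mul_div_cancel_right₀ _ (M.dist_pos T F h).ne']
  have hcut := hasDerivAt_cutoff hε h1 h2
  rw [← hval] at hcut
  have h3 := hcut.comp_hasFDerivAt _ hℓ
  rw [hval] at h3
  have h4 : M.bump T ε =ᶠ[𝓝 (M.pt T + r • (z - M.pt T))] cutoff ε ∘ ℓ := by
    filter_upwards [(isOpen_cone_face h).mem_nhds hmem] with y hy
    simp only [bump, Function.comp_apply, ℓ, radial_eq_of_mem_cone h hy]
  rw [(h3.congr_of_eventuallyEq h4).fderiv]
  simp only [smul_apply, innerSL_apply_apply, smul_eq_mul, real_inner_comm v]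
  ring

theorem lipschitzWith_bump (hd : 1 ≤ d) {ε : ℝ} (hε : 0 < ε) :
    ∃ L, LipschitzWith L (M.bump T ε) := by
  obtain ⟨L, hL⟩ := exists_lipschitzWith_radial (M := M) (T := T) hd
  exact ⟨_, (lipschitzWith_cutoff hε).comp hL⟩

theorem tsupport_bump {ε : ℝ} (hε : 0 < ε) : tsupport (M.bump T ε) ⊆ M.cell T := by
  have h1 : tsupport (M.bump T ε) ⊆ {y | M.radial T y ≤ 1 - ε} := by
    refine closure_minimal (fun y hy => ?_) (isClosed_le continuous_radial continuous_const)
    by_contra hcon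
    exact hy (cutoff_eq_zero hε (not_le.1 hcon).le)
  exact fun y hy => radial_lt_one_iff.1 ((h1 hy).trans_lt (by linarith))

theorem hasCompactSupport_bump {ε : ℝ} (hε : 0 < ε) : HasCompactSupport (M.bump T ε) :=
  (M.isCompact_closure_cell T).of_isClosed_subset (isClosed_tsupport _)
    ((tsupport_bump hε).trans subset_closure)

theorem integrableOn_fderiv_bump (hd : 1 ≤ d) {ε : ℝ} (hε : 0 < ε) {q : E d → E d}
    (hq : IntegrableOn q (M.cell T)) :
    IntegrableOn (fun y => fderiv ℝ (M.bump T ε) y (q y)) (M.cell T) := by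
  obtain ⟨L, hL⟩ := lipschitzWith_bump (M := M) (T := T) hd hε
  refine (hq.norm.const_mul (L : ℝ)).mono' ?_ (Eventually.of_forall fun y => ?_)
  · exact isBoundedBilinearMap_apply.continuous.comp_aestronglyMeasurable
      ((measurable_fderiv ℝ (M.bump T ε)).stronglyMeasurable.aestronglyMeasurable.prodMk
        hq.aestronglyMeasurable)
  · exact (ContinuousLinearMap.le_opNorm _ _).trans (mul_le_mul_of_nonneg_right
      (norm_fderiv_le_of_lipschitz ℝ hL) (norm_nonneg _))

/-- The factor `d_TF` from radial integration cancels the one in the gradient of the bump, leaving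
an average of the level fluxes over an interval of length `ε`. -/
theorem integral_cone_bump (hd : 1 ≤ d) (h : M.Bd T F) {ε : ℝ} (hε : 0 < ε) (hε' : 2 * ε ≤ 1)
    {q : E d → E d} (hq : IntegrableOn q (M.cell T)) :
    ∫ y in cone (M.pt T) (M.face F), fderiv ℝ (M.bump T ε) y (q y) =
      -(ε⁻¹ * ∫ r in (1 - 2 * ε)..(1 - ε), M.levelFlux T F q r) := by
  have hc := M.dist_pos T F h
  rw [integral_cone_radial (M.normal_norm T F h) hc (face_subset_hyperplane h)
    (measurableSet_face F) ((integrableOn_fderiv_bump hd hε hq).mono_set (cone_face_subset_cell h))]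
  have h1 : ∀ᵐ r : ℝ, r ∈ uIoc 0 1 → M.dist T F * (r ^ (d - 1) *
      ∫ z in M.face F, fderiv ℝ (M.bump T ε) (M.pt T + r • (z - M.pt T))
        (q (M.pt T + r • (z - M.pt T))) ∂(μHE[d - 1] : Measure (E d))) =
      (Ioc (1 - 2 * ε) (1 - ε)).indicator (fun r => -ε⁻¹ * M.levelFlux T F q r) r := by
    have hfin : ∀ᵐ r : ℝ, r ∉ ({1 - 2 * ε, 1 - ε, 1} : Set ℝ) :=
      measure_eq_zero_iff_ae_notMem.1 ((toFinite _).measure_zero _)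
    filter_upwards [hfin] with r hr hr01
    rw [uIoc_of_le zero_le_one] at hr01
    simp only [mem_insert_iff, mem_singleton_iff, not_or] at hr
    have hr' : r ∈ Ioo (0 : ℝ) 1 := ⟨hr01.1, lt_of_le_of_ne hr01.2 hr.2.2⟩
    rw [setIntegral_congr_fun (measurableSet_face F)
      (fun z hz => fderiv_bump h hε hr' hr.1 hr.2.1 hz _), integral_const_mul, integral_div]
    by_cases hmem : r ∈ Ioc (1 - 2 * ε) (1 - ε)
    · rw [indicator_of_mem hmem, indicator_of_mem hmem, levelFlux]
      field_simp
    · rw [indicator_of_notMem hmem, indicator_of_notMem hmem]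
      ring
  rw [intervalIntegral.integral_congr_ae h1, intervalIntegral.integral_of_le zero_le_one,
    setIntegral_indicator measurableSet_Ioc, intervalIntegral.integral_of_le (by linarith),
    inter_eq_self_of_subset_right (Ioc_subset_Ioc (by linarith) (by linarith)),
    integral_const_mul, neg_mul]

end

/-- The divergence theorem in a cell: if `-div q = f` weakly in the cell, then the outward fluxes
of `-q` through the faces sum up to the integral of `f`. -/
theorem integral_cell_eq_neg_sum_flux [Fintype ℱ] (hd : 1 ≤ d) {q : E d → E d} {f : E d → ℝ}
    (hq : ContinuousOn q (closure (M.cell T))) (hf : IntegrableOn f (M.cell T))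
    (h : WeakDiv (M.cell T) q f) :
    ∫ x in M.cell T, f x = -∑ F ∈ M.facesOf T,
      ∫ z in M.face F, ⟪q z, M.normal T F⟫ ∂(μHE[d - 1] : Measure (E d)) := by
  have hqi : IntegrableOn q (M.cell T) :=
    (hq.integrableOn_compact (M.isCompact_closure_cell T)).mono_set subset_closure
  -- The factor `1 / 2` ensures `2 * ε k ≤ 1`, so the transition layers stay in `[0, 1]`.
  let ε : ℕ → ℝ := fun k => 1 / (k + 1) / 2
  have hε : ∀ k, 0 < ε k := fun k => by positivity
  have hε' : ∀ k, 2 * ε k ≤ 1 := fun k => by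
    have : (1 : ℝ) / (k + 1) ≤ 1 := by
      rw [div_le_one (by positivity)]; linarith [(Nat.cast_nonneg k : (0 : ℝ) ≤ k)]
    simp only [ε]; linarith
  have hε0 : Tendsto ε atTop (𝓝 0) := by
    have h0 := (tendsto_one_div_add_atTop_nhds_zero_nat (𝕜 := ℝ)).div_const 2
    rwa [zero_div] at h0
  have e1 : Tendsto (fun k => ∫ x in M.cell T, f x * M.bump T (ε k) x) atTop
      (𝓝 (∫ x in M.cell T, f x)) := by
    refine tendsto_integral_of_dominated_convergence (fun x => ‖f x‖) (fun k => ?_) hf.norm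
      (fun k => Eventually.of_forall fun x => ?_) ?_
    · obtain ⟨L, hL⟩ := lipschitzWith_bump (M := M) (T := T) hd (hε k)
      exact hf.aestronglyMeasurable.mul hL.continuous.aestronglyMeasurable
    · rw [norm_mul]
      refine mul_le_of_le_one_right (norm_nonneg _) ?_
      rw [Real.norm_of_nonneg (show 0 ≤ M.bump T (ε k) x from cutoff_nonneg _ _)]
      exact cutoff_le_one _ _
    · refine (ae_restrict_iff' (M.cell_open T).measurableSet).2 (Eventually.of_forall fun x hx => ?_)
      refine tendsto_const_nhds.congr' ?_
      have h1 : 0 < 1 - M.radial T x := sub_pos.2 (radial_lt_one_iff.2 hx)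
      have h2 : Tendsto (fun k => 2 * ε k) atTop (𝓝 0) := by simpa using hε0.const_mul 2
      filter_upwards [h2.eventually_lt_const h1] with k hk
      rw [bump, cutoff_eq_one (hε k) (by linarith), mul_one]
  have e2 : Tendsto (fun k => ∑ F ∈ M.facesOf T,
      -((ε k)⁻¹ * ∫ r in (1 - 2 * ε k)..(1 - ε k), M.levelFlux T F q r)) atTop
      (𝓝 (∑ F ∈ M.facesOf T, -M.levelFlux T F q 1)) :=
    tendsto_finsetSum _ fun F hF => (tendsto_average_left
      (continuousOn_levelFlux (mem_facesOf.1 hF) hq) hε hε' hε0).neg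
  have e3 : ∀ k, ∫ x in M.cell T, f x * M.bump T (ε k) x = ∑ F ∈ M.facesOf T,
      -((ε k)⁻¹ * ∫ r in (1 - 2 * ε k)..(1 - ε k), M.levelFlux T F q r) := by
    intro k
    obtain ⟨L, hL⟩ := lipschitzWith_bump (M := M) (T := T) hd (hε k)
    rw [← h.lipschitz (M.cell_open T) hqi hf hL (hasCompactSupport_bump (hε k))
      (tsupport_bump (hε k)), integral_cell_eq_sum hd (integrableOn_fderiv_bump hd (hε k) hqi)]
    exact Finset.sum_congr rfl fun F hF =>
      integral_cone_bump hd (mem_facesOf.1 hF) (hε k) (hε' k) hqi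
  simp only [e3] at e1
  rw [tendsto_nhds_unique e1 e2, Finset.sum_neg_distrib]
  simp only [levelFlux_one]

end Mesh

end MPFA

/-! ### Half balls and generic points of the faces -/

namespace MPFA

variable {d : ℕ}

/-- The half ball of centre `p` on the side of the hyperplane `p + n^⊥` opposite to `n`. -/
def halfBall (p n : E d) (r : ℝ) : Set (E d) := Metric.ball p r ∩ {y | ⟪y - p, n⟫ < 0}

theorem isOpen_halfBall (p n : E d) (r : ℝ) : IsOpen (halfBall p n r) :=
  Metric.isOpen_ball.inter (isOpen_lt (by fun_prop) continuous_const)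

theorem convex_halfBall (p n : E d) (r : ℝ) : Convex ℝ (halfBall p n r) := by
  refine (convex_ball p r).inter fun y hy z hz a b ha hb hab => ?_
  have h1 : a • y + b • z - p = a • (y - p) + b • (z - p) := by
    rw [← sub_eq_zero]
    have : p = (a + b) • p := by rw [hab, one_smul]
    nth_rewrite 1 [this]
    module
  have hy' : ⟪y - p, n⟫ < 0 := hy
  have hz' : ⟪z - p, n⟫ < 0 := hz
  change ⟪a • y + b • z - p, n⟫ < 0
  rw [h1, inner_add_left, real_inner_smul_left, real_inner_smul_left]
  rcases ha.eq_or_lt with rfl | ha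
  · have : b = 1 := by linarith
    subst this; linarith
  · nlinarith [mul_neg_of_pos_of_neg ha hy', mul_nonneg hb (neg_nonneg.2 hz'.le)]

theorem halfBall_mono (p n : E d) {r r' : ℝ} (h : r ≤ r') : halfBall p n r ⊆ halfBall p n r' :=
  inter_subset_inter_left _ (Metric.ball_subset_ball h)

theorem sub_smul_mem_halfBall {p n : E d} {r t : ℝ} (hn : ‖n‖ = 1) (h0 : 0 < t) (h1 : t < r) :
    p - t • n ∈ halfBall p n r := by
  refine ⟨?_, ?_⟩
  · rw [Metric.mem_ball, dist_eq_norm, sub_sub_cancel_left, norm_neg, norm_smul, hn,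
      Real.norm_of_nonneg h0.le, mul_one]
    exact h1
  · change ⟪p - t • n - p, n⟫ < 0
    rw [sub_sub_cancel_left, inner_neg_left, real_inner_smul_left, real_inner_self_eq_norm_sq, hn]
    linarith

theorem halfBall_mem_nhdsWithin (p n : E d) {r : ℝ} (hr : 0 < r) :
    halfBall p n r ∈ 𝓝[{y | ⟪y - p, n⟫ < 0}] p :=
  inter_mem (mem_nhdsWithin_of_mem_nhds (Metric.ball_mem_nhds p hr)) self_mem_nhdsWithin

/-- Points of the closed half ball are limits of points of the half ball. -/
theorem mem_closure_halfBall {p n y : E d} {r : ℝ} (hn : ‖n‖ = 1) (hy : y ∈ Metric.ball p r)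
    (h : ⟪y - p, n⟫ ≤ 0) : y ∈ closure (halfBall p n r) := by
  have hc : Tendsto (fun t : ℝ => y - t • n) (𝓝[>] 0) (𝓝 y) := by
    have : Continuous fun t : ℝ => y - t • n := by fun_prop
    simpa using (this.tendsto 0).mono_left nhdsWithin_le_nhds
  refine mem_closure_of_tendsto hc ?_
  filter_upwards [hc (Metric.isOpen_ball.mem_nhds hy), self_mem_nhdsWithin] with t h1 h2
  refine ⟨h1, ?_⟩
  have h2' : (0 : ℝ) < t := h2
  change ⟪y - t • n - p, n⟫ < 0
  rw [sub_right_comm, inner_sub_left, real_inner_smul_left, real_inner_self_eq_norm_sq, hn]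
  linarith

/-- A vector orthogonal to the hyperplane `n^⊥` is a multiple of `n`. -/
theorem eq_inner_smul_of_perp {n a : E d} (hn : ‖n‖ = 1)
    (h : ∀ w : E d, ⟪w, n⟫ = 0 → ⟪w, a⟫ = 0) : a = ⟪a, n⟫ • n := by
  rw [← sub_eq_zero, ← inner_self_eq_zero (𝕜 := ℝ)]
  have hw : ⟪a - ⟪a, n⟫ • n, n⟫ = 0 := by
    rw [inner_sub_left, real_inner_smul_left, real_inner_self_eq_norm_sq, hn]; ring
  conv_lhs => rw [inner_sub_right, h _ hw, real_inner_smul_right, hw]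
  ring

/-- A connected set that misses the frontier cannot meet both `U` and the complement of its closure.
-/
theorem Convex.subset_of_disjoint_frontier {A U : Set (E d)} (hA : Convex ℝ A) (hU : IsOpen U)
    (h : Disjoint A (frontier U)) (hne : (A ∩ closure U).Nonempty) : A ⊆ U := by
  refine hA.isPreconnected.subset_left_of_subset_union hU isClosed_closure.isOpen_compl
    (disjoint_compl_right.mono_left subset_closure |>.mono_right le_rfl) (fun x hx => ?_) ?_
  · by_cases hc : x ∈ closure U
    · left
      by_contra hn
      exact disjoint_left.1 h hx (by rw [hU.frontier_eq]; exact ⟨hc, hn⟩)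
    · exact Or.inr hc
  · obtain ⟨x, hx, hc⟩ := hne
    refine ⟨x, hx, ?_⟩
    by_contra hn
    exact disjoint_left.1 h hx (by rw [hU.frontier_eq]; exact ⟨hc, hn⟩)

namespace Mesh

variable {D : Diffusion d} {𝒯 ℱ : Type} {M : Mesh D 𝒯 ℱ} {T T' : 𝒯} {F : ℱ} {p : E d}

variable (M) in
/-- Points of a face which are not in the closure of another face. -/
def IsGood (F : ℱ) (p : E d) : Prop := p ∈ M.face F ∧ ∀ F', F' ≠ F → p ∉ closure (M.face F')

/-- Faces are disjoint, so a point of `F` in another closed face lies in the relative boundary of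
that face, which is null. -/
theorem ae_isGood [Finite ℱ] (F : ℱ) :
    ∀ᵐ p ∂((μHE[d - 1] : Measure (E d)).restrict (M.face F)), M.IsGood F p := by
  refine (ae_restrict_iff' (measurableSet_face F)).2 ?_
  have h : ∀ F', ∀ᵐ p ∂(μHE[d - 1] : Measure (E d)), p ∉ closure (M.face F') \ M.face F' :=
    fun F' => measure_eq_zero_iff_ae_notMem.1 (M.face_boundary_null F')
  filter_upwards [ae_all_iff.2 h] with p hp hpF
  exact ⟨hpF, fun F' hF' hc => hp F' ⟨hc, disjoint_left.1 (M.face_disjoint F F' hF'.symm) hpF⟩⟩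

/-- In the isometric chart of its hyperplane, the face contains a nonempty open set. -/
theorem measure_face_pos (F : ℱ) : 0 < (μHE[d - 1] : Measure (E d)) (M.face F) := by
  have h := M.bd_owner F
  have hn := M.normal_norm _ F h
  obtain ⟨V, hVo, hV⟩ := M.face_flat _ F h
  obtain ⟨p, hp⟩ := M.face_nonempty F
  have hsub : M.face F ⊆ {x | ⟪x - p, M.normal (M.owner F) F⟫ = 0} := fun x hx => by
    have h1 : ⟪x - M.pt (M.owner F), M.normal (M.owner F) F⟫ = _ := face_subset_hyperplane h hx
    have h2 : ⟪p - M.pt (M.owner F), M.normal (M.owner F) F⟫ = _ := face_subset_hyperplane h hp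
    change ⟪x - p, M.normal (M.owner F) F⟫ = 0
    rw [← sub_sub_sub_cancel_right x p (M.pt (M.owner F)), inner_sub_left, h1, h2, sub_self]
  rw [measure_slice hn hsub]
  have hc : Continuous fun a : Perp (M.normal (M.owner F) F) =>
    coord p (M.normal (M.owner F) F) (a, 0) := (isometry_coord_slice p _ 0).continuous
  refine ((hVo.preimage hc).measure_pos volume ⟨0, ?_⟩).trans_le (measure_mono fun a ha => ?_)
  · rw [hV] at hp
    simpa [coord] using hp.1
  · have h2 : ⟪p - M.pt (M.owner F), M.normal (M.owner F) F⟫ = _ := face_subset_hyperplane h hp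
    change coord p _ (a, 0) ∈ M.face F
    rw [hV]
    refine ⟨ha, ?_⟩
    change ⟪coord p _ (a, 0) - M.pt (M.owner F), _⟫ = _
    rw [← sub_add_sub_cancel _ p, inner_add_left, inner_coord hn, h2, zero_add]

theorem exists_isGood [Finite ℱ] (F : ℱ) : ∃ p, M.IsGood F p := by
  have : (ae ((μHE[d - 1] : Measure (E d)).restrict (M.face F))).NeBot := by
    rw [ae_neBot, Ne, Measure.restrict_eq_zero]
    exact (measure_face_pos F).ne'
  exact (ae_isGood (M := M) F).exists

theorem dist_add_inner (h : M.Bd T F) (hp : p ∈ M.face F) (y : E d) :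
    ⟪y - M.pt T, M.normal T F⟫ = M.dist T F + ⟪y - p, M.normal T F⟫ := by
  have h2 : ⟪p - M.pt T, M.normal T F⟫ = _ := face_subset_hyperplane h hp
  rw [← sub_add_sub_cancel y p, inner_add_left, h2, add_comm]

/-- Near a good point of a face, the cell is a half ball, and the hyperplane is in the face. -/
theorem IsGood.exists_ball [Finite ℱ] (hp : M.IsGood F p) (h : M.Bd T F) :
    ∃ r > 0, halfBall p (M.normal T F) r ⊆ M.cell T ∧
      (∀ y ∈ Metric.ball p r, ⟪y - p, M.normal T F⟫ = 0 → y ∈ M.face F) ∧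
      ∀ S, (halfBall p (-M.normal T F) r ∩ closure (M.cell S)).Nonempty →
        halfBall p (-M.normal T F) r ⊆ M.cell S := by
  obtain ⟨V, hVo, hV⟩ := M.face_flat T F h
  have hpV : p ∈ V := by have := hp.1; rw [hV] at this; exact this.1
  have h1 : ∀ᶠ y in 𝓝 p, ∀ F', F' ≠ F → y ∉ closure (M.face F') := by
    rw [eventually_all]
    intro F'
    by_cases hF : F' = F
    · exact Eventually.of_forall fun y hy => absurd hF hy
    · filter_upwards [isClosed_closure.isOpen_compl.mem_nhds (hp.2 F' hF)] with y hy _ using hy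
  obtain ⟨r, hr, hB⟩ := Metric.eventually_nhds_iff_ball.1 (h1.and (hVo.mem_nhds hpV))
  have hn := M.normal_norm T F h
  -- In this ball the frontier of any cell can only meet `F`, hence stays in the hyperplane. Each
  -- open half ball is therefore inside or outside each cell as a whole.
  have hside : ∀ S, ∀ y ∈ Metric.ball p r, ⟪y - p, M.normal T F⟫ ≠ 0 →
      y ∉ frontier (M.cell S) := by
    intro S y hy hyn hyS
    obtain ⟨F', -, hF'⟩ := exists_of_mem_frontier hyS
    by_cases hFF : F' = F
    · subst hFF
      have := closure_face_subset_hyperplane h hF'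
      rw [mem_ofPred_eq, dist_add_inner h hp.1] at this
      exact hyn (by linarith)
    · exact (hB y hy).1 F' hFF hF'
  refine ⟨r, hr, ?_, fun y hy h0 => ?_, fun S hS => ?_⟩
  · refine Convex.subset_of_disjoint_frontier (convex_halfBall _ _ _) (M.cell_open T)
      (disjoint_left.2 fun y hy => hside T y hy.1 (ne_of_lt hy.2)) ?_
    have hpc : p ∈ closure (M.cell T) :=
      frontier_subset_closure (closure_face_subset_frontier h (subset_closure hp.1))
    -- Points of the segment from `x_T` just before `p` lie in both the cell and the half ball.
    have hc : Tendsto (fun t : ℝ => M.pt T + t • (p - M.pt T)) (𝓝[<] 1) (𝓝 p) := by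
      have : Continuous fun t : ℝ => M.pt T + t • (p - M.pt T) := by fun_prop
      simpa using (this.tendsto 1).mono_left nhdsWithin_le_nhds
    obtain ⟨t, ht, ht1, ht0⟩ := ((hc.eventually (Metric.ball_mem_nhds p hr)).and
      (eventually_mem_nhdsWithin.and
        (nhdsWithin_le_nhds (lt_mem_nhds (zero_lt_one (α := ℝ)))))).exists
    have ht1' : t < 1 := ht1
    have ht0' : 0 < t := ht0
    refine ⟨M.pt T + t • (p - M.pt T), ⟨ht, ?_⟩, subset_closure (M.ray_mem hpc ht0'.le ht1')⟩
    have h4 := dist_add_inner h hp.1 (M.pt T + t • (p - M.pt T))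
    have h5 : ⟪p - M.pt T, M.normal T F⟫ = _ := face_subset_hyperplane h hp.1
    rw [add_sub_cancel_left, real_inner_smul_left, h5] at h4
    have := M.dist_pos T F h
    change ⟪_, _⟫ < 0
    nlinarith
  · rw [hV]
    refine ⟨(hB y hy).2, ?_⟩
    rw [mem_ofPred_eq, dist_add_inner h hp.1, h0, add_zero]
  · refine Convex.subset_of_disjoint_frontier (convex_halfBall _ _ _) (M.cell_open S)
      (disjoint_left.2 fun y hy => hside S y hy.1 fun h0 => ?_) hS
    have : ⟪y - p, -M.normal T F⟫ < 0 := hy.2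
    rw [inner_neg_right, h0, neg_zero] at this
    exact lt_irrefl _ this

/-- Otherwise the ray from `x_T` through `p` would meet the cell beyond `p`, and star-shapedness
would put `p` in the open cell. -/
theorem IsGood.not_halfBall_neg_subset (hp : M.IsGood F p) (h : M.Bd T F) {r : ℝ} (hr : 0 < r) :
    ¬ halfBall p (-M.normal T F) r ⊆ M.cell T := by
  intro hs
  have hc : Tendsto (fun t : ℝ => p + t • (p - M.pt T)) (𝓝[>] 0) (𝓝 p) := by
    have : Continuous fun t : ℝ => p + t • (p - M.pt T) := by fun_prop
    simpa using (this.tendsto 0).mono_left nhdsWithin_le_nhds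
  obtain ⟨t, ht, ht0⟩ := ((hc.eventually (Metric.ball_mem_nhds p hr)).and
    eventually_mem_nhdsWithin).exists
  have ht0' : 0 < t := ht0
  have h5 : ⟪p - M.pt T, M.normal T F⟫ = _ := face_subset_hyperplane h hp.1
  have hmem : p + t • (p - M.pt T) ∈ M.cell T := by
    refine hs ⟨ht, ?_⟩
    change ⟪_, _⟫ < 0
    rw [add_sub_cancel_left, inner_neg_right, real_inner_smul_left, h5]
    linarith [mul_pos ht0' (M.dist_pos T F h)]
  have hpT : p ∈ M.cell T := by
    have := (M.cell_star T).add_smul_sub_mem hmem (t := (1 + t)⁻¹) (by positivity)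
      (inv_le_one_of_one_le₀ (by linarith))
    have he : M.pt T + (1 + t)⁻¹ • (p + t • (p - M.pt T) - M.pt T) = p := by
      have : p + t • (p - M.pt T) - M.pt T = (1 + t) • (p - M.pt T) := by module
      rw [this, smul_smul, inv_mul_cancel₀ (by positivity), one_smul, add_sub_cancel]
    rwa [he] at this
  exact cell_not_mem_frontier hpT (closure_face_subset_frontier h (subset_closure hp.1))

theorem across_some_bd (h : M.Bd T F) (ha : M.across T F = some T') :
    T' ≠ T ∧ M.Bd T' F ∧ M.neighbor F ≠ none := by
  refine ⟨M.across_ne ha, M.across_bd ha, fun hn => ?_⟩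
  unfold across at ha
  split_ifs at ha with hc
  · rw [hn] at ha; exact Option.some_ne_none _ ha.symm
  · rcases h with h | h
    · exact hc h.symm
    · rw [hn] at h; exact Option.some_ne_none _ h.symm

theorem across_none_iff : M.across T F = none ↔ T = M.owner F ∧ M.neighbor F = none := by
  unfold across
  split_ifs with hc <;> simp [hc]

/-- Across an internal face, the half ball on the other side is in the other cell. -/
theorem IsGood.internal [Finite ℱ] (hp : M.IsGood F p) (h : M.Bd T F)
    (ha : M.across T F = some T') : M.normal T' F = -M.normal T F ∧
      ∃ r > 0, Metric.ball p r ⊆ D.Ω ∧ halfBall p (M.normal T F) r ⊆ M.cell T ∧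
        halfBall p (-M.normal T F) r ⊆ M.cell T' := by
  obtain ⟨hne, h', hnb⟩ := across_some_bd h ha
  obtain ⟨r, hr, h1, h2, -⟩ := hp.exists_ball h
  obtain ⟨r', hr', h1', h2', -⟩ := hp.exists_ball h'
  have hn := M.normal_norm T F h
  have hn' := M.normal_norm T' F h'
  -- Near `p` the face fills its hyperplane, so every direction tangent for `T` is tangent for `T'`.
  -- The unit normals are thus equal or opposite, and equality would place one half ball in two
  -- disjoint cells.
  have hperp : ∀ w : E d, ⟪w, M.normal T F⟫ = 0 → ⟪w, M.normal T' F⟫ = 0 := by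
    intro w hw
    have hc : Tendsto (fun t : ℝ => p + t • w) (𝓝[>] 0) (𝓝 p) := by
      have : Continuous fun t : ℝ => p + t • w := by fun_prop
      simpa using (this.tendsto 0).mono_left nhdsWithin_le_nhds
    obtain ⟨t, ht, ht0⟩ := ((hc.eventually (Metric.ball_mem_nhds p hr)).and
      eventually_mem_nhdsWithin).exists
    have ht0' : (0 : ℝ) < t := ht0
    have hf := face_subset_hyperplane h' (h2 _ ht (by
      rw [add_sub_cancel_left, real_inner_smul_left, hw, mul_zero]))
    rw [mem_ofPred_eq, dist_add_inner h' hp.1, add_sub_cancel_left, real_inner_smul_left] at hf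
    have : t * ⟪w, M.normal T' F⟫ = 0 := by linarith
    exact (mul_eq_zero.1 this).resolve_left ht0'.ne'
  have hpar := eq_inner_smul_of_perp hn hperp
  have hneg : M.normal T' F = -M.normal T F := by
    have habs : |⟪M.normal T' F, M.normal T F⟫| = 1 := by
      have := congrArg norm hpar
      rw [norm_smul, hn, hn', mul_one, Real.norm_eq_abs] at this
      exact this.symm
    rcases (abs_eq zero_le_one).1 habs with h3 | h3
    · exfalso
      rw [h3, one_smul] at hpar
      rw [hpar] at h1'
      have hm : 0 < min r r' := lt_min hr hr'
      have h4 := sub_smul_mem_halfBall (p := p) (r := min r r') (t := min r r' / 2) hn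
        (by linarith) (by linarith)
      exact disjoint_left.1 (M.cell_disjoint T T' hne.symm)
        (h1 (halfBall_mono _ _ (min_le_left _ _) h4)) (h1' (halfBall_mono _ _ (min_le_right _ _) h4))
    · rw [hpar, h3, neg_one_smul]
  refine ⟨hneg, ?_⟩
  obtain ⟨s, hs, hsΩ⟩ := Metric.isOpen_iff.1 D.Ω_polytopal.isOpen p (M.internal_face F hnb hp.1)
  rw [hneg] at h1'
  refine ⟨min s (min r r'), lt_min hs (lt_min hr hr'),
    (Metric.ball_subset_ball (min_le_left _ _)).trans hsΩ,
    (halfBall_mono _ _ ((min_le_right _ _).trans (min_le_left _ _))).trans h1,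
    (halfBall_mono _ _ ((min_le_right _ _).trans (min_le_right _ _))).trans h1'⟩

/-- Across a boundary face, the half ball on the other side is outside the domain. -/
theorem IsGood.boundary [Finite ℱ] [Finite 𝒯] (hp : M.IsGood F p) (ha : M.across T F = none) :
    ∃ r > 0, halfBall p (M.normal T F) r ⊆ M.cell T ∧
      Disjoint (halfBall p (-M.normal T F) r) D.Ω := by
  obtain ⟨hT, hnone⟩ := across_none_iff.1 ha
  have h : M.Bd T F := Or.inl hT.symm
  obtain ⟨r, hr, h1, -, h3⟩ := hp.exists_ball h
  refine ⟨r, hr, h1, disjoint_left.2 fun y hy hyΩ => ?_⟩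
  have hyc := subset_closure hyΩ
  rw [M.cell_cover] at hyc
  obtain ⟨S, hS⟩ := mem_iUnion.1 hyc
  -- A point of `Ω` beyond the face would put the whole outer half ball in some cell `S ≠ T`. Then
  -- `p`, outside `Ω`, is on the frontier of `S`, hence in a closed face of `S`; goodness forces it
  -- to be `F`, which belongs to `T` only.
  have hsub := h3 S ⟨y, hy, hS⟩
  have hST : S ≠ T := by
    rintro rfl
    exact hp.not_halfBall_neg_subset h hr hsub
  have hn := M.normal_norm T F h
  have hpS : p ∈ closure (M.cell S) := closure_mono hsub
    (mem_closure_halfBall (by rw [norm_neg, hn]) (Metric.mem_ball_self hr) (by simp))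
  have hpΩ : p ∉ D.Ω := by
    have := M.boundary_face F hnone hp.1
    rw [D.Ω_polytopal.isOpen.frontier_eq] at this
    exact this.2
  obtain ⟨F', hF', hpF'⟩ := exists_of_mem_frontier (M := M) (T := S) (z := p) (by
    rw [(M.cell_open S).frontier_eq]
    exact ⟨hpS, fun hm => hpΩ (M.cell_subset_domain S hm)⟩)
  by_cases hFF : F' = F
  · subst hFF
    rcases hF' with h5 | h5
    · exact hST (h5.symm.trans hT.symm)
    · rw [hnone] at h5; exact Option.some_ne_none _ h5.symm
  · exact hp.2 F' hFF hpF'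

end Mesh

end MPFA

namespace MPFA

variable {d : ℕ}

/-! ### Functions of class `C²` up to the boundary -/

theorem IsC2Closure.exists_gradient {U : Set (E d)} {u : E d → ℝ} (h : IsC2Closure U u) :
    ∃ G : E d → E d, ContinuousOn G (closure U) ∧ EqOn G (gradient u) U := by
  obtain ⟨g, hg, he⟩ := h.2 1 one_le_two
  refine ⟨fun x => (InnerProductSpace.toDual ℝ (E d)).symm
    (continuousMultilinearCurryFin1 ℝ (E d) ℝ (g x)), ?_, fun x hx => ?_⟩
  · exact (LinearIsometryEquiv.continuous _).comp_continuousOn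
      ((LinearIsometryEquiv.continuous _).comp_continuousOn hg)
  · change (InnerProductSpace.toDual ℝ (E d)).symm
      (continuousMultilinearCurryFin1 ℝ (E d) ℝ (g x)) = gradient u x
    rw [gradient]
    congr 1
    ext1 v
    rw [continuousMultilinearCurryFin1_apply, he hx, iteratedFDeriv_one_apply]
    rfl

/-- Real suprema are informative only when bounded; boundedness comes from the continuous extensions
to the compact closures. -/
theorem norm_iteratedFDeriv_le_c2Norm {D : Diffusion d} {u : E d → ℝ}
    (hu : ∀ i, IsC2Closure (D.part i) u) (i : Fin D.N) {k : ℕ} (hk : k ≤ 2) {x : E d}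
    (hx : x ∈ D.part i) : ‖iteratedFDeriv ℝ k u x‖ ≤ c2Norm D u := by
  have hb : BddAbove (range fun y : D.part i => ‖iteratedFDeriv ℝ k u (y : E d)‖) := by
    obtain ⟨g, hg, he⟩ := (hu i).2 k hk
    obtain ⟨C, hC⟩ := (D.part_polytopal i).isBounded.isCompact_closure.exists_bound_of_continuousOn
      hg
    refine ⟨C, ?_⟩
    rintro _ ⟨y, rfl⟩
    change ‖iteratedFDeriv ℝ k u (y : E d)‖ ≤ C
    rw [← he y.2]
    exact hC y (subset_closure y.2)
  have h1 := le_ciSup hb ⟨x, hx⟩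
  have h2 := le_ciSup (f := fun k : Fin 3 => ⨆ x : D.part i, ‖iteratedFDeriv ℝ (k : ℕ) u (x : E d)‖)
    (finite_range _).bddAbove ⟨k, by omega⟩
  have h3 := le_ciSup (f := fun i : Fin D.N => ⨆ k : Fin 3, ⨆ x : D.part i,
    ‖iteratedFDeriv ℝ (k : ℕ) u (x : E d)‖) (finite_range _).bddAbove i
  exact h1.trans (h2.trans h3)

/-- Subdomains need not be convex, so only the segment is assumed to lie in `U`. For segments issued
from `x_T` this is the star-shapedness of the cell. -/
theorem norm_fderiv_sub_le {U : Set (E d)} (hU : IsOpen U) {u : E d → ℝ} (hu : ContDiffOn ℝ 2 u U)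
    {M : ℝ} (hM : ∀ x ∈ U, ‖iteratedFDeriv ℝ 2 u x‖ ≤ M) {x y : E d} (hs : segment ℝ x y ⊆ U) :
    ‖fderiv ℝ u y - fderiv ℝ u x‖ ≤ M * ‖y - x‖ := by
  have h1 : ContDiffOn ℝ 1 (fderiv ℝ u) U := hu.fderiv_of_isOpen hU (by norm_num)
  refine Convex.norm_image_sub_le_of_norm_fderiv_le (𝕜 := ℝ) (s := segment ℝ x y)
    (fun z hz => (h1.contDiffAt (hU.mem_nhds (hs hz))).differentiableAt one_ne_zero)
    (fun z hz => ?_) (convex_segment x y) (left_mem_segment ℝ x y) (right_mem_segment ℝ x y)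
  rw [← norm_iteratedFDeriv_one, norm_iteratedFDeriv_fderiv]
  exact hM z (hs hz)

theorem norm_taylor_le {U : Set (E d)} (hU : IsOpen U) {u : E d → ℝ} (hu : ContDiffOn ℝ 2 u U)
    {M : ℝ} (hM : ∀ x ∈ U, ‖iteratedFDeriv ℝ 2 u x‖ ≤ M) {x y : E d} (hs : segment ℝ x y ⊆ U) :
    |u y - u x - fderiv ℝ u x (y - x)| ≤ M * ‖y - x‖ ^ 2 := by
  have hM0 : 0 ≤ M := (norm_nonneg _).trans (hM x (hs (left_mem_segment ℝ x y)))
  have hd : ∀ z ∈ segment ℝ x y, DifferentiableAt ℝ u z := fun z hz =>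
    (hu.contDiffAt (hU.mem_nhds (hs hz))).differentiableAt two_ne_zero
  have h := Convex.norm_image_sub_le_of_norm_hasFDerivWithin_le (𝕜 := ℝ)
    (f := fun z => u z - fderiv ℝ u x z) (f' := fun z => fderiv ℝ u z - fderiv ℝ u x)
    (s := segment ℝ x y) (C := M * ‖y - x‖)
    (fun z hz => ((hd z hz).hasFDerivAt.sub (fderiv ℝ u x).hasFDerivAt).hasFDerivWithinAt)
    (fun z hz => ?_) (convex_segment x y) (left_mem_segment ℝ x y) (right_mem_segment ℝ x y)
  · rw [map_sub, pow_two, ← mul_assoc]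
    refine le_of_eq_of_le ?_ h
    rw [Real.norm_eq_abs]
    congr 1
    ring
  · refine (norm_fderiv_sub_le hU hu hM
      (((convex_segment x y).segment_subset (left_mem_segment ℝ x y) hz).trans hs)).trans ?_
    refine mul_le_mul_of_nonneg_left ?_ hM0
    rw [segment_eq_image'] at hz
    obtain ⟨t, ht, rfl⟩ := hz
    rw [add_sub_cancel_left, norm_smul, Real.norm_of_nonneg ht.1]
    exact mul_le_of_le_one_left (norm_nonneg _) ht.2

theorem continuous_act (A : Matrix (Fin d) (Fin d) ℝ) : Continuous (act A) :=
  LinearMap.continuous_of_finiteDimensional (Matrix.toEuclideanLin A)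

theorem Diffusion.field_eq (D : Diffusion d) {i : Fin D.N} {x : E d} (hx : x ∈ D.part i) :
    D.field x = D.tensor i := by
  rw [Diffusion.field, Finset.sum_eq_single i, indicator_of_mem hx]
  · intro j _ hj
    exact indicator_of_notMem (fun h => disjoint_left.1 (D.part_disjoint j i hj) h hx) _
  · simp

theorem Diffusion.integrableOn_of_memLp {F : Type*} [NormedAddCommGroup F] (D : Diffusion d)
    {f : E d → F} (hf : MemLp f 2 (volume.restrict D.Ω)) : IntegrableOn f D.Ω := by
  have : IsFiniteMeasure (volume.restrict D.Ω) :=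
    ⟨by simpa using D.Ω_polytopal.isBounded.measure_lt_top⟩
  exact hf.integrable (by norm_num)

/-- In open subsets of the domain, the flux of the weak solution has a weak divergence. -/
theorem weakDiv_of_weakForm {D : Diffusion d} {f : E d → ℝ} {g : E d → E d}
    (h : ∀ v w, IsH10 D.Ω v w → ∫ x in D.Ω, ⟪act (D.field x) (g x), w x⟫ = ∫ x in D.Ω, f x * v x)
    {U : Set (E d)} (hU : IsOpen U) (hUΩ : U ⊆ D.Ω) {q : E d → E d}
    (hq : ∀ᵐ x, x ∈ U → act (D.field x) (g x) = q x) : WeakDiv U q f := by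
  intro φ hφ
  have hφ' := hφ.mono hUΩ
  have h1 := h φ _ hφ'.isH10
  rw [setIntegral_mul_test hφ', ← setIntegral_mul_test hφ] at h1
  rw [← h1]
  have h2 : ∀ V : Set (E d), IsTest V φ → ∫ x in V, ⟪act (D.field x) (g x), gradient φ x⟫ =
      ∫ x, ⟪act (D.field x) (g x), gradient φ x⟫ := fun V hV =>
    setIntegral_eq_integral_of_forall_compl_eq_zero fun x hx => by
      rw [inner_gradient_right, fderiv_eq_zero_of_notMem_tsupport fun h => hx (hV.2.2 h),
        zero_apply]
  rw [h2 _ hφ', ← h2 _ hφ]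
  refine setIntegral_congr_ae hU.measurableSet ?_
  filter_upwards [hq] with x hx hxU
  rw [inner_gradient_right, hx hxU]

/-- A tangential line through `p` stays, near `p`, in the closed half ball, so a one-sided
derivative gives a genuine derivative along it. Comparing both sides of a face yields equal
tangential derivatives. -/
theorem hasDerivAt_of_halfBall {u : E d → ℝ} {L : E d →L[ℝ] ℝ} {p n w : E d} {r : ℝ} (hr : 0 < r)
    (hn : ‖n‖ = 1) (h : HasFDerivWithinAt u L (closure (halfBall p n r)) p) (hw : ⟪w, n⟫ = 0) :
    HasDerivAt (fun t : ℝ => u (p + t • w)) (L w) 0 := by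
  have hγ : HasDerivAt (fun t : ℝ => p + t • w) w 0 := by
    simpa using ((hasDerivAt_id (0 : ℝ)).smul_const w).const_add p
  refine HasFDerivWithinAt.comp_hasDerivAt (t := closure (halfBall p n r)) 0 (by simpa using h) hγ ?_
  have hc : Tendsto (fun t : ℝ => p + t • w) (𝓝 0) (𝓝 p) := by
    have : Continuous fun t : ℝ => p + t • w := by fun_prop
    simpa using this.tendsto 0
  filter_upwards [hc (Metric.ball_mem_nhds p hr)] with t ht
  refine mem_closure_halfBall hn ht ?_
  rw [add_sub_cancel_left, real_inner_smul_left, hw, mul_zero]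

/-! ### Traces of the exact solution on the faces -/

namespace Mesh

variable {D : Diffusion d} {𝒯 ℱ : Type} {M : Mesh D 𝒯 ℱ} {T T' : 𝒯} {F : ℱ} {p : E d}

theorem closure_cell_subset (T : 𝒯) : closure (M.cell T) ⊆ closure (D.part (M.region T)) :=
  closure_mono (M.cell_subset T)

theorem isOpen_part (i : Fin D.N) : IsOpen (D.part i) := (D.part_polytopal i).isOpen

theorem face_subset_closure_cell (h : M.Bd T F) : M.face F ⊆ closure (M.cell T) :=
  subset_closure.trans ((closure_face_subset_frontier h).trans frontier_subset_closure)

theorem segment_subset_cell {z : E d} (hz : z ∈ M.cell T) : segment ℝ (M.pt T) z ⊆ M.cell T :=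
  (M.cell_star T).segment_subset hz

theorem norm_sub_pt_le {z : E d} (hz : z ∈ closure (M.cell T)) :
    ‖z - M.pt T‖ ≤ Metric.diam (M.cell T) := by
  rw [← Metric.diam_closure, ← dist_eq_norm]
  exact Metric.dist_le_diam_of_mem (M.isCompact_closure_cell T).isBounded hz
    (subset_closure (M.pt_mem T))

section exact

variable {u : E d → ℝ} {G : Fin D.N → E d → E d}

variable (M G) in
/-- The flux `K ∇u` in a cell, for a field `G` of extensions of the gradients. -/
noncomputable def flow (T : 𝒯) (x : E d) : E d := act (M.K T) (G (M.region T) x)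

theorem continuousOn_flow (hG : ∀ i, ContinuousOn (G i) (closure (D.part i))) (T : 𝒯) :
    ContinuousOn (M.flow G T) (closure (M.cell T)) :=
  (continuous_act _).comp_continuousOn ((hG _).mono (closure_cell_subset T))

/-- The mean value inequality on segments from `x_T` holds in the open cell, and continuity of the
extension carries it to the closure. -/
theorem norm_extension_sub_le (hu : ∀ i, IsC2Closure (D.part i) u)
    (hG : ∀ i, ContinuousOn (G i) (closure (D.part i)))
    (hGu : ∀ i, EqOn (G i) (gradient u) (D.part i)) {z : E d} (hz : z ∈ closure (M.cell T)) :
    ‖G (M.region T) z - gradient u (M.pt T)‖ ≤ c2Norm D u * Metric.diam (M.cell T) := by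
  have hc : ContinuousWithinAt (fun z => ‖G (M.region T) z - gradient u (M.pt T)‖) (M.cell T) z :=
    (((hG (M.region T)).mono (closure_cell_subset T) z hz).mono subset_closure).sub
      continuousWithinAt_const |>.norm
  refine hc.closure_le hz continuousWithinAt_const fun y hy => ?_
  rw [hGu _ (M.cell_subset T hy), gradient, gradient, ← map_sub, LinearIsometryEquiv.norm_map]
  have h0 := norm_iteratedFDeriv_le_c2Norm hu (M.region T) (le_refl 2)
    (M.cell_subset T (M.pt_mem T))
  exact (norm_fderiv_sub_le (isOpen_part _) (hu (M.region T)).1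
    (fun x hx => norm_iteratedFDeriv_le_c2Norm hu _ le_rfl hx)
    ((segment_subset_cell hy).trans (M.cell_subset T))).trans
    (mul_le_mul_of_nonneg_left (norm_sub_pt_le (subset_closure hy)) ((norm_nonneg _).trans h0))

theorem abs_taylor_le (hu : ∀ i, IsC2Closure (D.part i) u) (huc : ContinuousOn u (closure D.Ω))
    {z : E d} (hz : z ∈ closure (M.cell T)) :
    |u z - u (M.pt T) - ⟪gradient u (M.pt T), z - M.pt T⟫| ≤
      c2Norm D u * Metric.diam (M.cell T) ^ 2 := by
  have hc : ContinuousWithinAt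
      (fun z => |u z - u (M.pt T) - ⟪gradient u (M.pt T), z - M.pt T⟫|) (M.cell T) z := by
    have h1 : ContinuousWithinAt u (M.cell T) z :=
      (huc z (closure_mono (M.cell_subset_domain T) hz)).mono
        ((M.cell_subset_domain T).trans subset_closure)
    exact ((h1.sub continuousWithinAt_const).sub (Continuous.continuousWithinAt (by fun_prop))).abs
  refine hc.closure_le hz continuousWithinAt_const fun y hy => ?_
  rw [inner_gradient_left]
  have h0 := norm_iteratedFDeriv_le_c2Norm hu (M.region T) (le_refl 2)
    (M.cell_subset T (M.pt_mem T))
  exact (norm_taylor_le (isOpen_part _) (hu (M.region T)).1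
    (fun x hx => norm_iteratedFDeriv_le_c2Norm hu _ le_rfl hx)
    ((segment_subset_cell hy).trans (M.cell_subset T))).trans
    (mul_le_mul_of_nonneg_left (pow_le_pow_left₀ (norm_nonneg _)
      (norm_sub_pt_le (subset_closure hy)) 2) ((norm_nonneg _).trans h0))

theorem tendsto_flow (hG : ∀ i, ContinuousOn (G i) (closure (D.part i))) {n : E d} {r : ℝ}
    (hr : 0 < r) (hs : halfBall p n r ⊆ M.cell T) (hp : p ∈ closure (M.cell T)) :
    Tendsto (M.flow G T) (𝓝[{y | ⟪y - p, n⟫ < 0}] p) (𝓝 (M.flow G T p)) := by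
  refine ((continuousOn_flow hG T p hp).mono (hs.trans subset_closure)).tendsto.mono_left ?_
  exact le_inf nhdsWithin_le_nhds (le_principal_iff.2 (halfBall_mem_nhdsWithin p n hr))

theorem ae_field_eq_flow (hu : ∀ i, IsC2Closure (D.part i) u) {g : E d → E d}
    (hg : HasWeakGrad D.Ω u g) (hGu : ∀ i, EqOn (G i) (gradient u) (D.part i)) (T : 𝒯) :
    ∀ᵐ x, x ∈ M.cell T → act (D.field x) (g x) = M.flow G T x := by
  filter_upwards [hg.ae_eq (M.cell_open T) (M.cell_subset_domain T)
    (((hu (M.region T)).1.of_le (by norm_num)).mono (M.cell_subset T))] with x hx hxT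
  rw [hx hxT, D.field_eq (M.cell_subset T hxT), flow, hGu _ (M.cell_subset T hxT)]
  rfl

theorem weakDiv_flow {f : E d → ℝ} (hu : ∀ i, IsC2Closure (D.part i) u)
    (hw : IsWeakSolution D f u) (hGu : ∀ i, EqOn (G i) (gradient u) (D.part i)) (T : 𝒯) :
    WeakDiv (M.cell T) (M.flow G T) f := by
  obtain ⟨g, hg, h⟩ := hw
  exact weakDiv_of_weakForm h (M.cell_open T) (M.cell_subset_domain T)
    (ae_field_eq_flow hu hg.weakGrad hGu T)

/-- The exact fluxes are continuous through the internal faces. -/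
theorem flow_add_flow_eq_zero [Finite ℱ] {f : E d → ℝ} (hu : ∀ i, IsC2Closure (D.part i) u)
    (hf : MemLp f 2 (volume.restrict D.Ω))
    (hw : IsWeakSolution D f u) (hG : ∀ i, ContinuousOn (G i) (closure (D.part i)))
    (hGu : ∀ i, EqOn (G i) (gradient u) (D.part i)) (hp : M.IsGood F p) (h : M.Bd T F)
    (ha : M.across T F = some T') :
    ⟪M.flow G T p, M.normal T F⟫ + ⟪M.flow G T' p, M.normal T' F⟫ = 0 := by
  obtain ⟨hneg, r, hr, hΩ, h1, h2⟩ := hp.internal h ha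
  have hn := M.normal_norm T F h
  rw [hneg, inner_neg_right, ← sub_eq_add_neg, sub_eq_zero]
  obtain ⟨g, hg, hwg⟩ := hw
  set n := M.normal T F
  let A := halfBall p n r
  let B := halfBall p (-n) r
  have hAm : MeasurableSet A := (isOpen_halfBall _ _ _).measurableSet
  have hBm : MeasurableSet B := (isOpen_halfBall _ _ _).measurableSet
  have hAB : ∀ x, x ∈ A → x ∉ B := fun x hx hx' => by
    have h3 : ⟪x - p, n⟫ < 0 := hx.2
    have h4 : ⟪x - p, -n⟫ < 0 := hx'.2
    rw [inner_neg_right] at h4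
    linarith
  -- The continuous extensions are glued from the two half balls; off the null hyperplane they agree
  -- almost everywhere with the weak flux, so the ball sees a single weak equation.
  let q : E d → E d := fun x => A.indicator (M.flow G T) x + B.indicator (M.flow G T') x
  have hqA : ∀ x ∈ A, q x = M.flow G T x := fun x hx => by
    simp [q, hx, hAB x hx]
  have hqB : ∀ x ∈ B, q x = M.flow G T' x := fun x hx => by
    simp [q, hx, show x ∉ A from fun h => hAB x h hx]
  have hint : ∀ {S : 𝒯} {A : Set (E d)}, MeasurableSet A → A ⊆ M.cell S →
      Integrable (A.indicator (M.flow G S)) := fun {S A} hAm hA =>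
    (integrable_indicator_iff hAm).2 (((continuousOn_flow hG S).integrableOn_compact
      (M.isCompact_closure_cell S)).mono_set (hA.trans subset_closure))
  have hq : Integrable q := (hint hAm h1).add (hint hBm h2)
  have hdiv : WeakDiv (Metric.ball p r) q f := by
    refine weakDiv_of_weakForm hwg Metric.isOpen_ball hΩ ?_
    filter_upwards [ae_field_eq_flow (M := M) hu hg.weakGrad hGu T,
      ae_field_eq_flow (M := M) hu hg.weakGrad hGu T',
      measure_eq_zero_iff_ae_notMem.1 (volume_hyperplane hn p 0)] with x hx hx' hx0 hxB
    rcases lt_or_gt_of_ne (show ⟪x - p, n⟫ ≠ 0 from hx0) with h3 | h3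
    · rw [hqA x ⟨hxB, h3⟩, hx (h1 ⟨hxB, h3⟩)]
    · have : x ∈ B := ⟨hxB, by
        change ⟪x - p, -n⟫ < 0
        rw [inner_neg_right]; linarith⟩
      rw [hqB x this, hx' (h2 this)]
  have hpc : ∀ {S}, M.Bd S F → p ∈ closure (M.cell S) := fun hS => face_subset_closure_cell hS hp.1
  refine hdiv.normal_eq Metric.isOpen_ball hq.integrableOn
    ((D.integrableOn_of_memLp hf).mono_set hΩ) hn (Metric.mem_ball_self hr) ?_ ?_
  · refine (tendsto_flow hG hr h1 (hpc h)).congr' ?_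
    filter_upwards [halfBall_mem_nhdsWithin p n hr] with x hx using (hqA x hx).symm
  · have hset : {y : E d | 0 < ⟪y - p, n⟫} = {y | ⟪y - p, -n⟫ < 0} := by
      ext y
      simp [inner_neg_right]
    rw [hset]
    refine (tendsto_flow hG hr h2 (hpc (M.across_bd ha))).congr' ?_
    filter_upwards [halfBall_mem_nhdsWithin p (-n) hr] with x hx using (hqB x hx).symm

/-- The solution vanishes on the boundary faces. -/
theorem eq_zero_of_boundary [Finite ℱ] [Finite 𝒯] {f : E d → ℝ} (huc : ContinuousOn u (closure D.Ω))
    (hw : IsWeakSolution D f u) (hp : M.IsGood F p) (ha : M.across T F = none) : u p = 0 := by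
  obtain ⟨r, hr, h1, h2⟩ := hp.boundary ha
  obtain ⟨hT, -⟩ := across_none_iff.1 ha
  have h : M.Bd T F := Or.inl hT.symm
  have hn := M.normal_norm T F h
  obtain ⟨g, hg, -⟩ := hw
  set n := M.normal T F
  have hΩm : MeasurableSet D.Ω := D.Ω_polytopal.isOpen.measurableSet
  -- As `u` is in `H¹₀`, its extension by zero has a weak derivative in direction `n` on the whole
  -- space. The normal component of `q` is `u` inside and `0` outside, so its continuity at `p`
  -- gives `u p = 0`.
  let q : E d → E d := D.Ω.indicator fun x => u x • n
  let k : E d → ℝ := D.Ω.indicator fun x => -⟪g x, n⟫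
  have hq : Integrable q := (integrable_indicator_iff hΩm).2
    (((huc.integrableOn_compact D.Ω_polytopal.isBounded.isCompact_closure).mono_set
      subset_closure).smul_const n)
  have hk : Integrable k := (integrable_indicator_iff hΩm).2
    ((D.integrableOn_of_memLp hg.weakGrad.memLp_grad).inner_const n).neg
  have hdiv : WeakDiv univ q k := by
    intro φ hφ
    have h3 := hg.by_parts hφ n
    rw [← integral_neg, ← integral_indicator hΩm, ← integral_indicator hΩm] at h3
    rw [setIntegral_univ, setIntegral_univ]
    calc ∫ x, fderiv ℝ φ x (q x) = ∫ x, D.Ω.indicator (fun x => u x * fderiv ℝ φ x n) x := by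
          refine integral_congr_ae (Eventually.of_forall fun x => ?_)
          by_cases hx : x ∈ D.Ω <;> simp [q, hx]
      _ = _ := h3
      _ = _ := by
          refine integral_congr_ae (Eventually.of_forall fun x => ?_)
          by_cases hx : x ∈ D.Ω <;> simp [k, hx]
  have hpΩ : p ∈ closure D.Ω :=
    closure_mono (M.cell_subset_domain T) (face_subset_closure_cell h hp.1)
  have hTΩ : halfBall p n r ⊆ D.Ω := h1.trans (M.cell_subset_domain T)
  have key := hdiv.normal_eq isOpen_univ hq.integrableOn hk.integrableOn hn (mem_univ p)
    (a := u p • n) (b := 0) ?_ ?_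
  · rwa [real_inner_smul_left, real_inner_self_eq_norm_sq, hn, inner_zero_left, one_pow,
      mul_one] at key
  · have hu1 : Tendsto u (𝓝[{y | ⟪y - p, n⟫ < 0}] p) (𝓝 (u p)) :=
      ((huc p hpΩ).mono (hTΩ.trans subset_closure)).tendsto.mono_left
        (le_inf nhdsWithin_le_nhds (le_principal_iff.2 (halfBall_mem_nhdsWithin p n hr)))
    refine (hu1.smul_const n).congr' ?_
    filter_upwards [halfBall_mem_nhdsWithin p n hr] with x hx
    exact (indicator_of_mem (hTΩ hx) fun x => u x • n).symm
  · have hset : {y : E d | 0 < ⟪y - p, n⟫} = {y | ⟪y - p, -n⟫ < 0} := by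
      ext y
      simp [inner_neg_right]
    rw [hset]
    refine tendsto_const_nhds.congr' ?_
    filter_upwards [halfBall_mem_nhdsWithin p (-n) hr] with x hx
    exact (indicator_of_notMem (disjoint_left.1 h2 hx) fun x => u x • n).symm

/-- On a convex open set, a derivative with a limit at a boundary point is the derivative there
within the closure; the half ball supplies the convexity. -/
theorem hasFDerivWithinAt_halfBall (hu : ∀ i, IsC2Closure (D.part i) u)
    (huc : ContinuousOn u (closure D.Ω)) (hG : ∀ i, ContinuousOn (G i) (closure (D.part i)))
    (hGu : ∀ i, EqOn (G i) (gradient u) (D.part i)) {n : E d} {r : ℝ}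
    (hs : halfBall p n r ⊆ M.cell T) (hp : p ∈ closure (M.cell T)) :
    HasFDerivWithinAt u (InnerProductSpace.toDual ℝ (E d) (G (M.region T) p))
      (closure (halfBall p n r)) p := by
  have hsub := hs.trans (M.cell_subset T)
  refine hasFDerivWithinAt_closure_of_tendsto_fderiv
    (((hu (M.region T)).1.differentiableOn two_ne_zero).mono hsub) (convex_halfBall p n r)
    (isOpen_halfBall p n r) (fun y hy => ?_) ?_
  · exact (huc y (closure_mono (hs.trans (M.cell_subset_domain T)) hy)).mono
      ((hs.trans (M.cell_subset_domain T)).trans subset_closure)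
  · have h1 : Tendsto (G (M.region T)) (𝓝[halfBall p n r] p) (𝓝 (G (M.region T) p)) :=
      ((hG (M.region T)) p (closure_cell_subset T hp)).mono (hsub.trans subset_closure)
    refine (((InnerProductSpace.toDual ℝ (E d)).continuous.tendsto _).comp h1).congr' ?_
    filter_upwards [self_mem_nhdsWithin] with y hy
    rw [Function.comp_apply, hGu _ (hsub hy), toDual_gradient]

/-- The tangential derivatives are continuous through the internal faces. -/
theorem extension_sub_eq_smul_normal [Finite ℱ] (hu : ∀ i, IsC2Closure (D.part i) u)
    (huc : ContinuousOn u (closure D.Ω)) (hG : ∀ i, ContinuousOn (G i) (closure (D.part i)))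
    (hGu : ∀ i, EqOn (G i) (gradient u) (D.part i)) (hp : M.IsGood F p) (h : M.Bd T F)
    (ha : M.across T F = some T') : ∃ μ : ℝ,
      G (M.region T) p - G (M.region T') p = μ • M.normal T' F := by
  obtain ⟨hneg, r, hr, -, h1, h2⟩ := hp.internal h ha
  have h' := M.across_bd ha
  have hn := M.normal_norm T F h
  have hn' := M.normal_norm T' F h'
  rw [← hneg] at h2
  refine ⟨_, eq_inner_smul_of_perp hn' fun w hw => ?_⟩
  have hw' : ⟪w, M.normal T F⟫ = 0 := by
    rw [hneg, inner_neg_right] at hw; linarith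
  have e1 := hasDerivAt_of_halfBall hr hn (hasFDerivWithinAt_halfBall hu huc hG hGu h1
    (face_subset_closure_cell h hp.1)) hw'
  have e2 := hasDerivAt_of_halfBall hr hn' (hasFDerivWithinAt_halfBall hu huc hG hGu h2
    (face_subset_closure_cell h' hp.1)) hw
  have := e1.unique e2
  rw [InnerProductSpace.toDual_apply_apply, InnerProductSpace.toDual_apply_apply] at this
  rw [real_inner_comm, inner_sub_left, this, sub_self]

end exact

end Mesh

end MPFA

/-! ### Consistency of the group gradients and of the fluxes -/

namespace MPFA

variable {d : ℕ}

theorem Diffusion.exists_norm_act_le (D : Diffusion d) :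
    ∃ Λ : ℝ, 0 ≤ Λ ∧ ∀ i x, ‖act (D.tensor i) x‖ ≤ Λ * ‖x‖ := by
  let A : Fin D.N → E d →L[ℝ] E d := fun i =>
    LinearMap.toContinuousLinearMap (Matrix.toEuclideanLin (D.tensor i))
  refine ⟨∑ i, ‖A i‖, Finset.sum_nonneg fun i _ => norm_nonneg _, fun i x => ?_⟩
  exact ((A i).le_opNorm x).trans (mul_le_mul_of_nonneg_right
    (Finset.single_le_sum (f := fun i => ‖A i‖) (fun i _ => norm_nonneg _) (Finset.mem_univ i))
    (norm_nonneg _))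

theorem act_sub (A : Matrix (Fin d) (Fin d) ℝ) (x y : E d) : act A (x - y) = act A x - act A y :=
  map_sub (Matrix.toEuclideanLin A) x y

theorem c2Norm_nonneg {D : Diffusion d} (u : E d → ℝ) : 0 ≤ c2Norm D u :=
  Real.iSup_nonneg fun _ => Real.iSup_nonneg fun _ => Real.iSup_nonneg fun _ => norm_nonneg _

/-- A weak solution which is regular up to the boundary of each subdomain, together with the
extensions of its gradients. -/
structure RegularSolution (D : Diffusion d) (f u : E d → ℝ) (G : Fin D.N → E d → E d) : Prop where
  memLp : MemLp f 2 (volume.restrict D.Ω)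
  weak : IsWeakSolution D f u
  cont : ContinuousOn u (closure D.Ω)
  c2 : ∀ i, IsC2Closure (D.part i) u
  contGrad : ∀ i, ContinuousOn (G i) (closure (D.part i))
  eqGrad : ∀ i, EqOn (G i) (gradient u) (D.part i)

namespace Mesh

variable {D : Diffusion d} {𝒯 ℱ : Type} {M : Mesh D 𝒯 ℱ} {T T' S : 𝒯} {F : ℱ} {p : E d}
  {f u : E d → ℝ} {G : Fin D.N → E d → E d} {Λ η : ℝ}

variable (M) in
theorem diam_le_h [Finite 𝒯] (T : 𝒯) : Metric.diam (M.cell T) ≤ M.h :=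
  le_ciSup (f := fun T => Metric.diam (M.cell T)) (finite_range _).bddAbove T

theorem abs_trans_le (hΛ : ∀ i x, ‖act (D.tensor i) x‖ ≤ Λ * ‖x‖) (h : M.Bd T F) :
    |M.trans T F| ≤ Λ / M.dist T F := by
  have hd := M.dist_pos T F h
  have hn := M.normal_norm T F h
  rw [trans, abs_div, abs_of_pos hd]
  refine div_le_div_of_nonneg_right ?_ hd.le
  refine (abs_real_inner_le_norm _ _).trans ?_
  have := hΛ (M.region T) (M.normal T F)
  rw [hn, mul_one] at this ⊢
  exact this

/-- One unit of the constant is the Taylor remainder at `x_T`, the other the replacement of the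
gradient at `x_T` by the trace at `z`. -/
theorem abs_value_le (hu : RegularSolution D f u G) {z : E d} (hz : z ∈ closure (M.cell T)) :
    |u z - u (M.pt T) - ⟪G (M.region T) z, z - M.pt T⟫| ≤
      2 * c2Norm D u * Metric.diam (M.cell T) ^ 2 := by
  have h1 := abs_taylor_le hu.c2 hu.cont hz
  have h2 : |⟪G (M.region T) z - gradient u (M.pt T), z - M.pt T⟫| ≤
      c2Norm D u * Metric.diam (M.cell T) * Metric.diam (M.cell T) :=
    (abs_real_inner_le_norm _ _).trans (mul_le_mul
      (norm_extension_sub_le hu.c2 hu.contGrad hu.eqGrad hz) (norm_sub_pt_le hz) (norm_nonneg _)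
      (mul_nonneg (c2Norm_nonneg u) Metric.diam_nonneg))
  rw [inner_sub_left] at h2
  rw [abs_le] at h1 h2 ⊢
  constructor <;> nlinarith

/-- Flux continuity eliminates the conormal terms of the row. The jump `μ n_TF` of the traces
contributes `μ K_T n_TF · n_TF`, which the coefficient `K_T n_TF · n_TF / d_TF` of `x_T - x_S`
compensates. The value `u p` is common to both expansions and cancels. -/
theorem inner_row_sub_rhs [Finite ℱ] (hu : RegularSolution D f u G) (hp : M.IsGood F p)
    (h : M.Bd S F) (ha : M.across S F = some T) :
    ⟪M.row S F, G (M.region S) p⟫ - M.rhs S (M.interp u) F = M.trans T F *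
      ((u p - u (M.pt T) - ⟪G (M.region T) p, p - M.pt T⟫) -
        (u p - u (M.pt S) - ⟪G (M.region S) p, p - M.pt S⟫)) := by
  have hT := M.across_bd ha
  have hdist := M.dist_pos T F hT
  have h1 := flow_add_flow_eq_zero hu.c2 hu.memLp hu.weak hu.contGrad hu.eqGrad hp h ha
  obtain ⟨μ, hμ⟩ := extension_sub_eq_smul_normal hu.c2 hu.cont hu.contGrad hu.eqGrad hp h ha
  have hK : ∀ T, (M.K T).IsHermitian := fun T => (D.tensor_posDef _).isHermitian
  have hpT : ⟪p - M.pt T, M.normal T F⟫ = M.dist T F := face_subset_hyperplane hT hp.1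
  have e1 : M.trans T F * M.dist T F = ⟪act (M.K T) (M.normal T F), M.normal T F⟫ :=
    div_mul_cancel₀ _ hdist.ne'
  simp only [flow, act_symm (hK T), act_symm (hK S)] at h1
  have hGS : G (M.region S) p = G (M.region T) p + μ • M.normal T F := by rw [← hμ]; abel
  have e2 : ⟪act (M.K T) (M.normal T F), G (M.region S) p⟫ =
      ⟪act (M.K T) (M.normal T F), G (M.region T) p⟫ + μ * (M.trans T F * M.dist T F) := by
    rw [hGS, inner_add_right, real_inner_smul_right, e1]
  have e3 : ⟪G (M.region S) p, p - M.pt T⟫ =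
      ⟪G (M.region T) p, p - M.pt T⟫ + μ * M.dist T F := by
    rw [hGS, inner_add_left, real_inner_smul_left, real_inner_comm, real_inner_comm _ (M.normal T F),
      hpT, real_inner_comm]
  have e4 : ⟪M.pt T - M.pt S, G (M.region S) p⟫ =
      ⟪G (M.region S) p, p - M.pt S⟫ - ⟪G (M.region S) p, p - M.pt T⟫ := by
    rw [← inner_sub_right, real_inner_comm]
    congr 1
    abel
  simp only [row, rhs, ha, Option.elim_some, inner_add_left, real_inner_smul_left, interp]
  rw [e2, e4, e3, real_inner_comm (G (M.region S) p) (act (M.K S) _),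
    real_inner_comm (G (M.region T) p) (act (M.K T) _)]
  linear_combination h1

theorem across_eq_some (h : M.Bd S F) (h' : M.Bd T F) (hne : T ≠ S) : M.across S F = some T := by
  unfold across
  split_ifs with hc
  · rcases h' with h' | h'
    · exact absurd (h'.symm.trans hc.symm) hne
    · exact h'
  · rcases h with h | h
    · exact absurd h.symm hc
    · rcases h' with h' | h'
      · rw [h']
      · rw [h] at h'
        exact absurd (Option.some_injective _ h').symm hne

variable [Fintype ℱ] {X : Scheme M}

theorem diam_le (hX : X.Regular η) (h : M.Bd T F) : Metric.diam (M.cell T) ≤ η * M.dist T F :=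
  (div_le_iff₀ (M.dist_pos T F h)).1 (hX.diam_le T F h)

/-- One factor `η` compares the diameter with the distance in `S`, the other the distances on the
two sides of the face. -/
theorem diam_neighbor_le (hη : 0 ≤ η) (hX : X.Regular η) (h : M.Bd S F) (h' : M.Bd T F)
    (hne : S ≠ T) : Metric.diam (M.cell S) ≤ η ^ 2 * M.dist T F := by
  have h1 := diam_le hX h
  have h2 := (div_le_iff₀ (M.dist_pos T F h')).1 (hX.dist_le S T F h h' hne)
  nlinarith

theorem norm_row_le (hη : 0 ≤ η) (hX : X.Regular η) (hΛ0 : 0 ≤ Λ)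
    (hΛ : ∀ i x, ‖act (D.tensor i) x‖ ≤ Λ * ‖x‖) (h : M.Bd S F) (ha : M.across S F = some T) :
    ‖M.row S F‖ ≤ Λ * (η + η ^ 2 + 2) := by
  have hT := M.across_bd ha
  have hdist := M.dist_pos T F hT
  obtain ⟨p, hp⟩ := M.face_nonempty F
  have h1 : ‖M.pt T - M.pt S‖ ≤ (η + η ^ 2) * M.dist T F := by
    have e : M.pt T - M.pt S = (p - M.pt S) - (p - M.pt T) := by abel
    rw [e]
    refine (norm_sub_le _ _).trans ?_
    have := norm_sub_pt_le (face_subset_closure_cell h hp)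
    have := norm_sub_pt_le (face_subset_closure_cell hT hp)
    linarith [diam_le hX hT, diam_neighbor_le hη hX h hT (M.across_ne ha).symm]
  have h2 : ‖M.trans T F • (M.pt T - M.pt S)‖ ≤ Λ * (η + η ^ 2) := by
    rw [norm_smul, Real.norm_eq_abs]
    refine (mul_le_mul (abs_trans_le hΛ hT) h1 (norm_nonneg _) (by positivity)).trans_eq ?_
    field_simp
  have h3 : ∀ {T}, M.Bd T F → ‖act (M.K T) (M.normal T F)‖ ≤ Λ := fun {T} hT => by
    have := hΛ (M.region T) (M.normal T F)
    rwa [M.normal_norm T F hT, mul_one] at this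
  simp only [row, ha, Option.elim_some]
  refine (norm_add₃_le ..).trans ?_
  linarith [h3 h, h3 hT]

/-- The gradient of the exact solution at `x_S` almost solves the group system. -/
theorem abs_residual_le [Finite 𝒯] (hu : RegularSolution D f u G) (hη : 0 ≤ η) (hX : X.Regular η)
    (hΛ0 : 0 ≤ Λ) (hΛ : ∀ i x, ‖act (D.tensor i) x‖ ≤ Λ * ‖x‖) (h : M.Bd S F) :
    |⟪M.row S F, gradient u (M.pt S)⟫ - M.rhs S (M.interp u) F| ≤
      Λ * (3 * (η + η ^ 2) + 2) * c2Norm D u * M.h := by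
  have hc := c2Norm_nonneg (D := D) u
  have hh : 0 ≤ M.h := Metric.diam_nonneg.trans (M.diam_le_h S)
  have hS0 : 0 ≤ Metric.diam (M.cell S) := Metric.diam_nonneg
  cases ha : M.across S F with
  | some T =>
    have hT := M.across_bd ha
    have hdist := M.dist_pos T F hT
    obtain ⟨p, hp⟩ := exists_isGood (M := M) F
    have hT0 : 0 ≤ Metric.diam (M.cell T) := Metric.diam_nonneg
    have h1 : |⟪M.row S F, G (M.region S) p⟫ - M.rhs S (M.interp u) F| ≤
        2 * Λ * (η + η ^ 2) * c2Norm D u * M.h := by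
      rw [inner_row_sub_rhs hu hp h ha, abs_mul]
      have h2 := (abs_sub _ _).trans (add_le_add
        (abs_value_le hu (face_subset_closure_cell hT hp.1))
        (abs_value_le hu (face_subset_closure_cell h hp.1)))
      have h3 : 2 * c2Norm D u * Metric.diam (M.cell T) ^ 2 +
          2 * c2Norm D u * Metric.diam (M.cell S) ^ 2 ≤
          2 * c2Norm D u * ((η + η ^ 2) * M.dist T F * M.h) := by
        have h4 := mul_le_mul (diam_le hX hT) (M.diam_le_h T) hT0 (by positivity)
        have h5 := mul_le_mul (diam_neighbor_le hη hX h hT (M.across_ne ha).symm) (M.diam_le_h S)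
          hS0 (by positivity)
        rw [← mul_add]
        exact mul_le_mul_of_nonneg_left (by nlinarith) (by positivity)
      refine (mul_le_mul (abs_trans_le hΛ hT) (h2.trans h3) (abs_nonneg _)
        (by positivity)).trans_eq ?_
      field_simp
    -- The trace at `p` is exchanged for the gradient at `x_S`. The two contributions `2 (η + η²)`
    -- and `η + η² + 2` add up to the constant of the statement.
    have h6 : |⟪M.row S F, G (M.region S) p - gradient u (M.pt S)⟫| ≤
        Λ * (η + η ^ 2 + 2) * (c2Norm D u * M.h) :=
      (abs_real_inner_le_norm _ _).trans (mul_le_mul (norm_row_le hη hX hΛ0 hΛ h ha)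
        ((norm_extension_sub_le hu.c2 hu.contGrad hu.eqGrad
          (face_subset_closure_cell h hp.1)).trans
            (mul_le_mul_of_nonneg_left (M.diam_le_h S) hc)) (norm_nonneg _) (by positivity))
    rw [inner_sub_right] at h6
    rw [abs_le] at h1 h6 ⊢
    constructor <;> nlinarith
  | none =>
    have hdist := M.dist_pos S F h
    -- As `u` vanishes on the face, Taylor's formula bounds this affine function almost everywhere
    -- on it. The bound defines a closed convex set, which therefore contains the centre of mass.
    have hmem : M.facePt F ∈ {z | |⟪gradient u (M.pt S), z - M.pt S⟫ + u (M.pt S)| ≤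
        c2Norm D u * Metric.diam (M.cell S) ^ 2} := by
      refine Convex.set_average_mem (s := {z | |⟪gradient u (M.pt S), z - M.pt S⟫ + u (M.pt S)| ≤
        c2Norm D u * Metric.diam (M.cell S) ^ 2}) ?_ (isClosed_le (by fun_prop) continuous_const)
        (measure_face_pos F).ne' (measure_face_lt_top F).ne ?_ ?_
      · intro x hx y hy a b ha hb hab
        rw [mem_ofPred_eq, abs_le] at hx hy ⊢
        have e : a • x + b • y - M.pt S = a • (x - M.pt S) + b • (y - M.pt S) := by
          have : M.pt S = (a + b) • M.pt S := by rw [hab, one_smul]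
          nth_rewrite 1 [this]
          module
        rw [e, inner_add_right, real_inner_smul_right, real_inner_smul_right]
        have hb' : b = 1 - a := by linarith
        subst hb'
        constructor <;> nlinarith
      · filter_upwards [ae_isGood (M := M) F] with z hz
        have h1 := abs_taylor_le hu.c2 hu.cont (face_subset_closure_cell h hz.1)
        rw [eq_zero_of_boundary hu.cont hu.weak hz ha, ← abs_neg] at h1
        convert h1 using 2
        ring
      · have : IsFiniteMeasure ((μHE[d - 1] : Measure (E d)).restrict (M.face F)) :=
          ⟨by simpa using measure_face_lt_top F⟩
        obtain ⟨R, hR⟩ := (M.isCompact_closure_cell S).isBounded.exists_norm_le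
        refine Integrable.of_bound (C := R) aestronglyMeasurable_id ?_
        exact (ae_restrict_iff' (measurableSet_face F)).2 (Eventually.of_forall fun z hz =>
          hR z (face_subset_closure_cell h hz))
    have e : ⟪M.row S F, gradient u (M.pt S)⟫ - M.rhs S (M.interp u) F = M.trans S F *
        (⟪gradient u (M.pt S), M.facePt F - M.pt S⟫ + u (M.pt S)) := by
      simp only [row, rhs, ha, Option.elim_none, real_inner_smul_left, interp]
      rw [real_inner_comm]
      ring
    rw [e, abs_mul]
    have h4 := mul_le_mul (diam_le hX h) (M.diam_le_h S) hS0 (by positivity)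
    have h5 : c2Norm D u * Metric.diam (M.cell S) ^ 2 ≤
        c2Norm D u * (η * M.dist S F * M.h) := by
      rw [pow_two]
      exact mul_le_mul_of_nonneg_left h4 hc
    refine (mul_le_mul (abs_trans_le hΛ h) (hmem.trans h5) (abs_nonneg _) (by positivity)).trans ?_
    have e2 : Λ / M.dist S F * (c2Norm D u * (η * M.dist S F * M.h)) =
        Λ * η * c2Norm D u * M.h := by field_simp
    rw [e2]
    gcongr
    nlinarith [sq_nonneg η]

/-- The error is the inverse group matrix applied to the residual, whose `d` entries are uniformly
bounded; hence the factor `√d`. -/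
theorem norm_baseGrad_sub_le [Finite 𝒯] (hu : RegularSolution D f u G) (hη : 0 ≤ η)
    (hX : X.Regular η) (hΛ0 : 0 ≤ Λ) (hΛ : ∀ i x, ‖act (D.tensor i) x‖ ≤ Λ * ‖x‖) {A : Finset ℱ}
    (hA : A.card = d) (hAS : ∀ F ∈ A, M.Bd S F) (hinv : (M.groupOp S A).IsInvertible) :
    ‖M.baseGrad S A (M.interp u) - gradient u (M.pt S)‖ ≤
      ‖(M.groupOp S A).inverse‖ * (√d * (Λ * (3 * (η + η ^ 2) + 2) * c2Norm D u * M.h)) := by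
  have hh : 0 ≤ M.h := Metric.diam_nonneg.trans (M.diam_le_h S)
  have hc := c2Norm_nonneg (D := D) u
  set R := Λ * (3 * (η + η ^ 2) + 2) * c2Norm D u * M.h
  have hR : 0 ≤ R := by positivity
  have e1 : M.baseGrad S A (M.interp u) - gradient u (M.pt S) = (M.groupOp S A).inverse
      (M.groupRhs S A (M.interp u) - M.groupOp S A (gradient u (M.pt S))) := by
    obtain ⟨e, he⟩ := hinv
    rw [baseGrad, map_sub, ← he]
    simp
  rw [e1]
  refine (ContinuousLinearMap.le_opNorm _ _).trans
    (mul_le_mul_of_nonneg_left ?_ (norm_nonneg _))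
  rw [EuclideanSpace.norm_eq]
  refine (Real.sqrt_le_sqrt (y := d * R ^ 2) ?_).trans_eq ?_
  · refine (Finset.sum_le_card_nsmul _ _ (R ^ 2) fun F _ => ?_).trans_eq ?_
    · refine pow_le_pow_left₀ (norm_nonneg _) ?_ 2
      have e2 : ∀ a : E d, (M.groupOp S A a) F = ⟪M.row S F, a⟫ := fun a => by
        simp [groupOp, groupMatrix, Matrix.toLpLin_apply, Matrix.mulVec, dotProduct,
          PiLp.inner_apply, mul_comm]
      rw [Real.norm_eq_abs, PiLp.sub_apply, e2, abs_sub_comm]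
      exact abs_residual_le hu hη hX hΛ0 hΛ (hAS F F.2)
    · rw [Finset.card_univ, Fintype.card_coe, hA, nsmul_eq_mul]
  · rw [Real.sqrt_mul (Nat.cast_nonneg d), Real.sqrt_sq hR]

/-- Consistency of the fluxes of a group. -/
theorem abs_groupFlux_sub_le [Finite 𝒯] (hu : RegularSolution D f u G) (hη : 0 ≤ η)
    (hX : X.Regular η) (hΛ0 : 0 ≤ Λ) (hΛ : ∀ i x, ‖act (D.tensor i) x‖ ≤ Λ * ‖x‖) {A : Finset ℱ}
    (hF : F ∈ A) (hA : A.card = d) (hAS : ∀ F ∈ A, M.Bd S F)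
    (hinv : (M.groupOp S A).IsInvertible) (h : M.Bd T F) (hp : M.IsGood F p) :
    |⟪act (M.K T) (M.groupGrad S A (M.interp u) T F), M.normal T F⟫ -
        ⟪M.flow G T p, M.normal T F⟫| ≤
      Λ * (‖(M.groupOp S A).inverse‖ * (√d * (Λ * (3 * (η + η ^ 2) + 2))) + 1) *
        (c2Norm D u * M.h) := by
  have hS := hAS F hF
  have key : |⟪act (M.K S) (M.groupGrad S A (M.interp u) S F), M.normal S F⟫ -
        ⟪M.flow G S p, M.normal S F⟫| ≤
      Λ * (‖(M.groupOp S A).inverse‖ * (√d * (Λ * (3 * (η + η ^ 2) + 2))) + 1) *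
        (c2Norm D u * M.h) := by
    rw [groupGrad_self, flow, ← inner_sub_left, ← act_sub]
    refine (abs_real_inner_le_norm _ _).trans ?_
    rw [M.normal_norm S F hS, mul_one]
    refine (hΛ _ _).trans ?_
    rw [mul_assoc]
    refine mul_le_mul_of_nonneg_left ?_ hΛ0
    have h1 := norm_baseGrad_sub_le hu hη hX hΛ0 hΛ hA hAS hinv
    have h2 := norm_extension_sub_le hu.c2 hu.contGrad hu.eqGrad (face_subset_closure_cell hS hp.1)
    have h3 := mul_le_mul_of_nonneg_left (M.diam_le_h S) (c2Norm_nonneg (D := D) u)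
    have h4 := norm_sub_le (M.baseGrad S A (M.interp u) - gradient u (M.pt S))
      (G (M.region S) p - gradient u (M.pt S))
    rw [sub_sub_sub_cancel_right] at h4
    linarith
  by_cases hTS : T = S
  · subst hTS
    exact key
  · have ha := across_eq_some hS h hTS
    have h1 := M.groupGrad_flux (M.interp u) hinv hF ha
    have h2 := flow_add_flow_eq_zero hu.c2 hu.memLp hu.weak hu.contGrad hu.eqGrad hp hS ha
    rw [← abs_neg]
    convert key using 2
    linarith

/-- Consistency of the numerical fluxes. -/
theorem abs_flux_sub_le [Finite 𝒯] (hu : RegularSolution D f u G) (hη : 0 ≤ η)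
    (hX : X.Regular η) (hΛ0 : 0 ≤ Λ) (hΛ : ∀ i x, ‖act (D.tensor i) x‖ ≤ Λ * ‖x‖)
    (h : M.Bd T F) :
    |X.flux T F (M.interp u) -
        -∫ z in M.face F, ⟪M.flow G T z, M.normal T F⟫ ∂(μHE[d - 1] : Measure (E d))| ≤
      Λ * (η * (√d * (Λ * (3 * (η + η ^ 2) + 2))) + 1) * (c2Norm D u * M.h) * M.area F := by
  have hh : 0 ≤ M.h := Metric.diam_nonneg.trans (M.diam_le_h T)
  have hc := c2Norm_nonneg (D := D) u
  have hfin : IsFiniteMeasure ((μHE[d - 1] : Measure (E d)).restrict (M.face F)) :=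
    ⟨by simpa using measure_face_lt_top F⟩
  set t : Finset ℱ → ℝ := fun A =>
    ⟪act (M.K T) (M.groupGrad (X.TG A) A (M.interp u) T F), M.normal T F⟫ with ht
  set B := √d * (Λ * (3 * (η + η ^ 2) + 2)) with hB
  have hB0 : 0 ≤ B := by positivity
  -- The estimate is made pointwise and then integrated over the face. The weights sum to one, which
  -- gives the term `1`, and the weighted norms of the inverses give `η`.
  have hpt : ∀ p, M.IsGood F p → |(∑ A ∈ M.groups X.TG F, X.θ F A * t A) -
      ⟪M.flow G T p, M.normal T F⟫| ≤ Λ * (η * B + 1) * (c2Norm D u * M.h) := by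
    intro p hp
    have e : (∑ A ∈ M.groups X.TG F, X.θ F A * t A) - ⟪M.flow G T p, M.normal T F⟫ =
        ∑ A ∈ M.groups X.TG F, X.θ F A * (t A - ⟪M.flow G T p, M.normal T F⟫) := by
      simp only [mul_sub, Finset.sum_sub_distrib, ← Finset.sum_mul, X.θ_sum F, one_mul]
    rw [e]
    calc _ ≤ ∑ A ∈ M.groups X.TG F, X.θ F A *
          (Λ * (‖(M.groupOp (X.TG A) A).inverse‖ * B + 1) * (c2Norm D u * M.h)) := by
          refine (Finset.abs_sum_le_sum_abs _ _).trans (Finset.sum_le_sum fun A hA => ?_)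
          have hθ := X.θ_nonneg F A hA
          rw [abs_mul, abs_of_nonneg hθ]
          refine mul_le_mul_of_nonneg_left ?_ hθ
          simp only [groups, Finset.mem_filter, Finset.mem_univ, true_and] at hA
          exact abs_groupFlux_sub_le hu hη hX hΛ0 hΛ hA.1 hA.2.1.1 (X.TG_spec A hA.2.1) hA.2.2 h hp
      _ = Λ * ((∑ A ∈ M.groups X.TG F, X.θ F A * ‖(M.groupOp (X.TG A) A).inverse‖) * B +
          ∑ A ∈ M.groups X.TG F, X.θ F A) * (c2Norm D u * M.h) := by
          rw [Finset.sum_mul, ← Finset.sum_add_distrib, Finset.mul_sum, Finset.sum_mul]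
          exact Finset.sum_congr rfl fun A _ => by ring
      _ ≤ _ := by
          rw [X.θ_sum F]
          have := hX.inverse_le F
          gcongr
  have hint : IntegrableOn (fun z => ⟪M.flow G T z, M.normal T F⟫) (M.face F)
      (μHE[d - 1] : Measure (E d)) := by
    have hcont : ContinuousOn (fun z => ⟪M.flow G T z, M.normal T F⟫) (closure (M.cell T)) :=
      (continuousOn_flow hu.contGrad T).inner continuousOn_const
    obtain ⟨R, hR⟩ := (M.isCompact_closure_cell T).exists_bound_of_continuousOn hcont
    refine Integrable.of_bound (C := R) ((hcont.mono
      (face_subset_closure_cell h)).aestronglyMeasurable (measurableSet_face F)) ?_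
    exact (ae_restrict_iff' (measurableSet_face F)).2 (Eventually.of_forall fun z hz =>
      hR z (face_subset_closure_cell h hz))
  have e : X.flux T F (M.interp u) -
      -∫ z in M.face F, ⟪M.flow G T z, M.normal T F⟫ ∂(μHE[d - 1] : Measure (E d)) =
      -∫ z in M.face F, ((∑ A ∈ M.groups X.TG F, X.θ F A * t A) -
        ⟪M.flow G T z, M.normal T F⟫) ∂(μHE[d - 1] : Measure (E d)) := by
    rw [integral_sub (integrable_const _) hint, setIntegral_const, Scheme.flux, Mesh.flux,
      smul_eq_mul, ← area, Finset.mul_sum, neg_sub, sub_neg_eq_add, add_comm, sub_eq_add_neg,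
      ← Finset.sum_neg_distrib]
    congr 1
    exact Finset.sum_congr rfl fun A _ => by rw [ht]; ring
  rw [e, abs_neg, ← Real.norm_eq_abs]
  refine norm_setIntegral_le_of_norm_le_const_ae (measure_face_lt_top F) ?_
  filter_upwards [ae_isGood (M := M) F] with p hp using hpt p hp

end Mesh

end MPFA

/-! ### Conservativity, discrete integration by parts and the error bound -/

namespace MPFA

variable {d : ℕ}

theorem Diffusion.exists_le_minEig (hd : 1 ≤ d) (D : Diffusion d) :
    ∃ l : ℝ, 0 < l ∧ ∀ i, l ≤ D.minEig i := by
  have : Nonempty (Fin d) := ⟨⟨0, hd⟩⟩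
  have hpos : ∀ i, 0 < D.minEig i := fun i => by
    obtain ⟨j, hj⟩ := exists_eq_ciInf_of_finite
      (f := fun j => (D.tensor_posDef i).isHermitian.eigenvalues j)
    rw [Diffusion.minEig, ← hj]
    exact (D.tensor_posDef i).eigenvalues_pos j
  rcases isEmpty_or_nonempty (Fin D.N) with h | h
  -- Without subdomains the bound is vacuous, and any positive number serves.
  · exact ⟨1, one_pos, fun i => h.elim i⟩
  · obtain ⟨i, hi⟩ := Finite.exists_min D.minEig
    exact ⟨_, hpos i, hi⟩

namespace Mesh

variable {D : Diffusion d} {𝒯 ℱ : Type} {M : Mesh D 𝒯 ℱ} {T T' S : 𝒯} {F : ℱ}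
  {f u : E d → ℝ} {G : Fin D.N → E d → E d} {Λ η : ℝ}

theorem faceDist_pos (F : ℱ) : 0 < M.faceDist F := by
  have h := M.dist_pos _ F (M.bd_owner F)
  unfold faceDist
  cases hn : M.neighbor F with
  | none => simpa using h
  | some T' => exact add_pos h (M.dist_pos T' F (Or.inr hn))

theorem le_faceMinEig {l : ℝ} (hl : ∀ i, l ≤ D.minEig i) (F : ℱ) : l ≤ M.faceMinEig F := by
  unfold faceMinEig
  cases M.neighbor F with
  | none => exact hl _
  | some T' => exact le_min (hl _) (hl _)

theorem rhs_sub (v w : 𝒯 → ℝ) (S : 𝒯) (F : ℱ) :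
    M.rhs S (v - w) F = M.rhs S v F - M.rhs S w F := by
  unfold rhs
  cases M.across S F <;> simp <;> ring

theorem baseGrad_sub (S : 𝒯) (A : Finset ℱ) (v w : 𝒯 → ℝ) :
    M.baseGrad S A (v - w) = M.baseGrad S A v - M.baseGrad S A w := by
  have : M.groupRhs S A (v - w) = M.groupRhs S A v - M.groupRhs S A w := by
    ext F
    simpa [groupRhs] using rhs_sub v w S (F : ℱ)
  rw [baseGrad, this, map_sub]
  rfl

theorem groupGrad_sub (S : 𝒯) (A : Finset ℱ) (v w : 𝒯 → ℝ) (T : 𝒯) (F : ℱ) :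
    M.groupGrad S A (v - w) T F = M.groupGrad S A v T F - M.groupGrad S A w T F := by
  unfold groupGrad
  split_ifs
  · exact baseGrad_sub S A v w
  · rw [baseGrad_sub, inner_sub_left]
    simp only [Pi.sub_apply]
    rw [add_sub_add_comm, ← sub_smul, ← sub_div]
    congr 3
    ring

variable [Fintype ℱ] {X : Scheme M}

theorem flux_sub (v w : 𝒯 → ℝ) (T : 𝒯) (F : ℱ) :
    X.flux T F (v - w) = X.flux T F v - X.flux T F w := by
  simp only [Scheme.flux, flux]
  rw [← Finset.sum_sub_distrib]
  refine Finset.sum_congr rfl fun A _ => ?_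
  rw [groupGrad_sub, act_sub, inner_sub_left]
  ring

/-- The cell of a group containing `F` is one of the two cells next to `F`; in either case flux
continuity holds group by group, and the weights are common to both sides. -/
theorem flux_neighbor (v : 𝒯 → ℝ) (hT : M.neighbor F = some T) :
    X.flux T F v = -X.flux (M.owner F) F v := by
  simp only [Scheme.flux, flux]
  rw [← Finset.sum_neg_distrib]
  refine Finset.sum_congr rfl fun A hA => ?_
  simp only [groups, Finset.mem_filter, Finset.mem_univ, true_and] at hA
  have hne : T ≠ M.owner F := by
    rintro rfl
    exact M.neighbor_ne F hT
  have hbd : M.Bd T F := Or.inr hT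
  have key : ⟪act (M.K T) (M.groupGrad (X.TG A) A v T F), M.normal T F⟫ +
      ⟪act (M.K (M.owner F)) (M.groupGrad (X.TG A) A v (M.owner F) F), M.normal (M.owner F) F⟫
        = 0 := by
    rcases X.TG_spec A hA.2.1 F hA.1 with h | h
    · rw [← h] at hA ⊢
      exact M.groupGrad_flux v hA.2.2 hA.1 (across_eq_some (M.bd_owner F) hbd hne)
    · have hTG : X.TG A = T := Option.some_injective _ (h.symm.trans hT)
      rw [hTG] at hA ⊢
      rw [add_comm]
      exact M.groupGrad_flux v hA.2.2 hA.1 (across_eq_some hbd (M.bd_owner F) hne.symm)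
  linear_combination (-X.θ F A * M.area F) * key

theorem integral_flow_neighbor (hu : RegularSolution D f u G) (hT : M.neighbor F = some T) :
    ∫ z in M.face F, ⟪M.flow G T z, M.normal T F⟫ ∂(μHE[d - 1] : Measure (E d)) =
      -∫ z in M.face F, ⟪M.flow G (M.owner F) z, M.normal (M.owner F) F⟫
        ∂(μHE[d - 1] : Measure (E d)) := by
  rw [← integral_neg]
  refine integral_congr_ae ?_
  filter_upwards [ae_isGood (M := M) F] with p hp
  have hne : T ≠ M.owner F := by
    rintro rfl
    exact M.neighbor_ne F hT
  have := flow_add_flow_eq_zero hu.c2 hu.memLp hu.weak hu.contGrad hu.eqGrad hp (M.bd_owner F)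
    (across_eq_some (M.bd_owner F) (Or.inr hT) hne)
  linarith

/-- Rearrangement of a sum over the cells and their faces as a sum over the faces. -/
theorem sum_cells_faces [Fintype 𝒯] (a : 𝒯 → ℱ → ℝ) :
    ∑ T, ∑ F ∈ M.facesOf T, a T F =
      ∑ F, (a (M.owner F) F + (M.neighbor F).elim 0 fun T => a T F) := by
  classical
  simp only [facesOf, Finset.sum_filter]
  rw [Finset.sum_comm]
  refine Finset.sum_congr rfl fun F _ => ?_
  rw [← Finset.sum_filter]
  cases hn : M.neighbor F with
  | none =>
    have : (Finset.univ.filter fun T => M.Bd T F) = {M.owner F} := by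
      ext T
      simp [Bd, hn, eq_comm]
    rw [this, Finset.sum_singleton, Option.elim_none, add_zero]
  | some T' =>
    have hne : M.owner F ≠ T' := by
      rintro rfl
      exact M.neighbor_ne F hn
    have : (Finset.univ.filter fun T => M.Bd T F) = {M.owner F, T'} := by
      ext T
      simp [Bd, hn, eq_comm]
    rw [this, Finset.sum_pair hne, Option.elim_some]

/-- Discrete integration by parts. -/
theorem sum_cells_mul_fluxes [Fintype 𝒯] (Φ : 𝒯 → ℱ → ℝ)
    (hΦ : ∀ F T, M.neighbor F = some T → Φ T F = -Φ (M.owner F) F) (v : 𝒯 → ℝ) :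
    ∑ T, v T * ∑ F ∈ M.facesOf T, Φ T F = ∑ F, Φ (M.owner F) F * M.jump v F := by
  simp only [Finset.mul_sum]
  rw [sum_cells_faces]
  refine Finset.sum_congr rfl fun F _ => ?_
  unfold jump
  cases hn : M.neighbor F with
  | none => simp [mul_comm]
  | some T => rw [Option.elim_some, Option.elim_some, hΦ F T hn]; ring

/-- Splitting `d_F` between the cells of `F` turns the sum into one over cells and their faces,
where the cone volumes bound it cell by cell. -/
theorem sum_area_mul_faceDist_le [Fintype 𝒯] (hd : 1 ≤ d) (M : Mesh D 𝒯 ℱ) :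
    ∑ F, M.area F * M.faceDist F ≤ d * volume.real D.Ω := by
  have h1 := sum_cells_faces (M := M) fun T F => M.area F * M.dist T F
  have h2 : ∀ F, M.area F * M.faceDist F = M.area F * M.dist (M.owner F) F +
      (M.neighbor F).elim 0 fun T => M.area F * M.dist T F := fun F => by
    unfold faceDist
    cases M.neighbor F <;> simp [mul_add]
  simp only [h2]
  rw [← h1]
  have hfin : volume D.Ω ≠ ⊤ := D.Ω_polytopal.isBounded.measure_lt_top.ne
  have h3 : ∑ T, volume.real (M.cell T) ≤ volume.real D.Ω := by
    rw [← measureReal_biUnion_finset (s := Finset.univ) (f := M.cell)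
      (fun T _ T' _ h => M.cell_disjoint T T' h) (fun T _ => (M.cell_open T).measurableSet)
      (fun T _ => (M.volume_cell_lt_top T).ne)]
    exact measureReal_mono (iUnion₂_subset fun T _ => M.cell_subset_domain T) hfin
  calc _ ≤ ∑ T, d * volume.real (M.cell T) :=
        Finset.sum_le_sum fun T _ => sum_area_mul_dist_le hd T
    _ = d * ∑ T, volume.real (M.cell T) := (Finset.mul_sum ..).symm
    _ ≤ _ := mul_le_mul_of_nonneg_left h3 (Nat.cast_nonneg d)

/-- The total jump of a grid function is bounded by its discrete `H¹₀` norm. -/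
theorem sum_area_mul_jump_le [Fintype 𝒯] (hd : 1 ≤ d) {l : ℝ} (hl0 : 0 < l)
    (hl : ∀ i, l ≤ D.minEig i) (v : 𝒯 → ℝ) :
    ∑ F, M.area F * |M.jump v F| ≤ √(d * volume.real D.Ω / l) * M.norm1 v := by
  have hA : ∀ F, 0 ≤ M.area F := fun F => measureReal_nonneg
  have hD : ∀ F, 0 < M.faceDist F := faceDist_pos
  have hE : ∀ F, 0 < M.faceMinEig F := fun F => hl0.trans_le (le_faceMinEig hl F)
  -- The square of each term is the product of the summand of the discrete norm and the weight `|F|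
  -- d_F / λ_F`, whose sum is at most `d |Ω| / l`.
  have hCS := Finset.sum_sq_le_sum_mul_sum_of_sq_le_mul (R := ℝ) Finset.univ
    (r := fun F => M.area F * |M.jump v F|)
    (f := fun F => M.area F * M.faceDist F / M.faceMinEig F)
    (g := fun F => M.faceMinEig F * M.area F * M.faceDist F * (M.jump v F / M.faceDist F) ^ 2)
    (fun F _ => div_nonneg (mul_nonneg (hA F) (hD F).le) (hE F).le)
    (fun F _ => mul_nonneg (mul_nonneg (mul_nonneg (hE F).le (hA F)) (hD F).le) (sq_nonneg _))
    (fun F _ => by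
      have := (hD F).ne'
      have := (hE F).ne'
      refine le_of_eq ?_
      rw [mul_pow, sq_abs]
      field_simp)
  have h1 : ∑ F, M.area F * M.faceDist F / M.faceMinEig F ≤ d * volume.real D.Ω / l := by
    refine le_trans ?_ (div_le_div_of_nonneg_right (sum_area_mul_faceDist_le hd M) hl0.le)
    rw [Finset.sum_div]
    exact Finset.sum_le_sum fun F _ => div_le_div_of_nonneg_left
      (mul_nonneg (hA F) (hD F).le) hl0 (le_faceMinEig hl F)
  rw [norm1, ← Real.sqrt_mul (by positivity)]
  refine Real.le_sqrt_of_sq_le (hCS.trans (mul_le_mul_of_nonneg_right h1 ?_))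
  exact Finset.sum_nonneg fun F _ =>
    mul_nonneg (mul_nonneg (mul_nonneg (hE F).le (hA F)) (hD F).le) (sq_nonneg _)

/-- The error estimate, with an explicit constant. -/
theorem norm1_error_le [Fintype 𝒯] (hd : 1 ≤ d) (hu : RegularSolution D f u G) (hη : 0 ≤ η)
    (hX : X.Regular η) (hΛ0 : 0 ≤ Λ) (hΛ : ∀ i x, ‖act (D.tensor i) x‖ ≤ Λ * ‖x‖) {l : ℝ}
    (hl0 : 0 < l) (hl : ∀ i, l ≤ D.minEig i) {γ : ℝ} (hγ : 0 < γ) (hc : X.Coercive γ)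
    {v : 𝒯 → ℝ} (hv : X.IsSolution f v) :
    M.norm1 (v - M.interp u) ≤ √(d * volume.real D.Ω / l) *
      (Λ * (η * (√d * (Λ * (3 * (η + η ^ 2) + 2))) + 1)) * γ⁻¹ * c2Norm D u * M.h := by
  have hh : 0 ≤ M.h := Real.iSup_nonneg fun _ => Metric.diam_nonneg
  have hN := c2Norm_nonneg (D := D) u
  set Q := Λ * (η * (√d * (Λ * (3 * (η + η ^ 2) + 2))) + 1) with hQ
  have hQ0 : 0 ≤ Q := by positivity
  set e := v - M.interp u with he
  let Φ : 𝒯 → ℱ → ℝ := fun T F =>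
    -∫ z in M.face F, ⟪M.flow G T z, M.normal T F⟫ ∂(μHE[d - 1] : Measure (E d))
  have hbal : ∀ T, ∑ F ∈ M.facesOf T, X.flux T F v = ∑ F ∈ M.facesOf T, Φ T F := fun T => by
    rw [hv T, integral_cell_eq_neg_sum_flux hd (continuousOn_flow hu.contGrad T)
      ((D.integrableOn_of_memLp hu.memLp).mono_set (M.cell_subset_domain T))
      (weakDiv_flow hu.c2 hu.weak hu.eqGrad T), Finset.sum_neg_distrib]
  -- Both conservative families have the same balance in every cell, so testing them with `e` gives
  -- the same result.
  have h1 : ∑ F, X.flux (M.owner F) F v * M.jump e F = ∑ F, Φ (M.owner F) F * M.jump e F := by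
    rw [← sum_cells_mul_fluxes (fun T F => X.flux T F v) (fun F T h => flux_neighbor v h),
      ← sum_cells_mul_fluxes Φ (fun F T h => by simp only [Φ]; rw [integral_flow_neighbor hu h])]
    simp only [hbal]
  have h2 : ∑ F, X.flux (M.owner F) F e * M.jump e F =
      ∑ F, (Φ (M.owner F) F - X.flux (M.owner F) F (M.interp u)) * M.jump e F := by
    simp only [he, flux_sub, sub_mul, Finset.sum_sub_distrib] at h1 ⊢
    rw [h1]
  have h3 : ∑ F, (Φ (M.owner F) F - X.flux (M.owner F) F (M.interp u)) * M.jump e F ≤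
      Q * (c2Norm D u * M.h) * ∑ F, M.area F * |M.jump e F| := by
    rw [Finset.mul_sum]
    refine Finset.sum_le_sum fun F _ => (le_abs_self _).trans ?_
    rw [abs_mul, abs_sub_comm, ← mul_assoc]
    exact mul_le_mul_of_nonneg_right (abs_flux_sub_le hu hη hX hΛ0 hΛ (M.bd_owner F))
      (abs_nonneg _)
  have h4 := (hc e).trans (h2.trans_le (h3.trans (mul_le_mul_of_nonneg_left
    (sum_area_mul_jump_le hd hl0 hl e) (by positivity))))
  have hn0 : 0 ≤ M.norm1 e := Real.sqrt_nonneg _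
  -- The inequality is quadratic in the norm of `e`; one factor is cancelled when it is not zero.
  rcases hn0.eq_or_lt with h0 | h0
  · rw [← h0]; positivity
  · have h5 : γ * M.norm1 e ≤
        Q * (c2Norm D u * M.h) * √(d * volume.real D.Ω / l) := by
      refine le_of_mul_le_mul_right ?_ h0
      linarith
    rw [← le_div_iff₀' hγ] at h5
    refine h5.trans_eq ?_
    field_simp

end Mesh

theorem Scheme.Regular.mono {D : Diffusion d} {𝒯 ℱ : Type} [Fintype ℱ] {M : Mesh D 𝒯 ℱ}
    {X : Scheme M} {η η' : ℝ} (h : X.Regular η) (hη : η ≤ η') : X.Regular η' :=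
  ⟨fun T F hb => (h.diam_le T F hb).trans hη,
    fun T T' F hb hb' hne => (h.dist_le T T' F hb hb' hne).trans hη,
    fun F => (h.inverse_le F).trans hη⟩

end MPFA

open MPFA in
theorem mainTheorem8 {d : ℕ} (hd : 1 ≤ d) (D : Diffusion d) (η : ℝ) :
    ∃ C : ℝ, 0 < C ∧
      ∀ {𝒯 ℱ : Type} [Fintype 𝒯] [Fintype ℱ] (M : Mesh D 𝒯 ℱ) (S : Scheme M)
        (f u : E d → ℝ) (γ : ℝ) (u_h : 𝒯 → ℝ),
        S.Regular η →
        MemLp f 2 (volume.restrict D.Ω) →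
        IsWeakSolution D f u →
        ContinuousOn u (closure D.Ω) →
        (∀ i, IsC2Closure (D.part i) u) →
        0 < γ → S.Coercive γ →
        S.IsSolution f u_h →
        M.norm1 (u_h - M.interp u) ≤ C * γ⁻¹ * c2Norm D u * M.h := by
  obtain ⟨Λ, hΛ0, hΛ⟩ := D.exists_norm_act_le
  obtain ⟨l, hl0, hl⟩ := D.exists_le_minEig hd
  -- The estimates use a nonnegative regularity parameter, and regularity persists when `η` is
  -- enlarged. The final `+ 1` in the constant only makes it positive.
  have hη : 0 ≤ max η 0 := le_max_right _ _
  refine ⟨√(d * volume.real D.Ω / l) * (Λ * (max η 0 *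
    (√d * (Λ * (3 * (max η 0 + max η 0 ^ 2) + 2))) + 1)) + 1, by positivity, ?_⟩
  intro 𝒯 ℱ _ _ M S f u γ u_h hS hf hw huc hu hγ hc hv
  choose G hG hGu using fun i => (hu i).exists_gradient
  refine (Mesh.norm1_error_le hd ⟨hf, hw, huc, hu, hG, hGu⟩ hη (hS.mono (le_max_left _ _)) hΛ0 hΛ
    hl0 hl hγ hc hv).trans ?_
  have hh : 0 ≤ M.h := Real.iSup_nonneg fun _ => Metric.diam_nonneg
  have hN := c2Norm_nonneg (D := D) u
  gcongr
  linarith
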